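/- **Conventions.** $\mathsf{Lat}$ is the category of bounded lattices and bounded lattice homomorphisms. For $R\subseteq X\times Y$, $A\subseteq X$, $B\subseteq Y$ put $\Diamond_R B=R^{-1}[B]$, $\Box_R B=\{x: R[x]\subseteq B\}$, $\blacklozenge_R A=R[A]$, $\blacksquare_R A=\{y: R^{-1}[y]\subseteq A\}$; we write $\Diamond,\Box,\blacklozenge,\blacksquare$ when $R$ is clear (and $\blacklozenge'$ for $R'$), and $-A$ for complements. Put $x\le_X x'$ iff $R[x']\subseteq R[x]$, and $y\le_Y y'$ iff $R^{-1}[y']\subseteq R^{-1}[y]$. Filters are nonempty, and upset/downset means up- /down-closed. A family $\mathcal S$ is a subbasis of closed sets if the complements of its members are a subbasis of the topology. **DH.** A *coherent lattice* is an algebraic complete lattice $X$ whose set $K(X)$ of compact elements is closed under finite meets (so $1\in K(X)$); it carries the Lawson topology. A *coherent map* is a Lawson-continuous map preserving finite meets (including the top) and having a left adjoint that preserves finite meets (including the top). A *DH-space* is a triple $(X,R,Y)$, with $X,Y$ coherent lattices and $R\subseteq X\times Y$, such that: $R[x]$ and $R^{-1}[y]$ are closed, $R[U]$ and $R^{-1}[V]$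 are clopen for clopen $U,V$; $-R[x]$ and $-R^{-1}[y]$ are filters; $R[x]\subseteq R[x']$ implies $x'\le x$; $R^{-1}[y]\subseteq R^{-1}[y']$ implies $y'\le y$. A *DH-morphism* $(X,R,Y)\to(X',R',Y')$ is a pair $(f,g)$ of coherent maps such that: $x\mathrel R y$ implies $f(x)\mathrel{R'}g(y)$; if $x'\mathrel{R'}g(y)$ there is $x\mathrel R y$ with $x'\le f(x)$; if $f(x)\mathrel{R'}y'$ there is $y$ with $x\mathrel R y$ and $y'\le g(y)$. Composition is componentwise. $\mathbb L_{\mathsf{DH}}(X,R,Y)=\mathsf{CLF}(X)$, the clopen filters of $X$ ordered by inclusion, and $\mathbb L_{\mathsf{DH}}(f,g)=f^{-1}$. **GvG.** A *GvG-space* is a triple $\mathcal G=(X,R,Y)$ with $X,Y$ Priestley spaces such that: (1) $x\le x'$ iff $R[x']\subseteq R[x]$; (2) $y\le y'$ iff $R^{-1}[y']\subseteq R^{-1}[y]$; (3) $\blacklozenge U$ is a clopen downset for each clopen upset $U$ of $X$; (4) $\Box V$ is a clopen upset for each clopen downset $V$ of $Y$; (5) if not $x\mathrel R y$, there is $U\in\mathsf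 L\mathcal G$ with $x\in U$, $y\notin\blacklozenge U$; (6) a clopen upset $U$ with $X_0\cap\Box\blacklozenge U\subseteq U$ satisfies $U=\Box\blacklozenge U$; (7) a clopen downset $V$ with $Y_0\cap V\subseteq\blacklozenge\Box V$ satisfies $V=\blacklozenge\Box V$. Here $X_0=\bigcup_y\max R^{-1}[y]$, $Y_0=\bigcup_x\max R[x]$, and $\mathsf L\mathcal G$ is the set of clopen upsets $U=\Box\blacklozenge U$ of $X$, a bounded lattice under inclusion with $U\wedge V=U\cap V$, $U\vee V=\Box\blacklozenge(U\cup V)$. A *GvG-morphism* $(X,R,Y)\to(X',R',Y')$ is a pair of relations $S\subseteq X\times X'$, $T\subseteq Y\times Y'$ such that: (i) $U'\in\mathsf L\mathcal G'$ implies $\Box_SU'\in\mathsf L\mathcal G$ and $\blacklozenge\Box_SU'=\Diamond_T\blacklozenge'U'$; (ii) if not $x\mathrel S x'$, there is $U'\in\mathsf L\mathcal G'$ with $x\in\Box_SU'$, $x'\notin U'$; (iii) if not $y\mathrel T y'$, there is $U'\in\mathsf L\mathcal G'$ with $y\notin\Diamond_T\blacklozenge'U'$, $y'\in\blacklozenge'U'$;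 (iv) if $x\mathrel Ry$, there are $x',y'$ with $x\mathrel Sx'$, $y\mathrel Ty'$, $x'\mathrel{R'}y'$. The composite $(S_2,T_2)\star(S_1,T_1)$ is given by: $x\mathrel{(S_2\star S_1)}z$ iff $x\in\Box_{S_1}\Box_{S_2}U\Rightarrow z\in U$ for all $U\in\mathsf L\mathcal G_3$; $y\mathrel{(T_2\star T_1)}w$ iff $w\in\blacklozenge U\Rightarrow y\in\Diamond_{T_1}\Diamond_{T_2}\blacklozenge U$ for all $U\in\mathsf L\mathcal G_3$. Identities are $(\le_X,\le_Y)$. $\mathbb L_{\mathsf{GvG}}$ sends $\mathcal G$ to $\mathsf L\mathcal G$ and $(S,T)$ to $\Box_S$. **Hg.** For topological spaces $X,Y$, $R\subseteq X\times Y$ and $\mathcal H=(X,R,Y)$ let $\mathsf L\mathcal H$ be the set of closed $A\subseteq X$ with $A=\Box\blacklozenge A$ and $-\blacklozenge A$ closed. For $x\mathrel Ry$, $x$ is *$y$-maximal* if $x\le_Xx'\mathrel Ry$ implies $x'=x$, and $y$ is *$x$-maximal* if $y\le_Yy'$ and $x\mathrel Ry'$ imply $y'=y$. $\mathcal H$ is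 a *Hartung space* if: $\le_X,\le_Y$ are partial orders; $R$ is compact in $X\times Y$; $\mathsf L\mathcal H$ and $\{-\blacklozenge A:A\in\mathsf L\mathcal H\}$ are subbases of closed sets of $X$ and $Y$; $\Box\blacklozenge A$ and $\blacksquare\Diamond B$ are closed for closed $A,B$; if $x\mathrel Ry$, there are $x'\ge_Xx$ that is $y$-maximal and $y'\ge_Yy$ that is $x$-maximal; if not $x\mathrel Ry$, there is $A\in\mathsf L\mathcal H$ with $x\in A$, $y\notin\blacklozenge A$. Hartung morphisms, composition, identities and the functor $\mathbb L_{\mathsf{Hg}}$ (sending $\mathcal H$ to $\mathsf L\mathcal H$ and $(S,T)$ to $\Box_S$) are defined as for GvG-spaces with $\mathsf L\mathcal H$ in place of $\mathsf L\mathcal G$. Joins in $\mathsf L\mathcal H$ are $\Box\blacklozenge(A\cup B)$, meets are intersections. **Urq.** For a topological space $Z$ with quasi-orders $\le_1,\le_2$ put $\phi A=-{\downarrow_2}A$, $\psi A=-{\downarrow_1}A$, and for $\mathcal U=(Z,\le_1,\le_2)$ let $\mathsf L\mathcal U$ be the set of $\le_1$-upsets $C=\psi\phi C$ with $C,\phi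 C$ closed. $\mathcal U$ is an *Urquhart space* if: $Z$ is compact; $x\le_1y$ and $x\le_2y$ imply $x=y$; $\mathsf L\mathcal U\cup\{\phi C:C\in\mathsf L\mathcal U\}$ is a subbasis of closed sets; $\phi(C_1\cap C_2)$ and $\psi(\phi C_1\cap\phi C_2)$ are closed for $C_1,C_2\in\mathsf L\mathcal U$; if $x\not\le_1y$ there is $C\in\mathsf L\mathcal U$ with $x\in C$, $y\notin C$; if $x\not\le_2y$ there is $C\in\mathsf L\mathcal U$ with $x\in\phi C$, $y\notin\phi C$. An *Urquhart morphism* $\mathcal U\to\mathcal U'$ is a pair of relations $P,Q\subseteq Z\times Z'$ such that: $C'\in\mathsf L\mathcal U'$ implies $\Box_PC'\in\mathsf L\mathcal U$ and $\phi\Box_PC'=\Box_Q\phi'C'$; if not $z\mathrel Pz'$ there is $C'\in\mathsf L\mathcal U'$ with $z\in\Box_PC'$, $z'\notin C'$; if not $z\mathrel Qz'$ there is $C'\in\mathsf L\mathcal U'$ with $z\in\Box_Q\phi'C'$, $z'\notin\phi'C'$; $P[z]\cap Q[z]\neq\varnothing$ for all $z$. Composition: $x\mathrel{(P_2\star P_1)}z$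 iff $x\in\Box_{P_1}\Box_{P_2}C\Rightarrow z\in C$, and $y\mathrel{(Q_2\star Q_1)}w$ iff $y\in\Box_{Q_1}\Box_{Q_2}\phi C\Rightarrow w\in\phi C$, for all $C\in\mathsf L\mathcal U_3$; identities are $(\le_1,\le_2)$. $\mathsf L\mathcal U$ is a bounded lattice under inclusion, with $C_1\wedge C_2=C_1\cap C_2$, $C_1\vee C_2=\psi(\phi C_1\cap\phi C_2)$. $\mathbb L_{\mathsf{Urq}}$ sends $\mathcal U$ to $\mathsf L\mathcal U$ and $(P,Q)$ to $\Box_P$. **Plo.** For a topological space $Z$, a reflexive relation $R$ on $Z$ and $\mathcal P=(Z,R)$ let $\mathsf L\mathcal P$ be the set of closed $C=\Box\blacklozenge C$ with $-\blacklozenge C$ closed. $\mathcal P$ is a *Ploščica space* if: $Z$ is compact $T_1$; $\{-C\}\cup\{\blacklozenge C\}$, $C\in\mathsf L\mathcal P$, is a subbasis of the topology; $-\blacklozenge(C_1\cap C_2)$ and $\Box\blacklozenge(C_1\cup C_2)$ are closed for $C_1,C_2\in\mathsf L\mathcal P$; if $R[y]\not\subseteq R[x]$ there is $C\in\mathsf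 L\mathcal P$ with $x\in C$, $y\notin C$; if $R^{-1}[y]\not\subseteq R^{-1}[x]$ there is $C\in\mathsf L\mathcal P$ with $x\notin\blacklozenge C$, $y\in\blacklozenge C$; if $x\mathrel Ry$ there is $z$ with $R[z]\subseteq R[x]$ and $R^{-1}[z]\subseteq R^{-1}[y]$. A *Ploščica morphism* $(Z,R)\to(Z',R')$ is a pair of relations $P,Q\subseteq Z\times Z'$ satisfying (i)–(iii) of the definition of a GvG-morphism with $(P,Q)$ for $(S,T)$ and $\mathsf L\mathcal P$ for $\mathsf L\mathcal G$, and $P[z]\cap Q[z]\ne\varnothing$ for all $z$; composition is given by the same formulas as for GvG-spaces, identities are $(\le_1,\le_2)$ with $x\le_1z$ iff $R[z]\subseteq R[x]$ and $y\le_2z$ iff $R^{-1}[z]\subseteq R^{-1}[y]$. Joins in $\mathsf L\mathcal P$ are $\Box\blacklozenge(C_1\cup C_2)$, meets are intersections. $\mathbb L_{\mathsf{Plo}}$ sends $\mathcal P$ to $\mathsf L\mathcal P$ and $(P,Q)$ to $\Box_P$. **Assignments between the categories.** * $\mathbb G:\mathsf{DH}\to\mathsf{GvG}$. In a coherent lattice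 $Z$, $x$ is *d-prime* if $x\neq1$ and for every finite $M\subseteq K(Z)$ such that $a\vee\bigwedge M=\bigwedge\{a\vee m:m\in M\}$ for all $a\in K(Z)$, $\bigwedge M\le x$ implies $m\le x$ for some $m\in M$. $\mathbb G(X,R,Y)=(X_p,R_p,Y_p)$, where $X_p,Y_p$ are the subspaces of d-prime elements with the restricted orders and $R_p$ is the restriction of $R$; $\mathbb G(f,g)=(S_f,T_g)$, where $x\mathrel{S_f}x'$ iff $f(x)\le x'$ and $y\mathrel{T_g}y'$ iff $g(y)\le y'$. * $\mathbb H:\mathsf{GvG}\to\mathsf{Hg}$. $\mathbb H(X,R,Y)=(X_0,R_0,Y_0)$, where $X_0$ and $Y_0$ carry the subspace topologies of the topologies of open downsets of $X$ and $Y$ and $R_0$ is the restriction of $R$; $\mathbb H(S,T)=(S_0,T_0)$, the restrictions of $S,T$. * $\mathbb U:\mathsf{Hg}\to\mathsf{Urq}$. $\mathbb U(X,R,Y)=(Z,\le_1,\le_2)$, where $Z\subseteq X\times Y$ is the subspace of pairs $(x,y)$ such that $x$ is $y$-maximal and $y$ is $x$-maximal, $(x,y)\le_1(x',y')$ iff $x\le_Xx'$,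 and $(x,y)\le_2(x',y')$ iff $y\le_Yy'$; $\mathbb U(S,T)=(P,Q)$, where $(x,y)\mathrel P(x',y')$ iff $x\mathrel Sx'$, and $(x,y)\mathrel Q(x',y')$ iff $y\mathrel Ty'$. * $\mathbb D:\mathsf{Urq}\to\mathsf{DH}$. $\mathbb D(\mathcal U)=(\mathsf{LC}\,\mathcal U,R_{\mathcal U},\mathsf{RC}\,\mathcal U)$, where $\mathsf{LC}\,\mathcal U$ is the set of closed $\le_1$-upsets $D=\psi\phi D$, $\mathsf{RC}\,\mathcal U$ is the set of closed $\le_2$-upsets $E=\phi\psi E$, both ordered by reverse inclusion and given the Lawson topology, and $D\mathrel{R_{\mathcal U}}E$ iff $D\cap E\ne\varnothing$; $\mathbb D(P,Q)=(f,g)$ with $f(D)=\bigcap\{C'\in\mathsf L\mathcal U':D\subseteq\Box_PC'\}$ and $g(E)=\bigcap\{\phi'C':C'\in\mathsf L\mathcal U',\ E\subseteq\Box_Q\phi'C'\}$. * $\mathbb P:\mathsf{Urq}\to\mathsf{Plo}$. $\mathbb P(Z,\le_1,\le_2)=(Z,R)$, where $x\mathrel Ry$ iff there is $z$ with $x\le_1z$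 and $y\le_2z$; $\mathbb P(P,Q)=(P,Q)$. **Theorem.** $\mathsf{DH},\mathsf{GvG},\mathsf{Hg},\mathsf{Urq},\mathsf{Plo}$ are categories, $\mathbb L_{\mathsf{DH}},\mathbb L_{\mathsf{GvG}},\mathbb L_{\mathsf{Hg}},\mathbb L_{\mathsf{Urq}},\mathbb L_{\mathsf{Plo}}$ are contravariant functors to $\mathsf{Lat}$, and $\mathbb G,\mathbb H,\mathbb U,\mathbb D,\mathbb P$ are well-defined functors. The following are natural isomorphisms: 1. $\gamma:\mathbb L_{\mathsf{DH}}\cong\mathbb L_{\mathsf{GvG}}\circ\mathbb G$, $\gamma(U)=U\cap X_p$; 2. $\delta:\mathbb L_{\mathsf{GvG}}\cong\mathbb L_{\mathsf{Hg}}\circ\mathbb H$, $\delta(U)=U\cap X_0$; 3. $\mu:\mathbb L_{\mathsf{Hg}}\cong\mathbb L_{\mathsf{Urq}}\circ\mathbb U$, $\mu(A)=(A\times Y)\cap Z$; 4. $\xi:\mathbb L_{\mathsf{Urq}}\cong\mathbb L_{\mathsf{DH}}\circ\mathbb D$, $\xi(C)={\uparrow}C=\{D\in\mathsf{LC}\,\mathcal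 U:D\subseteq C\}$; 5. $\pi:\mathbb L_{\mathsf{Urq}}\cong\mathbb L_{\mathsf{Plo}}\circ\mathbb P$, $\pi(C)=C$. Moreover $\mathbb G,\mathbb H,\mathbb U,\mathbb D,\mathbb P$ are equivalences of categories, and $\mathbb L_{\mathsf{DH}},\mathbb L_{\mathsf{GvG}},\mathbb L_{\mathsf{Hg}},\mathbb L_{\mathsf{Urq}},\mathbb L_{\mathsf{Plo}}$ are dual equivalences with $\mathsf{Lat}$. -/

import Mathlib

open CategoryTheory Opposite Topology

universe u

namespace LatDual

/-! ### Operators induced by a relation -/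

section Operators

variable {α β γ δ : Type*}

/-- `□_S U`, the set of points all of whose `S`-successors lie in `U`. -/
def box (S : α → β → Prop) (U : Set β) : Set α := {x | ∀ y, S x y → y ∈ U}

/-- `◇_S U = S⁻¹[U]`. -/
def dia (S : α → β → Prop) (U : Set β) : Set α := {x | ∃ y, S x y ∧ y ∈ U}

/-- `◆_R A = R[A]`. -/
def bdia (R : α → β → Prop) (A : Set α) : Set β := {y | ∃ x, R x y ∧ x ∈ A}

/-- `■_R A`, the set of points all of whose `R`-predecessors lie in `A`. -/
def bbox (R : α → β → Prop) (A : Set α) : Set β := {y | ∀ x, R x y → x ∈ A}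

/-- The composition `S₂ ⋆ S₁` of relations, relative to a family `L` of subsets of the target:
`x (S₂ ⋆ S₁) z` iff `x ∈ □_{S₁} □_{S₂} U` implies `z ∈ U` for each `U ∈ L`. -/
def star (S₁ : α → β → Prop) (S₂ : β → γ → Prop) (L : Set (Set γ)) : α → γ → Prop :=
  fun x z => ∀ U ∈ L, x ∈ box S₁ (box S₂ U) → z ∈ U

/-- The composition `T₂ ⋆ T₁` on the second sort: `y (T₂ ⋆ T₁) w` iff `w ∈ ◆U` implies
`y ∈ ◇_{T₁} ◇_{T₂} ◆U` for each `U ∈ L`. -/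
def costar (T₁ : α → β → Prop) (T₂ : β → γ → Prop) (R : δ → γ → Prop) (L : Set (Set δ)) :
    α → γ → Prop :=
  fun y w => ∀ U ∈ L, w ∈ bdia R U → y ∈ dia T₁ (dia T₂ (bdia R U))

theorem box_mono (S : α → β → Prop) {U V : Set β} (h : U ⊆ V) : box S U ⊆ box S V :=
  fun _ hx y hy => h (hx y hy)

theorem bdia_mono (R : α → β → Prop) {U V : Set α} (h : U ⊆ V) : bdia R U ⊆ bdia R V := by
  rintro y ⟨x, hx, hU⟩
  exact ⟨x, hx, h hU⟩

theorem subset_box_bdia (R : α → β → Prop) (A : Set α) : A ⊆ box R (bdia R A) :=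
  fun x hx _ hy => ⟨x, hy, hx⟩

theorem bdia_box_bdia (R : α → β → Prop) (A : Set α) :
    bdia R (box R (bdia R A)) = bdia R A := by
  apply Set.Subset.antisymm
  · rintro y ⟨x, hx, hA⟩
    exact hA y hx
  · exact bdia_mono R (subset_box_bdia R A)

theorem bdia_union (R : α → β → Prop) (A B : Set α) :
    bdia R (A ∪ B) = bdia R A ∪ bdia R B := by
  ext y
  constructor
  · rintro ⟨x, hx, hA | hB⟩
    · exact Or.inl ⟨x, hx, hA⟩
    · exact Or.inr ⟨x, hx, hB⟩
  · rintro (⟨x, hx, hA⟩ | ⟨x, hx, hA⟩)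
    · exact ⟨x, hx, Or.inl hA⟩
    · exact ⟨x, hx, Or.inr hA⟩

theorem dia_union (R : α → β → Prop) (A B : Set β) :
    dia R (A ∪ B) = dia R A ∪ dia R B := by
  ext y
  constructor
  · rintro ⟨x, hx, hA | hB⟩
    · exact Or.inl ⟨x, hx, hA⟩
    · exact Or.inr ⟨x, hx, hB⟩
  · rintro (⟨x, hx, hA⟩ | ⟨x, hx, hA⟩)
    · exact ⟨x, hx, Or.inl hA⟩
    · exact ⟨x, hx, Or.inr hA⟩

theorem bdia_empty (R : α → β → Prop) : bdia R ∅ = ∅ := by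
  ext y; simp [bdia]

theorem dia_empty (R : α → β → Prop) : dia R ∅ = ∅ := by
  ext y; simp [dia]

theorem box_star (S₁ : α → β → Prop) (S₂ : β → γ → Prop) {L : Set (Set γ)} {U : Set γ}
    (hU : U ∈ L) : box (star S₁ S₂ L) U = box S₁ (box S₂ U) := by
  ext x
  constructor
  · intro h y hy z hz
    exact h z fun W _ hW => hW y hy z hz
  · intro h z hz
    exact hz U hU h

theorem dia_costar (T₁ : α → β → Prop) (T₂ : β → γ → Prop) (R : δ → γ → Prop)
    {L : Set (Set δ)} {U : Set δ} (hU : U ∈ L) :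
    dia (costar T₁ T₂ R L) (bdia R U) = dia T₁ (dia T₂ (bdia R U)) := by
  ext y
  constructor
  · rintro ⟨w, hw, hwU⟩
    exact hw U hU hwU
  · rintro ⟨y', hy', w, hw, hwU⟩
    exact ⟨w, fun W _ hW => ⟨y', hy', w, hw, hW⟩, hwU⟩

theorem star_assoc {ε : Type*} (S₁ : α → β → Prop) (S₂ : β → γ → Prop) (S₃ : γ → ε → Prop)
    {L₃ : Set (Set γ)} {L₄ : Set (Set ε)} (h : ∀ U ∈ L₄, box S₃ U ∈ L₃) :
    star (star S₁ S₂ L₃) S₃ L₄ = star S₁ (star S₂ S₃ L₄) L₄ := by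
  funext x z
  refine propext (forall₂_congr fun U hU => ?_)
  rw [box_star S₁ S₂ (h U hU), box_star S₂ S₃ hU]

theorem star_id_left {I : α → α → Prop} {S : α → β → Prop} {L : Set (Set β)}
    (hI : ∀ U ∈ L, box I (box S U) = box S U)
    (hS : ∀ x x', ¬ S x x' → ∃ U ∈ L, x ∈ box S U ∧ x' ∉ U) : star I S L = S := by
  funext x z
  refine propext ⟨fun h => ?_, fun h U hU hx => ?_⟩
  · by_contra hn
    obtain ⟨U, hU, h1, h2⟩ := hS x z hn
    exact h2 (h U hU (by rwa [hI U hU]))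
  · rw [hI U hU] at hx
    exact hx z h

theorem star_id_right {I : β → β → Prop} {S : α → β → Prop} {L : Set (Set β)}
    (hI : ∀ U ∈ L, box I U = U)
    (hS : ∀ x x', ¬ S x x' → ∃ U ∈ L, x ∈ box S U ∧ x' ∉ U) : star S I L = S := by
  funext x z
  refine propext ⟨fun h => ?_, fun h U hU hx => ?_⟩
  · by_contra hn
    obtain ⟨U, hU, h1, h2⟩ := hS x z hn
    exact h2 (h U hU (by rwa [hI U hU]))
  · rw [hI U hU] at hx
    exact hx z h

end Operators

/-! ### Families of Galois-closed sets and the morphism conditions they share -/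

section Polarity

variable {X Y X' Y' X'' Y'' : Type*}

/-- The first three conditions in the definition of a morphism between two-sorted spaces
`(X, R, Y)` and `(X', R', Y')` with associated lattices of sets `L` and `L'`. -/
structure IsBoxHom (R : X → Y → Prop) (L : Set (Set X)) (R' : X' → Y' → Prop) (L' : Set (Set X'))
    (S : X → X' → Prop) (T : Y → Y' → Prop) : Prop where
  box_mem : ∀ U ∈ L', box S U ∈ L
  bdia_box : ∀ U ∈ L', bdia R (box S U) = dia T (bdia R' U)
  sep_left : ∀ x x', ¬ S x x' → ∃ U ∈ L', x ∈ box S U ∧ x' ∉ U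
  sep_right : ∀ y y', ¬ T y y' → ∃ U ∈ L', y ∉ dia T (bdia R' U) ∧ y' ∈ bdia R' U

/-- The family `L` consists of fixed points of `□_R ◆_R` and is closed under the operations of a
bounded lattice of such fixed points. -/
structure IsPolFamily (R : X → Y → Prop) (L : Set (Set X)) : Prop where
  fix : ∀ U ∈ L, box R (bdia R U) = U
  inter : ∀ U ∈ L, ∀ V ∈ L, U ∩ V ∈ L
  sup : ∀ U ∈ L, ∀ V ∈ L, box R (bdia R (U ∪ V)) ∈ L
  univ : Set.univ ∈ L
  bot : box R (bdia R ∅) ∈ L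

/-- The lattice structure `U ∧ V = U ∩ V`, `U ∨ V = □◆(U ∪ V)`, ordered by inclusion. -/
@[reducible]
def polLattice {R : X → Y → Prop} {L : Set (Set X)} (h : IsPolFamily R L) :
    Lattice {U : Set X // U ∈ L} where
  le U V := U.1 ⊆ V.1
  le_refl _ := Set.Subset.rfl
  le_trans _ _ _ h₁ h₂ := Set.Subset.trans h₁ h₂
  le_antisymm _ _ h₁ h₂ := Subtype.ext (Set.Subset.antisymm h₁ h₂)
  sup U V := ⟨box R (bdia R (U.1 ∪ V.1)), h.sup _ U.2 _ V.2⟩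
  le_sup_left _ _ := Set.subset_union_left.trans (subset_box_bdia R _)
  le_sup_right _ _ := Set.subset_union_right.trans (subset_box_bdia R _)
  sup_le _ _ W h₁ h₂ := by
    have := box_mono R (bdia_mono R (Set.union_subset h₁ h₂))
    rwa [h.fix _ W.2] at this
  inf U V := ⟨U.1 ∩ V.1, h.inter _ U.2 _ V.2⟩
  inf_le_left _ _ := Set.inter_subset_left
  inf_le_right _ _ := Set.inter_subset_right
  le_inf _ _ _ h₁ h₂ := Set.subset_inter h₁ h₂

/-- The bounds: the whole space and `□◆∅`. -/
@[reducible]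
def polBounded {R : X → Y → Prop} {L : Set (Set X)} (h : IsPolFamily R L) :
    @BoundedOrder {U : Set X // U ∈ L} (polLattice h).toLE :=
  letI := polLattice h
  { top := ⟨Set.univ, h.univ⟩
    le_top := fun _ => Set.subset_univ _
    bot := ⟨box R (bdia R ∅), h.bot⟩
    bot_le := fun U => by
      have := box_mono R (bdia_mono R (Set.empty_subset U.1))
      rwa [h.fix _ U.2] at this }

variable {R : X → Y → Prop} {L : Set (Set X)} {R' : X' → Y' → Prop} {L' : Set (Set X')}
  {R'' : X'' → Y'' → Prop} {L'' : Set (Set X'')}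
  {S : X → X' → Prop} {T : Y → Y' → Prop} {S' : X' → X'' → Prop} {T' : Y' → Y'' → Prop}

theorem IsBoxHom.box_sup (hS : IsBoxHom R L R' L' S T) (h : IsPolFamily R L)
    (h' : IsPolFamily R' L') {U V : Set X'} (hU : U ∈ L') (hV : V ∈ L') :
    box S (box R' (bdia R' (U ∪ V))) = box R (bdia R (box S U ∪ box S V)) := by
  have hW := h'.sup U hU V hV
  rw [← h.fix _ (hS.box_mem _ hW), hS.bdia_box _ hW, bdia_box_bdia, bdia_union, dia_union,
    ← hS.bdia_box _ hU, ← hS.bdia_box _ hV, ← bdia_union]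

theorem IsBoxHom.box_bot (hS : IsBoxHom R L R' L' S T) (h : IsPolFamily R L)
    (h' : IsPolFamily R' L') :
    box S (box R' (bdia R' ∅)) = box R (bdia R ∅) := by
  rw [← h.fix _ (hS.box_mem _ h'.bot), hS.bdia_box _ h'.bot, bdia_box_bdia, bdia_empty,
    dia_empty, bdia_empty]

theorem box_inter (S : X → X' → Prop) (U V : Set X') : box S (U ∩ V) = box S U ∩ box S V :=
  Set.ext fun _ => ⟨fun h => ⟨fun y hy => (h y hy).1, fun y hy => (h y hy).2⟩,
    fun h y hy => ⟨h.1 y hy, h.2 y hy⟩⟩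

theorem box_univ (S : X → X' → Prop) : box S Set.univ = Set.univ :=
  Set.eq_univ_of_forall fun _ _ _ => trivial

theorem IsBoxHom.comp (h : IsBoxHom R L R' L' S T) (h' : IsBoxHom R' L' R'' L'' S' T') :
    IsBoxHom R L R'' L'' (star S S' L'') (costar T T' R'' L'') where
  box_mem U hU := by
    rw [box_star _ _ hU]
    exact h.box_mem _ (h'.box_mem _ hU)
  bdia_box U hU := by
    rw [box_star _ _ hU, dia_costar _ _ _ hU, h.bdia_box _ (h'.box_mem _ hU), h'.bdia_box _ hU]
  sep_left x z hn := by
    simp only [star, not_forall] at hn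
    obtain ⟨U, hU, h1, h2⟩ := hn
    exact ⟨U, hU, by rwa [box_star _ _ hU], h2⟩
  sep_right y w hn := by
    simp only [costar, not_forall] at hn
    obtain ⟨U, hU, h1, h2⟩ := hn
    exact ⟨U, hU, by rwa [dia_costar _ _ _ hU], h1⟩

theorem IsBoxHom.costar_assoc {X₃ Y₃ : Type*} {R₃ : X₃ → Y₃ → Prop} {L₃ : Set (Set X₃)}
    {S₃ : X'' → X₃ → Prop} {T₃ : Y'' → Y₃ → Prop} (T : Y → Y' → Prop) (T' : Y' → Y'' → Prop)
    (h : IsBoxHom R'' L'' R₃ L₃ S₃ T₃) :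
    costar (costar T T' R'' L'') T₃ R₃ L₃ = costar T (costar T' T₃ R₃ L₃) R₃ L₃ := by
  funext x z
  refine propext (forall₂_congr fun U hU => ?_)
  rw [← h.bdia_box U hU, dia_costar _ _ _ (h.box_mem U hU), dia_costar _ _ _ hU,
    h.bdia_box U hU]

theorem IsBoxHom.costar_id_left (h : IsBoxHom R L R' L' S T) {I : Y → Y → Prop}
    (hI : ∀ U ∈ L, dia I (bdia R U) = bdia R U) : costar I T R' L' = T := by
  have key : ∀ U ∈ L', dia I (dia T (bdia R' U)) = dia T (bdia R' U) := fun U hU => by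
    rw [← h.bdia_box U hU, hI _ (h.box_mem U hU)]
  funext y w
  refine propext ⟨fun hy => ?_, fun hy U hU hw => ?_⟩
  · by_contra hn
    obtain ⟨U, hU, h1, h2⟩ := h.sep_right y w hn
    exact h1 (by rw [← key U hU]; exact hy U hU h2)
  · rw [key U hU]
    exact ⟨w, hy, hw⟩

theorem IsBoxHom.costar_id_right (h : IsBoxHom R L R' L' S T) {I : Y' → Y' → Prop}
    (hI : ∀ U ∈ L', dia I (bdia R' U) = bdia R' U) : costar T I R' L' = T := by
  funext y w
  refine propext ⟨fun hy => ?_, fun hy U hU hw => ?_⟩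
  · by_contra hn
    obtain ⟨U, hU, h1, h2⟩ := h.sep_right y w hn
    exact h1 (by have := hy U hU h2; rwa [hI U hU] at this)
  · rw [hI U hU]
    exact ⟨w, hy, hw⟩

/-- The quasi-order `x ≤_X x'` iff `R[x'] ⊆ R[x]`. -/
def leX (R : X → Y → Prop) (x x' : X) : Prop := ∀ y, R x' y → R x y

/-- The quasi-order `y ≤_Y y'` iff `R⁻¹[y'] ⊆ R⁻¹[y]`. -/
def leY (R : X → Y → Prop) (y y' : Y) : Prop := ∀ x, R x y' → R x y

theorem box_leX {U : Set X} (hU : box R (bdia R U) = U) : box (leX R) U = U := by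
  apply Set.Subset.antisymm
  · exact fun x hx => hx x fun _ h => h
  · intro x hx x' hxx'
    rw [← hU] at hx ⊢
    exact fun y hy => hx y (hxx' y hy)

theorem dia_leY (U : Set X) : dia (leY R) (bdia R U) = bdia R U := by
  apply Set.Subset.antisymm
  · rintro y ⟨y', h, x, hx, hU⟩
    exact ⟨x, h x hx, hU⟩
  · exact fun y hy => ⟨y, fun _ h => h, hy⟩

/-- A lattice of fixed points that separates unrelated points has `(≤_X, ≤_Y)` as an
endomorphism. -/
theorem isBoxHom_id (fix : ∀ U ∈ L, box R (bdia R U) = U)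
    (sepX : ∀ x x', ¬ leX R x x' → ∃ U ∈ L, x ∈ U ∧ x' ∉ U)
    (sepY : ∀ y y', ¬ leY R y y' → ∃ U ∈ L, y ∉ bdia R U ∧ y' ∈ bdia R U) :
    IsBoxHom R L R L (leX R) (leY R) where
  box_mem U hU := by rwa [box_leX (fix U hU)]
  bdia_box U hU := by rw [box_leX (fix U hU), dia_leY]
  sep_left x x' h := by
    obtain ⟨U, hU, h1, h2⟩ := sepX x x' h
    exact ⟨U, hU, by rwa [box_leX (fix U hU)], h2⟩
  sep_right y y' h := by
    obtain ⟨U, hU, h1, h2⟩ := sepY y y' h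
    exact ⟨U, hU, by rwa [dia_leY], h2⟩

theorem sepX_of_sep (sep : ∀ x y, ¬ R x y → ∃ U ∈ L, x ∈ U ∧ y ∉ bdia R U) (x x' : X)
    (h : ¬ leX R x x') : ∃ U ∈ L, x ∈ U ∧ x' ∉ U := by
  simp only [leX, not_forall] at h
  obtain ⟨y, h1, h2⟩ := h
  obtain ⟨U, hU, hx, hy⟩ := sep x y h2
  exact ⟨U, hU, hx, fun hx' => hy ⟨x', h1, hx'⟩⟩

theorem sepY_of_sep (sep : ∀ x y, ¬ R x y → ∃ U ∈ L, x ∈ U ∧ y ∉ bdia R U) (y y' : Y)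
    (h : ¬ leY R y y') : ∃ U ∈ L, y ∉ bdia R U ∧ y' ∈ bdia R U := by
  simp only [leY, not_forall] at h
  obtain ⟨x, h1, h2⟩ := h
  obtain ⟨U, hU, hx, hy⟩ := sep x y h2
  exact ⟨U, hU, hy, ⟨x, h1, hx⟩⟩

end Polarity

/-! ### Coherent lattices and Dunn–Hartonas spaces -/

section Coherent

variable {X Y X' Y' : Type*}

/-- A coherent lattice: a complete lattice that is algebraic and whose compact elements are closed
under finite meets (including the empty meet). -/
structure IsCoherent (X : Type*) [CompleteLattice X] : Prop where
  algebraic : IsCompactlyGenerated X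
  compact_top : IsCompactElement (⊤ : X)
  compact_inf : ∀ k l : X, IsCompactElement k → IsCompactElement l → IsCompactElement (k ⊓ l)

/-- A (nonempty) filter of a lattice. -/
structure IsLatFilter [Lattice X] (F : Set X) : Prop where
  nonempty : F.Nonempty
  upper : IsUpperSet F
  inf_mem : ∀ a ∈ F, ∀ b ∈ F, a ⊓ b ∈ F

/-- Morphisms of coherent lattices with the Lawson topology: continuous maps that preserve finite
meets and have a left adjoint that preserves finite meets. -/
structure IsCohMap [CompleteLattice X] [TopologicalSpace X] [CompleteLattice X']
    [TopologicalSpace X'] (f : X → X') : Prop where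
  map_inf : ∀ a b, f (a ⊓ b) = f a ⊓ f b
  map_top : f ⊤ = ⊤
  continuous : Continuous f
  left_adjoint : ∃ l : X' → X, GaloisConnection l f ∧ (∀ a b, l (a ⊓ b) = l a ⊓ l b) ∧ l ⊤ = ⊤

/-- Interior relations. -/
structure IsInteriorRel [TopologicalSpace X] [TopologicalSpace Y] (R : X → Y → Prop) : Prop where
  closed_image : ∀ x, IsClosed {y | R x y}
  clopen_image : ∀ U, IsClopen U → IsClopen (bdia R U)
  closed_preimage : ∀ y, IsClosed {x | R x y}
  clopen_preimage : ∀ V, IsClopen V → IsClopen (dia R V)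

/-- The triple `(X, R, Y)` is a Dunn–Hartonas space. -/
structure IsDH [CompleteLattice X] [TopologicalSpace X] [CompleteLattice Y] [TopologicalSpace Y]
    (R : X → Y → Prop) : Prop where
  coherent_left : IsCoherent X
  coherent_right : IsCoherent Y
  lawson_left : Topology.IsLawson X
  lawson_right : Topology.IsLawson Y
  interior : IsInteriorRel R
  filter_image : ∀ x, IsLatFilter {y | ¬ R x y}
  filter_preimage : ∀ y, IsLatFilter {x | ¬ R x y}
  le_left : ∀ x x', {y | R x y} ⊆ {y | R x' y} → x' ≤ x
  le_right : ∀ y y', {x | R x y} ⊆ {x | R x y'} → y' ≤ y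

/-- Dunn–Hartonas morphisms. -/
structure IsDHHom [CompleteLattice X] [TopologicalSpace X] [CompleteLattice Y] [TopologicalSpace Y]
    [CompleteLattice X'] [TopologicalSpace X'] [CompleteLattice Y'] [TopologicalSpace Y']
    (R : X → Y → Prop) (R' : X' → Y' → Prop) (f : X → X') (g : Y → Y') : Prop where
  coh_left : IsCohMap f
  coh_right : IsCohMap g
  forth : ∀ x y, R x y → R' (f x) (g y)
  back_left : ∀ x' y, R' x' (g y) → ∃ x, R x y ∧ x' ≤ f x
  back_right : ∀ x y', R' (f x) y' → ∃ y, R x y ∧ y' ≤ g y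

theorem IsCohMap.id [CompleteLattice X] [TopologicalSpace X] : IsCohMap (fun x : X => x) :=
  ⟨fun _ _ => rfl, rfl, continuous_id, fun x => x, GaloisConnection.id, fun _ _ => rfl, rfl⟩

theorem IsCohMap.mono [CompleteLattice X] [TopologicalSpace X] [CompleteLattice X']
    [TopologicalSpace X'] {f : X → X'} (h : IsCohMap f) : Monotone f := by
  obtain ⟨l, hl, -⟩ := h.left_adjoint
  exact hl.monotone_u

theorem IsCohMap.comp {X'' : Type*} [CompleteLattice X] [TopologicalSpace X] [CompleteLattice X']
    [TopologicalSpace X'] [CompleteLattice X''] [TopologicalSpace X''] {f : X → X'} {g : X' → X''}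
    (hf : IsCohMap f) (hg : IsCohMap g) : IsCohMap (fun x => g (f x)) where
  map_inf a b := by rw [hf.map_inf, hg.map_inf]
  map_top := by rw [hf.map_top, hg.map_top]
  continuous := hg.continuous.comp hf.continuous
  left_adjoint := by
    obtain ⟨l, hl, h1, h2⟩ := hf.left_adjoint
    obtain ⟨m, hm, h3, h4⟩ := hg.left_adjoint
    exact ⟨l ∘ m, hm.compose hl, fun a b => by simp [h3, h1], by simp [h4, h2]⟩

theorem scott_isOpen_iff [CompleteLattice X] (W : Set X) :
    IsOpen[Topology.scott X Set.univ] W ↔ IsUpperSet W ∧ DirSupInaccOn Set.univ W := by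
  let _ : TopologicalSpace X := Topology.scott X Set.univ
  have : Topology.IsScott X Set.univ := ⟨rfl⟩
  exact Topology.IsScott.isOpen_iff_isUpperSet_and_dirSupInaccOn (D := Set.univ)

/-- A clopen filter for the Lawson topology is the principal filter of a compact element. -/
theorem exists_compact_of_clopen_filter [CompleteLattice X] [TopologicalSpace X]
    [Topology.IsLawson X] {F : Set X} (hF : IsLatFilter F) (hc : IsClopen F) :
    ∃ k, IsCompactElement k ∧ F = Set.Ici k := by
  have hk : sInf F ∈ F := by
    by_contra hn
    obtain ⟨V, hV, hkV, hVF⟩ := (Topology.IsLawson.isTopologicalBasis X).exists_subset_of_mem_open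
      (show sInf F ∈ Fᶜ from hn) hc.1.isOpen_compl
    obtain ⟨t, ht, W, hW, rfl⟩ := hV
    have hWup : IsUpperSet W := ((scott_isOpen_iff W).1 hW).1
    have hts : ∀ s ∈ t, ∃ f ∈ F, ¬ s ≤ f := by
      intro s hs
      by_contra hcon
      push Not at hcon
      exact hkV.2 (mem_upperClosure.2 ⟨s, hs, le_sInf hcon⟩)
    have hfin : ∃ f ∈ F, ∀ s ∈ t, ¬ s ≤ f := by
      clear hkV hVF
      induction t, ht using Set.Finite.induction_on with
      | empty => exact ⟨_, hF.nonempty.some_mem, by simp⟩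
      | insert _ _ ih =>
        obtain ⟨f, hf, h1⟩ := ih fun s hs => hts s (Set.mem_insert_of_mem _ hs)
        obtain ⟨g, hg, h2⟩ := hts _ (Set.mem_insert _ _)
        refine ⟨f ⊓ g, hF.inf_mem _ hf _ hg, ?_⟩
        rintro s (rfl | hs) hle
        · exact h2 (hle.trans inf_le_right)
        · exact h1 s hs (hle.trans inf_le_left)
    obtain ⟨f, hf, h⟩ := hfin
    refine hVF ⟨hWup (sInf_le hf) hkV.1, fun hu => ?_⟩ hf
    obtain ⟨s, hs, hsf⟩ := mem_upperClosure.1 hu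
    exact h s hs hsf
  have hFk : F = Set.Ici (sInf F) :=
    Set.Subset.antisymm (fun x hx => sInf_le hx) fun x hx => hF.upper hx hk
  refine ⟨sInf F, ?_, hFk⟩
  have hop : IsOpen[Topology.scott X Set.univ] F :=
    (@Topology.lawsonOpen_iff_scottOpen_of_isUpperSet' X _ ‹TopologicalSpace X›
      (Topology.scott X Set.univ) ‹_› (@Topology.IsScott.mk X Set.univ _
        (Topology.scott X Set.univ) rfl) F hF.upper).1 hc.2
  have := ((scott_isOpen_iff F).1 hop).2
  intro s v hne hdir hlub hle
  obtain ⟨x, hxs, hxF⟩ := this (Set.mem_univ s) hne hdir hlub (hF.upper hle hk)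
  exact ⟨x, hxs, sInf_le hxF⟩

theorem isClopen_Ici_of_compact [CompleteLattice X] [TopologicalSpace X] [Topology.IsLawson X]
    {k : X} (hk : IsCompactElement k) : IsClopen (Set.Ici k) := by
  constructor
  · rw [← isOpen_compl_iff]
    refine (Topology.IsLawson.isTopologicalBasis X).isOpen ?_
    refine ⟨{k}, Set.finite_singleton k, Set.univ, @isOpen_univ X (Topology.scott X Set.univ), ?_⟩
    ext x
    simp
  · have : IsOpen[Topology.scott X Set.univ] (Set.Ici k) := by
      rw [scott_isOpen_iff]
      refine ⟨isUpperSet_Ici k, fun s _ hne hdir v hv hkv => ?_⟩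
      obtain ⟨x, hx, hkx⟩ := hk s v hne hdir hv hkv
      exact ⟨x, hx, hkx⟩
    exact (@Topology.lawsonOpen_iff_scottOpen_of_isUpperSet' X _ ‹TopologicalSpace X›
      (Topology.scott X Set.univ) ‹_› (@Topology.IsScott.mk X Set.univ _
        (Topology.scott X Set.univ) rfl) _ (isUpperSet_Ici k)).2 this

/-- The sets `{z | u ⊓ v ≤ z for some u ∈ F, v ∈ G}`, the join of two filters. -/
def filterJoin [Lattice X] (F G : Set X) : Set X := {z | ∃ u ∈ F, ∃ v ∈ G, u ⊓ v ≤ z}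

theorem isLatFilter_Ici [Lattice X] (k : X) : IsLatFilter (Set.Ici k) :=
  ⟨⟨k, le_rfl⟩, isUpperSet_Ici k, fun _ ha _ hb => le_inf ha hb⟩

theorem clopen_filterJoin [CompleteLattice X] [TopologicalSpace X] [Topology.IsLawson X]
    (hX : IsCoherent X) {F G : Set X} (hF : IsLatFilter F ∧ IsClopen F)
    (hG : IsLatFilter G ∧ IsClopen G) :
    IsLatFilter (filterJoin F G) ∧ IsClopen (filterJoin F G) := by
  obtain ⟨k, hk, rfl⟩ := exists_compact_of_clopen_filter hF.1 hF.2
  obtain ⟨l, hl, rfl⟩ := exists_compact_of_clopen_filter hG.1 hG.2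
  have : filterJoin (Set.Ici k) (Set.Ici l) = Set.Ici (k ⊓ l) := by
    ext z
    constructor
    · rintro ⟨u, hu, v, hv, h⟩
      exact (inf_le_inf hu hv).trans h
    · intro h
      exact ⟨k, le_rfl, l, le_rfl, h⟩
  rw [this]
  exact ⟨isLatFilter_Ici _, isClopen_Ici_of_compact (hX.compact_inf k l hk hl)⟩

end Coherent

/-- Dunn–Hartonas spaces. -/
structure DH where
  X : Type u
  Y : Type u
  [latX : CompleteLattice X]
  [topX : TopologicalSpace X]
  [latY : CompleteLattice Y]
  [topY : TopologicalSpace Y]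
  R : X → Y → Prop
  isDH : IsDH R

namespace DH

attribute [instance] DH.latX DH.topX DH.latY DH.topY

/-- Dunn–Hartonas morphisms, as pairs of maps. -/
@[ext]
structure Hom (D E : DH.{u}) where
  f : D.X → E.X
  g : D.Y → E.Y
  isHom : IsDHHom D.R E.R f g

/-- The category of Dunn–Hartonas spaces, with componentwise composition. -/
instance : Category.{u} DH.{u} where
  Hom := Hom
  id D := ⟨fun x => x, fun y => y, IsCohMap.id, IsCohMap.id, fun _ _ h => h,
    fun x _ h => ⟨x, h, le_rfl⟩, fun _ y h => ⟨y, h, le_rfl⟩⟩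
  comp {D E F} h k := ⟨fun x => k.f (h.f x), fun y => k.g (h.g y),
    h.isHom.coh_left.comp k.isHom.coh_left, h.isHom.coh_right.comp k.isHom.coh_right,
    fun x y hxy => k.isHom.forth _ _ (h.isHom.forth _ _ hxy),
    fun x'' y hxy => by
      obtain ⟨x', h1, h2⟩ := k.isHom.back_left _ _ hxy
      obtain ⟨x, h3, h4⟩ := h.isHom.back_left _ _ h1
      exact ⟨x, h3, h2.trans (k.isHom.coh_left.mono h4)⟩,
    fun x y'' hxy => by
      obtain ⟨y', h1, h2⟩ := k.isHom.back_right _ _ hxy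
      obtain ⟨y, h3, h4⟩ := h.isHom.back_right _ _ h1
      exact ⟨y, h3, h2.trans (k.isHom.coh_right.mono h4)⟩⟩

/-- `CLF(X)`, the clopen filters of `X`. -/
def CLF (D : DH.{u}) : Type u := {F : Set D.X // IsLatFilter F ∧ IsClopen F}

/-- The lattice of clopen filters, ordered by inclusion. -/
instance (D : DH.{u}) : Lattice D.CLF where
  le F G := F.1 ⊆ G.1
  le_refl _ := Set.Subset.rfl
  le_trans _ _ _ h₁ h₂ := Set.Subset.trans h₁ h₂
  le_antisymm _ _ h₁ h₂ := Subtype.ext (Set.Subset.antisymm h₁ h₂)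
  sup F G := ⟨filterJoin F.1 G.1,
    haveI := D.isDH.lawson_left
    clopen_filterJoin D.isDH.coherent_left F.2 G.2⟩
  le_sup_left F G := fun x hx => by
    obtain ⟨y, hy⟩ := G.2.1.nonempty
    exact ⟨x, hx, y, hy, inf_le_left⟩
  le_sup_right F G := fun x hx => by
    obtain ⟨y, hy⟩ := F.2.1.nonempty
    exact ⟨y, hy, x, hx, inf_le_right⟩
  sup_le F G H h₁ h₂ := by
    rintro z ⟨u, hu, v, hv, h⟩
    exact H.2.1.upper h (H.2.1.inf_mem _ (h₁ hu) _ (h₂ hv))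
  inf F G := ⟨F.1 ∩ G.1, ⟨by
      obtain ⟨a, ha⟩ := F.2.1.nonempty
      obtain ⟨b, hb⟩ := G.2.1.nonempty
      exact ⟨a ⊔ b, F.2.1.upper le_sup_left ha, G.2.1.upper le_sup_right hb⟩,
    F.2.1.upper.inter G.2.1.upper,
    fun a ha b hb => ⟨F.2.1.inf_mem _ ha.1 _ hb.1, G.2.1.inf_mem _ ha.2 _ hb.2⟩⟩,
    F.2.2.inter G.2.2⟩
  inf_le_left _ _ := Set.inter_subset_left
  inf_le_right _ _ := Set.inter_subset_right
  le_inf _ _ _ h₁ h₂ := Set.subset_inter h₁ h₂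

instance (D : DH.{u}) : BoundedOrder D.CLF where
  top := ⟨Set.univ, ⟨⟨⊤, trivial⟩, isUpperSet_univ, fun _ _ _ _ => trivial⟩, isClopen_univ⟩
  le_top _ := Set.subset_univ _
  bot := ⟨Set.Ici ⊤, isLatFilter_Ici _,
    haveI := D.isDH.lawson_left
    isClopen_Ici_of_compact D.isDH.coherent_left.compact_top⟩
  bot_le F := fun x hx => by
    obtain ⟨a, ha⟩ := F.2.1.nonempty
    exact F.2.1.upper (le_top.trans hx) ha

/-- The action of `𝕃_DH` on morphisms: `F ↦ f⁻¹(F)`. -/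
def latMap {D E : DH.{u}} (h : D ⟶ E) : BoundedLatticeHom E.CLF D.CLF where
  toFun F := ⟨h.f ⁻¹' F.1, ⟨⟨⊤, by
      obtain ⟨a, ha⟩ := F.2.1.nonempty
      rw [Set.mem_preimage, h.isHom.coh_left.map_top]
      exact F.2.1.upper le_top ha⟩,
    F.2.1.upper.preimage h.isHom.coh_left.mono,
    fun a ha b hb => by
      rw [Set.mem_preimage, h.isHom.coh_left.map_inf]
      exact F.2.1.inf_mem _ ha _ hb⟩,
    F.2.2.preimage h.isHom.coh_left.continuous⟩
  map_sup' F G := by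
    obtain ⟨l, hl, h1, -⟩ := h.isHom.coh_left.left_adjoint
    refine Subtype.ext (Set.Subset.antisymm ?_ ?_)
    · rintro z ⟨u, hu, v, hv, huv⟩
      refine ⟨l u, F.2.1.upper (hl.le_u_l u) hu, l v, G.2.1.upper (hl.le_u_l v) hv, ?_⟩
      rw [← h1]
      exact hl.l_le huv
    · rintro z ⟨u, hu, v, hv, huv⟩
      exact ⟨h.f u, hu, h.f v, hv, by
        rw [← h.isHom.coh_left.map_inf]
        exact h.isHom.coh_left.mono huv⟩
  map_inf' _ _ := rfl
  map_top' := rfl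
  map_bot' := by
    obtain ⟨l, hl, -, h2⟩ := h.isHom.coh_left.left_adjoint
    refine Subtype.ext (Set.ext fun z => ?_)
    change ⊤ ≤ h.f z ↔ ⊤ ≤ z
    rw [← hl ⊤ z, h2]

/-- The functor `𝕃_DH`, sending `(X, R, Y)` to `CLF(X)` and `(f, g)` to `f⁻¹`. -/
def latFunctor : DH.{u}ᵒᵖ ⥤ BddLat.{u} where
  obj D := BddLat.of D.unop.CLF
  map h := BddLat.ofHom (latMap h.unop)
  map_id _ := rfl
  map_comp _ _ := rfl

end DH

/-! ### Gehrke–van Gool spaces -/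

section GvGDefs

variable {X Y X' Y' : Type*}

/-- `X_0 = ⋃ {max R⁻¹[y] : y ∈ Y}`. -/
def maxLeft [Preorder X] (R : X → Y → Prop) : Set X := {x | ∃ y, Maximal (fun x' => R x' y) x}

/-- `Y_0 = ⋃ {max R[x] : x ∈ X}`. -/
def maxRight [Preorder Y] (R : X → Y → Prop) : Set Y := {y | ∃ x, Maximal (fun y' => R x y') y}

/-- The clopen upsets `U` of `X` with `U = □◆U`. -/
def gvgSets [Preorder X] [TopologicalSpace X] (R : X → Y → Prop) : Set (Set X) :=
  {U | IsClopen U ∧ IsUpperSet U ∧ box R (bdia R U) = U}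

/-- The triple `(X, R, Y)` is a Gehrke–van Gool space. -/
structure IsGvG [PartialOrder X] [TopologicalSpace X] [PartialOrder Y] [TopologicalSpace Y]
    (R : X → Y → Prop) : Prop where
  compact_left : CompactSpace X
  priestley_left : PriestleySpace X
  compact_right : CompactSpace Y
  priestley_right : PriestleySpace Y
  le_left : ∀ x x', x ≤ x' ↔ {y | R x' y} ⊆ {y | R x y}
  le_right : ∀ y y', y ≤ y' ↔ {x | R x y'} ⊆ {x | R x y}
  clopen_bdia : ∀ U : Set X, IsClopen U → IsUpperSet U →
    IsClopen (bdia R U) ∧ IsLowerSet (bdia R U)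
  clopen_box : ∀ V : Set Y, IsClopen V → IsLowerSet V → IsClopen (box R V) ∧ IsUpperSet (box R V)
  sep : ∀ x y, ¬ R x y → ∃ U ∈ gvgSets R, x ∈ U ∧ y ∉ bdia R U
  regular_left : ∀ U : Set X, IsClopen U → IsUpperSet U →
    maxLeft R ∩ box R (bdia R U) ⊆ U → U = box R (bdia R U)
  regular_right : ∀ V : Set Y, IsClopen V → IsLowerSet V →
    maxRight R ∩ V ⊆ bdia R (box R V) → V = bdia R (box R V)

/-- Gehrke–van Gool morphisms. -/
structure IsGvGHom [Preorder X] [TopologicalSpace X] [Preorder X'] [TopologicalSpace X']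
    (R : X → Y → Prop) (R' : X' → Y' → Prop) (S : X → X' → Prop) (T : Y → Y' → Prop) : Prop
    extends IsBoxHom R (gvgSets R) R' (gvgSets R') S T where
  compat : ∀ x y, R x y → ∃ x' y', S x x' ∧ T y y' ∧ R' x' y'

theorem IsGvG.isPolFamily [PartialOrder X] [TopologicalSpace X] [PartialOrder Y]
    [TopologicalSpace Y] {R : X → Y → Prop} (h : IsGvG R) : IsPolFamily R (gvgSets R) := by
  have key : ∀ U, IsClopen U → IsUpperSet U → box R (bdia R U) ∈ gvgSets R := fun U hU hU' => by
    have h1 := h.clopen_bdia U hU hU'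
    have h2 := h.clopen_box _ h1.1 h1.2
    exact ⟨h2.1, h2.2, by rw [bdia_box_bdia]⟩
  refine ⟨fun U hU => hU.2.2, fun U hU V hV => ⟨hU.1.inter hV.1, hU.2.1.inter hV.2.1, ?_⟩,
    fun U hU V hV => key _ (hU.1.union hV.1) (hU.2.1.union hV.2.1),
    ⟨isClopen_univ, isUpperSet_univ, ?_⟩, key _ isClopen_empty isUpperSet_empty⟩
  · refine Set.Subset.antisymm (Set.subset_inter ?_ ?_) (subset_box_bdia R _)
    · exact (box_mono R (bdia_mono R Set.inter_subset_left)).trans hU.2.2.subset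
    · exact (box_mono R (bdia_mono R Set.inter_subset_right)).trans hV.2.2.subset
  · exact Set.eq_univ_of_univ_subset (subset_box_bdia R _)

theorem IsGvG.leX_eq [PartialOrder X] [TopologicalSpace X] [PartialOrder Y]
    [TopologicalSpace Y] {R : X → Y → Prop} (h : IsGvG R) : leX R = fun x x' => x ≤ x' :=
  funext fun x => funext fun x' => propext (h.le_left x x').symm

theorem IsGvG.leY_eq [PartialOrder X] [TopologicalSpace X] [PartialOrder Y]
    [TopologicalSpace Y] {R : X → Y → Prop} (h : IsGvG R) : leY R = fun y y' => y ≤ y' :=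
  funext fun y => funext fun y' => propext (h.le_right y y').symm

end GvGDefs

/-- Gehrke–van Gool spaces. -/
structure GvG where
  X : Type u
  Y : Type u
  [ordX : PartialOrder X]
  [topX : TopologicalSpace X]
  [ordY : PartialOrder Y]
  [topY : TopologicalSpace Y]
  R : X → Y → Prop
  isGvG : IsGvG R

namespace GvG

attribute [instance] GvG.ordX GvG.topX GvG.ordY GvG.topY

/-- Gehrke–van Gool morphisms, as pairs of relations. -/
@[ext]
structure Hom (G H : GvG.{u}) where
  S : G.X → H.X → Prop
  T : G.Y → H.Y → Prop
  isHom : IsGvGHom G.R H.R S T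

theorem isHom_id (G : GvG.{u}) :
    IsGvGHom G.R G.R (fun x x' : G.X => x ≤ x') (fun y y' : G.Y => y ≤ y') where
  toIsBoxHom := by
    have := isBoxHom_id G.isGvG.isPolFamily.fix (sepX_of_sep G.isGvG.sep) (sepY_of_sep G.isGvG.sep)
    rwa [G.isGvG.leX_eq, G.isGvG.leY_eq] at this
  compat x y h := ⟨x, y, le_rfl, le_rfl, h⟩

theorem box_le (G : GvG.{u}) {U : Set G.X} (hU : U ∈ gvgSets G.R) :
    box (fun x x' : G.X => x ≤ x') U = U := by
  rw [← G.isGvG.leX_eq]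
  exact box_leX hU.2.2

theorem dia_le (G : GvG.{u}) (U : Set G.X) :
    dia (fun y y' : G.Y => y ≤ y') (bdia G.R U) = bdia G.R U := by
  rw [← G.isGvG.leY_eq]
  exact dia_leY U

/-- The category of Gehrke–van Gool spaces; composition is `⋆` and the identities are
`(≤_X, ≤_Y)`. -/
instance : Category.{u} GvG.{u} where
  Hom := Hom
  id G := ⟨fun x x' => x ≤ x', fun y y' => y ≤ y', G.isHom_id⟩
  comp {_ _ K} h k := ⟨star h.S k.S (gvgSets K.R), costar h.T k.T K.R (gvgSets K.R),
    h.isHom.toIsBoxHom.comp k.isHom.toIsBoxHom, fun x y hxy => by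
      obtain ⟨x', y', h1, h2, h3⟩ := h.isHom.compat x y hxy
      obtain ⟨x'', y'', h4, h5, h6⟩ := k.isHom.compat x' y' h3
      exact ⟨x'', y'', fun U _ hU => hU _ h1 _ h4,
        fun U _ hU => ⟨y', h2, y'', h5, hU⟩, h6⟩⟩
  id_comp {G _} h := Hom.ext
    (star_id_left (fun U hU => G.box_le (h.isHom.box_mem U hU)) h.isHom.sep_left)
    (h.isHom.toIsBoxHom.costar_id_left fun U _ => G.dia_le U)
  comp_id {_ H} h := Hom.ext
    (star_id_right (fun _ hU => H.box_le hU) h.isHom.sep_left)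
    (h.isHom.toIsBoxHom.costar_id_right fun U _ => H.dia_le U)
  assoc h k l := Hom.ext
    (star_assoc h.S k.S l.S l.isHom.box_mem)
    (l.isHom.toIsBoxHom.costar_assoc h.T k.T)

/-- `𝖫𝒢`, the lattice of clopen upsets `U` with `U = □◆U`. -/
def L (G : GvG.{u}) : Type u := {U : Set G.X // U ∈ gvgSets G.R}

instance (G : GvG.{u}) : Lattice G.L := polLattice G.isGvG.isPolFamily

instance (G : GvG.{u}) : BoundedOrder G.L := polBounded G.isGvG.isPolFamily

/-- The action of `𝕃_GvG` on morphisms: `U ↦ □_S U`. -/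
def latMap {G H : GvG.{u}} (h : G ⟶ H) : BoundedLatticeHom H.L G.L where
  toFun U := ⟨box h.S U.1, h.isHom.box_mem _ U.2⟩
  map_sup' U V := Subtype.ext
    (h.isHom.toIsBoxHom.box_sup G.isGvG.isPolFamily H.isGvG.isPolFamily U.2 V.2)
  map_inf' U V := Subtype.ext (box_inter h.S U.1 V.1)
  map_top' := Subtype.ext (box_univ h.S)
  map_bot' := Subtype.ext
    (h.isHom.toIsBoxHom.box_bot G.isGvG.isPolFamily H.isGvG.isPolFamily)

/-- The functor `𝕃_GvG`, sending `𝒢` to `𝖫𝒢` and `(S, T)` to `□_S`. -/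
def latFunctor : GvG.{u}ᵒᵖ ⥤ BddLat.{u} where
  obj G := BddLat.of G.unop.L
  map h := BddLat.ofHom (latMap h.unop)
  map_id G := BddLat.ext fun U => Subtype.ext (G.unop.box_le (Subtype.prop U))
  map_comp h k := BddLat.ext fun U =>
    Subtype.ext (box_star k.unop.S h.unop.S (Subtype.prop U))

end GvG

/-! ### Hartung spaces -/

section HgDefs

variable {X Y X' Y' : Type*}

/-- The closed sets `A` with `A = □◆A` and `-◆A` closed. -/
def closedSets [TopologicalSpace X] [TopologicalSpace Y] (R : X → Y → Prop) : Set (Set X) :=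
  {A | box R (bdia R A) = A ∧ IsClosed A ∧ IsClosed (bdia R A)ᶜ}

/-- `x` is `y`-maximal. -/
def IsMaxLeft (R : X → Y → Prop) (x : X) (y : Y) : Prop :=
  R x y ∧ ∀ x', leX R x x' → R x' y → x' = x

/-- `y` is `x`-maximal. -/
def IsMaxRight (R : X → Y → Prop) (x : X) (y : Y) : Prop :=
  R x y ∧ ∀ y', leY R y y' → R x y' → y' = y

/-- The triple `(X, R, Y)` is a Hartung space. -/
structure IsHg [tX : TopologicalSpace X] [tY : TopologicalSpace Y] (R : X → Y → Prop) : Prop where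
  antisymm_left : ∀ x x', leX R x x' → leX R x' x → x = x'
  antisymm_right : ∀ y y', leY R y y' → leY R y' y → y = y'
  compact : IsCompact {p : X × Y | R p.1 p.2}
  subbasis_left : tX = TopologicalSpace.generateFrom {W | ∃ A ∈ closedSets R, W = Aᶜ}
  subbasis_right : tY = TopologicalSpace.generateFrom {W | ∃ A ∈ closedSets R, W = bdia R A}
  closed_left : ∀ A : Set X, IsClosed A → IsClosed (box R (bdia R A))
  closed_right : ∀ B : Set Y, IsClosed B → IsClosed (bbox R (dia R B))
  maximal : ∀ x y, R x y →
    ∃ x' y', leX R x x' ∧ IsMaxLeft R x' y ∧ leY R y y' ∧ IsMaxRight R x y'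
  sep : ∀ x y, ¬ R x y → ∃ A ∈ closedSets R, x ∈ A ∧ y ∉ bdia R A

/-- Hartung morphisms. -/
structure IsHgHom [TopologicalSpace X] [TopologicalSpace Y] [TopologicalSpace X']
    [TopologicalSpace Y'] (R : X → Y → Prop) (R' : X' → Y' → Prop) (S : X → X' → Prop)
    (T : Y → Y' → Prop) : Prop
    extends IsBoxHom R (closedSets R) R' (closedSets R') S T where
  compat : ∀ x y, R x y → ∃ x' y', S x x' ∧ T y y' ∧ R' x' y'

theorem bbox_dia_eq (R : X → Y → Prop) (B : Set Y) :
    bbox R (dia R B) = (bdia R (box R Bᶜ))ᶜ := by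
  ext y
  constructor
  · rintro h ⟨x, hx, hA⟩
    obtain ⟨y', hy', hn⟩ := h x hx
    exact hA y' hy' hn
  · intro h x hx
    by_contra hn
    exact h ⟨x, hx, fun y' hy' hB => hn ⟨y', hy', hB⟩⟩

theorem box_inter_eq {R : X → Y → Prop} {U V : Set X} (hU : box R (bdia R U) = U)
    (hV : box R (bdia R V) = V) : box R (bdia R (U ∩ V)) = U ∩ V := by
  refine Set.Subset.antisymm (Set.subset_inter ?_ ?_) (subset_box_bdia R _)
  · exact (box_mono R (bdia_mono R Set.inter_subset_left)).trans hU.subset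
  · exact (box_mono R (bdia_mono R Set.inter_subset_right)).trans hV.subset

theorem IsHg.isPolFamily [TopologicalSpace X] [TopologicalSpace Y] {R : X → Y → Prop}
    (h : IsHg R) : IsPolFamily R (closedSets R) where
  fix _ hU := hU.1
  inter U hU V hV := by
    refine ⟨box_inter_eq hU.1 hV.1, hU.2.1.inter hV.2.1, ?_⟩
    have := h.closed_right _ (hU.2.2.union hV.2.2)
    rw [bbox_dia_eq, Set.compl_union, compl_compl, compl_compl, box_inter, hU.1, hV.1] at this
    exact this
  sup U hU V hV := by
    refine ⟨by rw [bdia_box_bdia], h.closed_left _ (hU.2.1.union hV.2.1), ?_⟩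
    rw [bdia_box_bdia, bdia_union, Set.compl_union]
    exact hU.2.2.inter hV.2.2
  univ := by
    refine ⟨Set.eq_univ_of_univ_subset (subset_box_bdia R _), isClosed_univ, ?_⟩
    have := h.closed_right ∅ isClosed_empty
    rwa [bbox_dia_eq, Set.compl_empty, box_univ] at this
  bot := ⟨by rw [bdia_box_bdia], h.closed_left ∅ isClosed_empty, by
    rw [bdia_box_bdia, bdia_empty, Set.compl_empty]
    exact isClosed_univ⟩

end HgDefs

/-- Hartung spaces. -/
structure Hg where
  X : Type u
  Y : Type u
  [topX : TopologicalSpace X]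
  [topY : TopologicalSpace Y]
  R : X → Y → Prop
  isHg : IsHg R

namespace Hg

attribute [instance] Hg.topX Hg.topY

/-- Hartung morphisms, as pairs of relations. -/
@[ext]
structure Hom (H K : Hg.{u}) where
  S : H.X → K.X → Prop
  T : H.Y → K.Y → Prop
  isHom : IsHgHom H.R K.R S T

/-- The category of Hartung spaces; composition is `⋆` and the identities are `(≤_X, ≤_Y)`. -/
instance : Category.{u} Hg.{u} where
  Hom := Hom
  id H := ⟨leX H.R, leY H.R,
    isBoxHom_id H.isHg.isPolFamily.fix (sepX_of_sep H.isHg.sep) (sepY_of_sep H.isHg.sep),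
    fun x y h => ⟨x, y, fun _ h => h, fun _ h => h, h⟩⟩
  comp {_ _ K} h k := ⟨star h.S k.S (closedSets K.R), costar h.T k.T K.R (closedSets K.R),
    h.isHom.toIsBoxHom.comp k.isHom.toIsBoxHom, fun x y hxy => by
      obtain ⟨x', y', h1, h2, h3⟩ := h.isHom.compat x y hxy
      obtain ⟨x'', y'', h4, h5, h6⟩ := k.isHom.compat x' y' h3
      exact ⟨x'', y'', fun U _ hU => hU _ h1 _ h4,
        fun U _ hU => ⟨y', h2, y'', h5, hU⟩, h6⟩⟩
  id_comp h := Hom.ext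
    (star_id_left (fun U hU => box_leX (h.isHom.box_mem U hU).1) h.isHom.sep_left)
    (h.isHom.toIsBoxHom.costar_id_left fun U _ => dia_leY U)
  comp_id h := Hom.ext
    (star_id_right (fun _ hU => box_leX hU.1) h.isHom.sep_left)
    (h.isHom.toIsBoxHom.costar_id_right fun U _ => dia_leY U)
  assoc h k l := Hom.ext
    (star_assoc h.S k.S l.S l.isHom.box_mem)
    (l.isHom.toIsBoxHom.costar_assoc h.T k.T)

/-- `𝖫ℋ`, the lattice of closed sets `A` with `A = □◆A` and `-◆A` closed. -/
def L (H : Hg.{u}) : Type u := {A : Set H.X // A ∈ closedSets H.R}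

instance (H : Hg.{u}) : Lattice H.L := polLattice H.isHg.isPolFamily

instance (H : Hg.{u}) : BoundedOrder H.L := polBounded H.isHg.isPolFamily

/-- The action of `𝕃_Hg` on morphisms: `A ↦ □_S A`. -/
def latMap {H K : Hg.{u}} (h : H ⟶ K) : BoundedLatticeHom K.L H.L where
  toFun U := ⟨box h.S U.1, h.isHom.box_mem _ U.2⟩
  map_sup' U V := Subtype.ext
    (h.isHom.toIsBoxHom.box_sup H.isHg.isPolFamily K.isHg.isPolFamily U.2 V.2)
  map_inf' U V := Subtype.ext (box_inter h.S U.1 V.1)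
  map_top' := Subtype.ext (box_univ h.S)
  map_bot' := Subtype.ext
    (h.isHom.toIsBoxHom.box_bot H.isHg.isPolFamily K.isHg.isPolFamily)

/-- The functor `𝕃_Hg`, sending `ℋ` to `𝖫ℋ` and `(S, T)` to `□_S`. -/
def latFunctor : Hg.{u}ᵒᵖ ⥤ BddLat.{u} where
  obj H := BddLat.of H.unop.L
  map h := BddLat.ofHom (latMap h.unop)
  map_id _ := BddLat.ext fun U => Subtype.ext (box_leX (Subtype.prop U).1)
  map_comp h k := BddLat.ext fun U =>
    Subtype.ext (box_star k.unop.S h.unop.S (Subtype.prop U))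

end Hg

/-! ### Urquhart spaces -/

section UrqDefs

variable {Z Z' : Type*}

/-- `-↓A`, the complement of the downset generated by `A`. For the quasi-orders `≤₁`, `≤₂` of an
Urquhart space, `φ = negDown (≤₂)` and `ψ = negDown (≤₁)`. -/
def negDown (le : Z → Z → Prop) (A : Set Z) : Set Z := {x | ∀ a ∈ A, ¬ le x a}

/-- `A` is an upset for `le`. -/
def IsUp (le : Z → Z → Prop) (A : Set Z) : Prop := ∀ x y, le x y → x ∈ A → y ∈ A

/-- The `≤₁`-upsets `C` with `C = ψφC` such that `C` and `φC` are closed. -/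
def urqSets [TopologicalSpace Z] (le₁ le₂ : Z → Z → Prop) : Set (Set Z) :=
  {C | IsUp le₁ C ∧ negDown le₁ (negDown le₂ C) = C ∧ IsClosed C ∧ IsClosed (negDown le₂ C)}

/-- The triple `(Z, ≤₁, ≤₂)` is an Urquhart space. -/
structure IsUrq [tZ : TopologicalSpace Z] (le₁ le₂ : Z → Z → Prop) : Prop where
  refl₁ : ∀ x, le₁ x x
  trans₁ : ∀ x y z, le₁ x y → le₁ y z → le₁ x z
  refl₂ : ∀ x, le₂ x x
  trans₂ : ∀ x y z, le₂ x y → le₂ y z → le₂ x z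
  compact : CompactSpace Z
  doubly_ordered : ∀ x y, le₁ x y → le₂ x y → x = y
  subbasis : tZ = TopologicalSpace.generateFrom
    {W | ∃ C ∈ urqSets le₁ le₂, W = Cᶜ ∨ W = (negDown le₂ C)ᶜ}
  closed_inter : ∀ C₁ ∈ urqSets le₁ le₂, ∀ C₂ ∈ urqSets le₁ le₂, IsClosed (negDown le₂ (C₁ ∩ C₂))
  closed_sup : ∀ C₁ ∈ urqSets le₁ le₂, ∀ C₂ ∈ urqSets le₁ le₂,
    IsClosed (negDown le₁ (negDown le₂ C₁ ∩ negDown le₂ C₂))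
  sep₁ : ∀ x y, ¬ le₁ x y → ∃ C ∈ urqSets le₁ le₂, x ∈ C ∧ y ∉ C
  sep₂ : ∀ x y, ¬ le₂ x y → ∃ C ∈ urqSets le₁ le₂, x ∈ negDown le₂ C ∧ y ∉ negDown le₂ C

/-- Urquhart morphisms. -/
structure IsUrqHom [TopologicalSpace Z] [TopologicalSpace Z'] (le₁ le₂ : Z → Z → Prop)
    (le₁' le₂' : Z' → Z' → Prop) (P Q : Z → Z' → Prop) : Prop where
  box_mem : ∀ C ∈ urqSets le₁' le₂', box P C ∈ urqSets le₁ le₂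
  neg_box : ∀ C ∈ urqSets le₁' le₂', negDown le₂ (box P C) = box Q (negDown le₂' C)
  sep_left : ∀ z z', ¬ P z z' → ∃ C ∈ urqSets le₁' le₂', z ∈ box P C ∧ z' ∉ C
  sep_right : ∀ z z', ¬ Q z z' →
    ∃ C ∈ urqSets le₁' le₂', z ∈ box Q (negDown le₂' C) ∧ z' ∉ negDown le₂' C
  serial : ∀ z, ∃ z', P z z' ∧ Q z z'

theorem negDown_anti (le : Z → Z → Prop) {A B : Set Z} (h : A ⊆ B) : negDown le B ⊆ negDown le A :=
  fun _ hx a ha => hx a (h ha)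

theorem subset_negDown_negDown {le₁ le₂ : Z → Z → Prop} (h : ∀ x, le₂ x x) {A : Set Z}
    (hA : IsUp le₁ A) : A ⊆ negDown le₁ (negDown le₂ A) :=
  fun x hx a ha hxa => ha a (hA x a hxa hx) (h a)

theorem isUp_negDown {le : Z → Z → Prop} (h : ∀ x y z, le x y → le y z → le x z) (A : Set Z) :
    IsUp le (negDown le A) :=
  fun x y hxy hx a ha hya => hx a ha (h x y a hxy hya)

theorem box_isUp {le : Z → Z → Prop} (h : ∀ x, le x x) {A : Set Z} (hA : IsUp le A) :
    box le A = A :=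
  Set.Subset.antisymm (fun x hx => hx x (h x)) fun x hx y hxy => hA x y hxy hx

theorem negDown_univ {le : Z → Z → Prop} (h : ∀ x, le x x) : negDown le Set.univ = ∅ :=
  Set.eq_empty_of_forall_notMem fun x hx => hx x trivial (h x)

theorem negDown_empty (le : Z → Z → Prop) : negDown le ∅ = Set.univ :=
  Set.eq_univ_of_forall fun _ _ ha => ha.elim

namespace IsUrq

variable [TopologicalSpace Z] {le₁ le₂ : Z → Z → Prop}

theorem neg_sup (h : IsUrq le₁ le₂) {C₁ C₂ : Set Z} (h₁ : C₁ ∈ urqSets le₁ le₂)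
    (h₂ : C₂ ∈ urqSets le₁ le₂) :
    negDown le₂ (negDown le₁ (negDown le₂ C₁ ∩ negDown le₂ C₂)) =
      negDown le₂ C₁ ∩ negDown le₂ C₂ := by
  apply Set.Subset.antisymm
  · refine Set.subset_inter (negDown_anti le₂ ?_) (negDown_anti le₂ ?_)
    · refine h₁.2.1.symm.subset.trans (negDown_anti le₁ Set.inter_subset_left)
    · refine h₂.2.1.symm.subset.trans (negDown_anti le₁ Set.inter_subset_right)
  · refine subset_negDown_negDown h.refl₁ fun x y hxy hx => ?_
    exact ⟨isUp_negDown h.trans₂ _ x y hxy hx.1, isUp_negDown h.trans₂ _ x y hxy hx.2⟩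

theorem sup_mem (h : IsUrq le₁ le₂) {C₁ C₂ : Set Z} (h₁ : C₁ ∈ urqSets le₁ le₂)
    (h₂ : C₂ ∈ urqSets le₁ le₂) :
    negDown le₁ (negDown le₂ C₁ ∩ negDown le₂ C₂) ∈ urqSets le₁ le₂ := by
  refine ⟨isUp_negDown h.trans₁ _, by rw [h.neg_sup h₁ h₂], h.closed_sup C₁ h₁ C₂ h₂, ?_⟩
  rw [h.neg_sup h₁ h₂]
  exact h₁.2.2.2.inter h₂.2.2.2

theorem inter_mem (h : IsUrq le₁ le₂) {C₁ C₂ : Set Z} (h₁ : C₁ ∈ urqSets le₁ le₂)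
    (h₂ : C₂ ∈ urqSets le₁ le₂) : C₁ ∩ C₂ ∈ urqSets le₁ le₂ := by
  have hup : IsUp le₁ (C₁ ∩ C₂) := fun x y hxy hx =>
    ⟨h₁.1 x y hxy hx.1, h₂.1 x y hxy hx.2⟩
  refine ⟨hup, Set.Subset.antisymm (Set.subset_inter ?_ ?_) (subset_negDown_negDown h.refl₂ hup),
    h₁.2.2.1.inter h₂.2.2.1, h.closed_inter C₁ h₁ C₂ h₂⟩
  · exact (negDown_anti le₁ (negDown_anti le₂ Set.inter_subset_left)).trans h₁.2.1.subset
  · exact (negDown_anti le₁ (negDown_anti le₂ Set.inter_subset_right)).trans h₂.2.1.subset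

theorem univ_mem (h : IsUrq le₁ le₂) : Set.univ ∈ urqSets le₁ le₂ :=
  ⟨fun _ _ _ _ => trivial, by rw [negDown_univ h.refl₂, negDown_empty], isClosed_univ, by
    rw [negDown_univ h.refl₂]
    exact isClosed_empty⟩

theorem empty_mem (h : IsUrq le₁ le₂) : ∅ ∈ urqSets le₁ le₂ :=
  ⟨fun _ _ _ h => h, by rw [negDown_empty, negDown_univ h.refl₁], isClosed_empty, by
    rw [negDown_empty]
    exact isClosed_univ⟩

end IsUrq

end UrqDefs

/-- Urquhart spaces. -/
structure Urq where
  Z : Type u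
  [top : TopologicalSpace Z]
  le₁ : Z → Z → Prop
  le₂ : Z → Z → Prop
  isUrq : IsUrq le₁ le₂

namespace Urq

attribute [instance] Urq.top

/-- The family `𝖫𝒰` of sets. -/
abbrev sets (U : Urq.{u}) : Set (Set U.Z) := urqSets U.le₁ U.le₂

/-- The map `φ`. -/
abbrev phi (U : Urq.{u}) (A : Set U.Z) : Set U.Z := negDown U.le₂ A

/-- The map `ψ`. -/
abbrev psi (U : Urq.{u}) (A : Set U.Z) : Set U.Z := negDown U.le₁ A

/-- Urquhart morphisms, as pairs of relations. -/
@[ext]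
structure Hom (U V : Urq.{u}) where
  P : U.Z → V.Z → Prop
  Q : U.Z → V.Z → Prop
  isHom : IsUrqHom U.le₁ U.le₂ V.le₁ V.le₂ P Q

theorem box_le₁ (U : Urq.{u}) {C : Set U.Z} (hC : C ∈ U.sets) : box U.le₁ C = C :=
  box_isUp U.isUrq.refl₁ hC.1

theorem box_le₂ (U : Urq.{u}) (C : Set U.Z) : box U.le₂ (U.phi C) = U.phi C :=
  box_isUp U.isUrq.refl₂ (isUp_negDown U.isUrq.trans₂ C)

theorem isHom_id (U : Urq.{u}) : IsUrqHom U.le₁ U.le₂ U.le₁ U.le₂ U.le₁ U.le₂ where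
  box_mem C hC := by rwa [U.box_le₁ hC]
  neg_box C hC := by rw [U.box_le₁ hC, U.box_le₂]
  sep_left z z' h := by
    obtain ⟨C, hC, h1, h2⟩ := U.isUrq.sep₁ z z' h
    exact ⟨C, hC, by rwa [U.box_le₁ hC], h2⟩
  sep_right z z' h := by
    obtain ⟨C, hC, h1, h2⟩ := U.isUrq.sep₂ z z' h
    exact ⟨C, hC, by rwa [U.box_le₂], h2⟩
  serial z := ⟨z, U.isUrq.refl₁ z, U.isUrq.refl₂ z⟩

/-- The sets `φC` with `C ∈ 𝖫𝒰`. -/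
def phiSets (U : Urq.{u}) : Set (Set U.Z) := {E | ∃ C ∈ U.sets, E = U.phi C}

theorem Hom.box_phi {U V : Urq.{u}} (h : U.Hom V) : ∀ E ∈ V.phiSets, box h.Q E ∈ U.phiSets := by
  rintro _ ⟨C, hC, rfl⟩
  exact ⟨box h.P C, h.isHom.box_mem C hC, (h.isHom.neg_box C hC).symm⟩

theorem Hom.sep_phi {U V : Urq.{u}} (h : U.Hom V) (z : U.Z) (z' : V.Z) (hn : ¬ h.Q z z') :
    ∃ E ∈ V.phiSets, z ∈ box h.Q E ∧ z' ∉ E := by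
  obtain ⟨C, hC, h1, h2⟩ := h.isHom.sep_right z z' hn
  exact ⟨_, ⟨C, hC, rfl⟩, h1, h2⟩

theorem box_le₂_phiSets (U : Urq.{u}) : ∀ E ∈ U.phiSets, box U.le₂ E = E := by
  rintro _ ⟨C, -, rfl⟩
  exact U.box_le₂ C

theorem isHom_comp {U V W : Urq.{u}} (h : U.Hom V) (k : V.Hom W) :
    IsUrqHom U.le₁ U.le₂ W.le₁ W.le₂ (star h.P k.P W.sets) (star h.Q k.Q W.phiSets) where
  box_mem C hC := by
    rw [box_star _ _ hC]
    exact h.isHom.box_mem _ (k.isHom.box_mem C hC)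
  neg_box C hC := by
    have hE : W.phi C ∈ W.phiSets := ⟨C, hC, rfl⟩
    rw [box_star _ _ hC, box_star _ _ hE, h.isHom.neg_box _ (k.isHom.box_mem C hC),
      k.isHom.neg_box C hC]
  sep_left z z' hn := by
    simp only [star, not_forall] at hn
    obtain ⟨C, hC, h1, h2⟩ := hn
    exact ⟨C, hC, by rwa [box_star _ _ hC], h2⟩
  sep_right z z' hn := by
    simp only [star, not_forall] at hn
    obtain ⟨_, ⟨C, hC, rfl⟩, h1, h2⟩ := hn
    have hE : W.phi C ∈ W.phiSets := ⟨C, hC, rfl⟩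
    exact ⟨C, hC, by rwa [box_star _ _ hE], h2⟩
  serial z := by
    obtain ⟨z', h1, h2⟩ := h.isHom.serial z
    obtain ⟨z'', h3, h4⟩ := k.isHom.serial z'
    exact ⟨z'', fun C _ hC => hC _ h1 _ h3, fun E _ hE => hE _ h2 _ h4⟩

/-- The category of Urquhart spaces; composition is `⋆` and the identities are `(≤₁, ≤₂)`. -/
instance : Category.{u} Urq.{u} where
  Hom := Hom
  id U := ⟨U.le₁, U.le₂, U.isHom_id⟩
  comp {_ _ W} h k := ⟨star h.P k.P W.sets, star h.Q k.Q W.phiSets, isHom_comp h k⟩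
  id_comp {U _} h := Hom.ext
    (star_id_left (fun C hC => U.box_le₁ (h.isHom.box_mem C hC)) h.isHom.sep_left)
    (star_id_left (fun E hE => U.box_le₂_phiSets _ (h.box_phi E hE)) h.sep_phi)
  comp_id {_ V} h := Hom.ext
    (star_id_right (fun _ hC => V.box_le₁ hC) h.isHom.sep_left)
    (star_id_right V.box_le₂_phiSets h.sep_phi)
  assoc h k l := Hom.ext (star_assoc h.P k.P l.P l.isHom.box_mem)
    (star_assoc h.Q k.Q l.Q l.box_phi)

/-- `𝖫𝒰`, the lattice of `≤₁`-upsets `C = ψφC` such that `C` and `φC` are closed. -/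
def L (U : Urq.{u}) : Type u := {C : Set U.Z // C ∈ U.sets}

/-- `C₁ ∧ C₂ = C₁ ∩ C₂` and `C₁ ∨ C₂ = ψ(φC₁ ∩ φC₂)`, ordered by inclusion. -/
instance (U : Urq.{u}) : Lattice U.L where
  le C D := C.1 ⊆ D.1
  le_refl _ := Set.Subset.rfl
  le_trans _ _ _ h₁ h₂ := Set.Subset.trans h₁ h₂
  le_antisymm _ _ h₁ h₂ := Subtype.ext (Set.Subset.antisymm h₁ h₂)
  sup C D := ⟨U.psi (U.phi C.1 ∩ U.phi D.1), U.isUrq.sup_mem C.2 D.2⟩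
  le_sup_left C _ := C.2.2.1.symm.subset.trans (negDown_anti _ Set.inter_subset_left)
  le_sup_right _ D := D.2.2.1.symm.subset.trans (negDown_anti _ Set.inter_subset_right)
  sup_le _ _ E h₁ h₂ := (negDown_anti _ (Set.subset_inter (negDown_anti _ h₁)
    (negDown_anti _ h₂))).trans E.2.2.1.subset
  inf C D := ⟨C.1 ∩ D.1, U.isUrq.inter_mem C.2 D.2⟩
  inf_le_left _ _ := Set.inter_subset_left
  inf_le_right _ _ := Set.inter_subset_right
  le_inf _ _ _ h₁ h₂ := Set.subset_inter h₁ h₂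

instance (U : Urq.{u}) : BoundedOrder U.L where
  top := ⟨Set.univ, U.isUrq.univ_mem⟩
  le_top _ := Set.subset_univ _
  bot := ⟨∅, U.isUrq.empty_mem⟩
  bot_le _ := Set.empty_subset _

/-- The action of `𝕃_Urq` on morphisms: `C ↦ □_P C`. -/
def latMap {U V : Urq.{u}} (h : U ⟶ V) : BoundedLatticeHom V.L U.L where
  toFun C := ⟨box h.P C.1, h.isHom.box_mem _ C.2⟩
  map_sup' C D := Subtype.ext <| by
    have hW := V.isUrq.sup_mem C.2 D.2
    change box h.P (V.psi (V.phi C.1 ∩ V.phi D.1)) =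
      U.psi (U.phi (box h.P C.1) ∩ U.phi (box h.P D.1))
    rw [← (h.isHom.box_mem _ hW).2.1, h.isHom.neg_box _ hW, V.isUrq.neg_sup C.2 D.2, box_inter,
      ← h.isHom.neg_box _ C.2, ← h.isHom.neg_box _ D.2]
  map_inf' C D := Subtype.ext (box_inter h.P C.1 D.1)
  map_top' := Subtype.ext (box_univ h.P)
  map_bot' := Subtype.ext <| Set.eq_empty_of_forall_notMem fun z hz => by
    obtain ⟨z', h1, -⟩ := h.isHom.serial z
    exact hz z' h1

/-- The functor `𝕃_Urq`, sending `𝒰` to `𝖫𝒰` and `(P, Q)` to `□_P`. -/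
def latFunctor : Urq.{u}ᵒᵖ ⥤ BddLat.{u} where
  obj U := BddLat.of U.unop.L
  map h := BddLat.ofHom (latMap h.unop)
  map_id U := BddLat.ext fun C => Subtype.ext (U.unop.box_le₁ (Subtype.prop C))
  map_comp h k := BddLat.ext fun C =>
    Subtype.ext (box_star k.unop.P h.unop.P (Subtype.prop C))

end Urq

/-! ### Ploščica spaces -/

section PloDefs

variable {Z Z' : Type*}

/-- The pair `(Z, R)` is a Ploščica space. -/
structure IsPlo [tZ : TopologicalSpace Z] (R : Z → Z → Prop) : Prop where
  refl : ∀ z, R z z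
  compact : CompactSpace Z
  t1 : T1Space Z
  subbasis : tZ = TopologicalSpace.generateFrom
    {W | ∃ C ∈ closedSets R, W = Cᶜ ∨ W = bdia R C}
  closed_inter : ∀ C₁ ∈ closedSets R, ∀ C₂ ∈ closedSets R, IsClosed (bdia R (C₁ ∩ C₂))ᶜ
  closed_sup : ∀ C₁ ∈ closedSets R, ∀ C₂ ∈ closedSets R, IsClosed (box R (bdia R (C₁ ∪ C₂)))
  sep_left : ∀ x y, ¬ ({z | R y z} ⊆ {z | R x z}) → ∃ C ∈ closedSets R, x ∈ C ∧ y ∉ C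
  sep_right : ∀ x y, ¬ ({z | R z y} ⊆ {z | R z x}) →
    ∃ C ∈ closedSets R, x ∉ bdia R C ∧ y ∈ bdia R C
  interpolate : ∀ x y, R x y → ∃ z, {w | R z w} ⊆ {w | R x w} ∧ {w | R w z} ⊆ {w | R w y}

/-- Ploščica morphisms. -/
structure IsPloHom [TopologicalSpace Z] [TopologicalSpace Z'] (R : Z → Z → Prop)
    (R' : Z' → Z' → Prop) (P Q : Z → Z' → Prop) : Prop
    extends IsBoxHom R (closedSets R) R' (closedSets R') P Q where
  serial : ∀ z, ∃ z', P z z' ∧ Q z z'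

theorem IsPlo.isPolFamily [TopologicalSpace Z] {R : Z → Z → Prop} (h : IsPlo R) :
    IsPolFamily R (closedSets R) where
  fix _ hU := hU.1
  inter U hU V hV := ⟨box_inter_eq hU.1 hV.1, hU.2.1.inter hV.2.1, h.closed_inter U hU V hV⟩
  sup U hU V hV := by
    refine ⟨by rw [bdia_box_bdia], h.closed_sup U hU V hV, ?_⟩
    rw [bdia_box_bdia, bdia_union, Set.compl_union]
    exact hU.2.2.inter hV.2.2
  univ := by
    refine ⟨Set.eq_univ_of_univ_subset (subset_box_bdia R _), isClosed_univ, ?_⟩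
    have : bdia R Set.univ = Set.univ := Set.eq_univ_of_forall fun z => ⟨z, h.refl z, trivial⟩
    rw [this, Set.compl_univ]
    exact isClosed_empty
  bot := by
    have : box R (bdia R ∅) = ∅ := by
      rw [bdia_empty]
      exact Set.eq_empty_of_forall_notMem fun z hz => hz z (h.refl z)
    rw [this]
    refine ⟨this, isClosed_empty, ?_⟩
    rw [bdia_empty, Set.compl_empty]
    exact isClosed_univ

end PloDefs

/-- Ploščica spaces. -/
structure Plo where
  Z : Type u
  [top : TopologicalSpace Z]
  R : Z → Z → Prop
  isPlo : IsPlo R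

namespace Plo

attribute [instance] Plo.top

/-- Ploščica morphisms, as pairs of relations. -/
@[ext]
structure Hom (A B : Plo.{u}) where
  P : A.Z → B.Z → Prop
  Q : A.Z → B.Z → Prop
  isHom : IsPloHom A.R B.R P Q

/-- The category of Ploščica spaces; composition is `⋆`, and the identities are `(≤₁, ≤₂)` where
`x ≤₁ z` iff `R[z] ⊆ R[x]` and `y ≤₂ z` iff `R⁻¹[z] ⊆ R⁻¹[y]`. -/
instance : Category.{u} Plo.{u} where
  Hom := Hom
  id A := ⟨leX A.R, leY A.R, isBoxHom_id A.isPlo.isPolFamily.fix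
      (fun x y h => A.isPlo.sep_left x y h) (fun x y h => A.isPlo.sep_right x y h),
    fun z => ⟨z, fun _ h => h, fun _ h => h⟩⟩
  comp {_ _ C} h k := ⟨star h.P k.P (closedSets C.R), costar h.Q k.Q C.R (closedSets C.R),
    h.isHom.toIsBoxHom.comp k.isHom.toIsBoxHom, fun z => by
      obtain ⟨z', h1, h2⟩ := h.isHom.serial z
      obtain ⟨z'', h3, h4⟩ := k.isHom.serial z'
      exact ⟨z'', fun U _ hU => hU _ h1 _ h3, fun U _ hU => ⟨z', h2, z'', h4, hU⟩⟩⟩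
  id_comp h := Hom.ext
    (star_id_left (fun U hU => box_leX (h.isHom.box_mem U hU).1) h.isHom.sep_left)
    (h.isHom.toIsBoxHom.costar_id_left fun U _ => dia_leY U)
  comp_id h := Hom.ext
    (star_id_right (fun _ hU => box_leX hU.1) h.isHom.sep_left)
    (h.isHom.toIsBoxHom.costar_id_right fun U _ => dia_leY U)
  assoc h k l := Hom.ext
    (star_assoc h.P k.P l.P l.isHom.box_mem)
    (l.isHom.toIsBoxHom.costar_assoc h.Q k.Q)

/-- `𝖫𝒫`, the lattice of closed sets `C = □◆C` with `-◆C` closed. -/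
def L (A : Plo.{u}) : Type u := {C : Set A.Z // C ∈ closedSets A.R}

instance (A : Plo.{u}) : Lattice A.L := polLattice A.isPlo.isPolFamily

instance (A : Plo.{u}) : BoundedOrder A.L := polBounded A.isPlo.isPolFamily

/-- The action of `𝕃_Plo` on morphisms: `C ↦ □_P C`. -/
def latMap {A B : Plo.{u}} (h : A ⟶ B) : BoundedLatticeHom B.L A.L where
  toFun U := ⟨box h.P U.1, h.isHom.box_mem _ U.2⟩
  map_sup' U V := Subtype.ext
    (h.isHom.toIsBoxHom.box_sup A.isPlo.isPolFamily B.isPlo.isPolFamily U.2 V.2)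
  map_inf' U V := Subtype.ext (box_inter h.P U.1 V.1)
  map_top' := Subtype.ext (box_univ h.P)
  map_bot' := Subtype.ext
    (h.isHom.toIsBoxHom.box_bot A.isPlo.isPolFamily B.isPlo.isPolFamily)

/-- The functor `𝕃_Plo`, sending `𝒫` to `𝖫𝒫` and `(P, Q)` to `□_P`. -/
def latFunctor : Plo.{u}ᵒᵖ ⥤ BddLat.{u} where
  obj A := BddLat.of A.unop.L
  map h := BddLat.ofHom (latMap h.unop)
  map_id _ := BddLat.ext fun U => Subtype.ext (box_leX (Subtype.prop U).1)
  map_comp h k := BddLat.ext fun U =>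
    Subtype.ext (box_star k.unop.P h.unop.P (Subtype.prop U))

end Plo

/-! ### The functor `𝔾` from Dunn–Hartonas spaces to Gehrke–van Gool spaces -/

section Prime

variable {X X' : Type*}

/-- d-prime elements: `x ≠ ⊤`, and whenever a finite meet `⋀ M` of compact elements is distributive
(that is, `a ⊔ ⋀ M = ⋀ {a ⊔ m : m ∈ M}` for every compact `a`) and `⋀ M ≤ x`, then `m ≤ x` for some
`m ∈ M`. -/
def IsDPrime [CompleteLattice X] (x : X) : Prop :=
  x ≠ ⊤ ∧ ∀ M : Finset X, (∀ m ∈ M, IsCompactElement m) →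
    (∀ a, IsCompactElement a → a ⊔ M.inf id = M.inf fun m => a ⊔ m) →
    M.inf id ≤ x → ∃ m ∈ M, m ≤ x

/-- The relation `x S_f x'` iff `f(x) ≤ x'` between d-prime elements. -/
def primeRel [CompleteLattice X] [CompleteLattice X'] (f : X → X') :
    {x : X // IsDPrime x} → {x' : X' // IsDPrime x'} → Prop :=
  fun x x' => f x.1 ≤ x'.1

end Prime

namespace DH

/-- The restriction `R_p` of `R` to the d-prime elements. The sets `X_p`, `Y_p` of d-prime elements
carry the subspace topologies and the restricted orders. -/
def Rp (D : DH.{u}) : {x : D.X // IsDPrime x} → {y : D.Y // IsDPrime y} → Prop :=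
  fun x y => D.R x.1 y.1

end DH

/-- `(X, R, Y) ↦ (X_p, R_p, Y_p)` and `(f, g) ↦ (S_f, T_g)` define a functor `DH ⥤ GvG`. (That
identities are preserved holds by definition.) -/
structure GWellDefined : Prop where
  obj : ∀ D : DH.{u}, IsGvG D.Rp
  map : ∀ {D E : DH.{u}} (h : D ⟶ E), IsGvGHom D.Rp E.Rp (primeRel h.f) (primeRel h.g)
  comp_left : ∀ {D E F : DH.{u}} (h : D ⟶ E) (k : E ⟶ F),
    primeRel (h ≫ k).f = star (primeRel h.f) (primeRel k.f) (gvgSets F.Rp)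
  comp_right : ∀ {D E F : DH.{u}} (h : D ⟶ E) (k : E ⟶ F),
    primeRel (h ≫ k).g = costar (primeRel h.g) (primeRel k.g) F.Rp (gvgSets F.Rp)

/-- The functor `𝔾`. -/
def functorG (w : GWellDefined.{u}) : DH.{u} ⥤ GvG.{u} where
  obj D := ⟨{x : D.X // IsDPrime x}, {y : D.Y // IsDPrime y}, D.Rp, w.obj D⟩
  map h := ⟨primeRel h.f, primeRel h.g, w.map h⟩
  map_id _ := rfl
  map_comp h k := GvG.Hom.ext (w.comp_left h k) (w.comp_right h k)

/-! ### The functor `ℍ` from Gehrke–van Gool spaces to Hartung spaces -/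

/-- The topology of open downsets. -/
@[reducible]
def openDownsets (X : Type*) [Preorder X] [TopologicalSpace X] : TopologicalSpace X where
  IsOpen U := IsOpen U ∧ IsLowerSet U
  isOpen_univ := ⟨isOpen_univ, isLowerSet_univ⟩
  isOpen_inter _ _ hU hV := ⟨hU.1.inter hV.1, hU.2.inter hV.2⟩
  isOpen_sUnion _ h := ⟨isOpen_sUnion fun U hU => (h U hU).1, isLowerSet_sUnion fun U hU => (h U hU).2⟩

namespace GvG

/-- `X_0`, with the subspace topology of the topology of open downsets of `X`. -/
def X₀ (G : GvG.{u}) : Type u := {x : G.X // x ∈ maxLeft G.R}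

/-- `Y_0`, with the subspace topology of the topology of open downsets of `Y`. -/
def Y₀ (G : GvG.{u}) : Type u := {y : G.Y // y ∈ maxRight G.R}

instance (G : GvG.{u}) : TopologicalSpace G.X₀ :=
  TopologicalSpace.induced Subtype.val (openDownsets G.X)

instance (G : GvG.{u}) : TopologicalSpace G.Y₀ :=
  TopologicalSpace.induced Subtype.val (openDownsets G.Y)

/-- The restriction `R_0` of `R` to `X_0` and `Y_0`. -/
def R₀ (G : GvG.{u}) : G.X₀ → G.Y₀ → Prop := fun x y => G.R x.1 y.1

/-- The restriction `S_0` of `S` to `X_0` and `X'_0`. -/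
def S₀ {G H : GvG.{u}} (h : G ⟶ H) : G.X₀ → H.X₀ → Prop := fun x x' => h.S x.1 x'.1

/-- The restriction `T_0` of `T` to `Y_0` and `Y'_0`. -/
def T₀ {G H : GvG.{u}} (h : G ⟶ H) : G.Y₀ → H.Y₀ → Prop := fun y y' => h.T y.1 y'.1

end GvG

/-- `(X, R, Y) ↦ (X_0, R_0, Y_0)` and `(S, T) ↦ (S_0, T_0)` define a functor `GvG ⥤ Hg`. -/
structure HWellDefined : Prop where
  obj : ∀ G : GvG.{u}, IsHg G.R₀
  map : ∀ {G H : GvG.{u}} (h : G ⟶ H), IsHgHom G.R₀ H.R₀ (GvG.S₀ h) (GvG.T₀ h)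
  id_left : ∀ G : GvG.{u}, GvG.S₀ (𝟙 G) = leX G.R₀
  id_right : ∀ G : GvG.{u}, GvG.T₀ (𝟙 G) = leY G.R₀
  comp_left : ∀ {G H K : GvG.{u}} (h : G ⟶ H) (k : H ⟶ K),
    GvG.S₀ (h ≫ k) = star (GvG.S₀ h) (GvG.S₀ k) (closedSets K.R₀)
  comp_right : ∀ {G H K : GvG.{u}} (h : G ⟶ H) (k : H ⟶ K),
    GvG.T₀ (h ≫ k) = costar (GvG.T₀ h) (GvG.T₀ k) K.R₀ (closedSets K.R₀)

/-- The functor `ℍ`. -/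
def functorH (w : HWellDefined.{u}) : GvG.{u} ⥤ Hg.{u} where
  obj G := ⟨G.X₀, G.Y₀, G.R₀, w.obj G⟩
  map h := ⟨GvG.S₀ h, GvG.T₀ h, w.map h⟩
  map_id G := Hg.Hom.ext (w.id_left G) (w.id_right G)
  map_comp h k := Hg.Hom.ext (w.comp_left h k) (w.comp_right h k)

/-! ### The functor `𝕌` from Hartung spaces to Urquhart spaces -/

namespace Hg

/-- The set `Z_ℋ` of pairs `(x, y)` such that `x` is `y`-maximal and `y` is `x`-maximal, with the
subspace topology of the product topology. -/
abbrev MaxPairs (H : Hg.{u}) : Type u :=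
  {p : H.X × H.Y // IsMaxLeft H.R p.1 p.2 ∧ IsMaxRight H.R p.1 p.2}

/-- `(x, y) ≤₁ (x', y')` iff `x ≤_X x'`. -/
def le₁ (H : Hg.{u}) (p q : H.MaxPairs) : Prop := leX H.R p.1.1 q.1.1

/-- `(x, y) ≤₂ (x', y')` iff `y ≤_Y y'`. -/
def le₂ (H : Hg.{u}) (p q : H.MaxPairs) : Prop := leY H.R p.1.2 q.1.2

/-- `(x, y) P (x', y')` iff `x S x'`. -/
def P {H K : Hg.{u}} (h : H ⟶ K) (p : H.MaxPairs) (q : K.MaxPairs) : Prop := h.S p.1.1 q.1.1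

/-- `(x, y) Q (x', y')` iff `y T y'`. -/
def Q {H K : Hg.{u}} (h : H ⟶ K) (p : H.MaxPairs) (q : K.MaxPairs) : Prop := h.T p.1.2 q.1.2

end Hg

/-- `ℋ ↦ (Z_ℋ, ≤₁, ≤₂)` and `(S, T) ↦ (P, Q)` define a functor `Hg ⥤ Urq`. (That identities are
preserved holds by definition.) -/
structure UWellDefined : Prop where
  obj : ∀ H : Hg.{u}, IsUrq H.le₁ H.le₂
  map : ∀ {H K : Hg.{u}} (h : H ⟶ K), IsUrqHom H.le₁ H.le₂ K.le₁ K.le₂ (Hg.P h) (Hg.Q h)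
  comp_left : ∀ {H K M : Hg.{u}} (h : H ⟶ K) (k : K ⟶ M),
    Hg.P (h ≫ k) = star (Hg.P h) (Hg.P k) (urqSets M.le₁ M.le₂)
  comp_right : ∀ {H K M : Hg.{u}} (h : H ⟶ K) (k : K ⟶ M),
    Hg.Q (h ≫ k) = star (Hg.Q h) (Hg.Q k)
      {E | ∃ C ∈ urqSets M.le₁ M.le₂, E = negDown M.le₂ C}

/-- The functor `𝕌`. -/
def functorU (w : UWellDefined.{u}) : Hg.{u} ⥤ Urq.{u} where
  obj H := ⟨H.MaxPairs, H.le₁, H.le₂, w.obj H⟩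
  map h := ⟨Hg.P h, Hg.Q h, w.map h⟩
  map_id _ := rfl
  map_comp h k := Urq.Hom.ext (w.comp_left h k) (w.comp_right h k)

/-! ### The functor `𝔻` from Urquhart spaces to Dunn–Hartonas spaces -/

section Stable

variable {Z : Type*} [TopologicalSpace Z]

/-- The closed `le`-upsets `D` with `-↓(-↓'D) = D`. -/
def stableSets (le le' : Z → Z → Prop) : Set (Set Z) :=
  {D | IsUp le D ∧ IsClosed D ∧ negDown le (negDown le' D) = D}

theorem sInter_mem_stableSets {le le' : Z → Z → Prop} (h : ∀ x, le' x x) {s : Set (Set Z)}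
    (hs : s ⊆ stableSets le le') : ⋂₀ s ∈ stableSets le le' := by
  have hup : IsUp le (⋂₀ s) := fun x y hxy hx D hD => (hs hD).1 x y hxy (hx D hD)
  refine ⟨hup, isClosed_sInter fun D hD => (hs hD).2.1,
    Set.Subset.antisymm (Set.subset_sInter fun D hD => ?_) (subset_negDown_negDown h hup)⟩
  exact (negDown_anti le (negDown_anti le' (Set.sInter_subset_of_mem hD))).trans
    (hs hD).2.2.subset

/-- Stable sets ordered by reverse inclusion. -/
@[reducible]
def stableOrder (le le' : Z → Z → Prop) : PartialOrder {D : Set Z // D ∈ stableSets le le'} where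
  le D E := E.1 ⊆ D.1
  lt D E := E.1 ⊆ D.1 ∧ ¬ D.1 ⊆ E.1
  le_refl _ := Set.Subset.rfl
  le_trans _ _ _ h₁ h₂ := Set.Subset.trans h₂ h₁
  le_antisymm _ _ h₁ h₂ := Subtype.ext (Set.Subset.antisymm h₂ h₁)

/-- Stable sets ordered by reverse inclusion form a complete lattice, in which suprema are
intersections. -/
@[reducible]
def stableLattice {le le' : Z → Z → Prop} (h : ∀ x, le' x x) :
    CompleteLattice {D : Set Z // D ∈ stableSets le le'} :=
  letI := stableOrder le le'
  letI : SupSet {D : Set Z // D ∈ stableSets le le'} :=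
    ⟨fun s => ⟨⋂₀ (Subtype.val '' s), sInter_mem_stableSets h (by
      rintro _ ⟨D, -, rfl⟩
      exact D.2)⟩⟩
  completeLatticeOfSup _ fun s => ⟨fun D hD => Set.sInter_subset_of_mem ⟨D, hD, rfl⟩,
    fun E hE => Set.subset_sInter (by
      rintro _ ⟨D, hD, rfl⟩
      exact hE hD)⟩

end Stable

namespace Urq

/-- `𝖫𝖢 𝒰`, the closed `≤₁`-upsets `D` with `ψφD = D`. -/
def LC (U : Urq.{u}) : Type u := {D : Set U.Z // D ∈ stableSets U.le₁ U.le₂}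

/-- `𝖱𝖢 𝒰`, the closed `≤₂`-upsets `E` with `φψE = E`. -/
def RC (U : Urq.{u}) : Type u := {E : Set U.Z // E ∈ stableSets U.le₂ U.le₁}

instance (U : Urq.{u}) : CompleteLattice U.LC := stableLattice U.isUrq.refl₂

instance (U : Urq.{u}) : CompleteLattice U.RC := stableLattice U.isUrq.refl₁

instance (U : Urq.{u}) : TopologicalSpace U.LC := Topology.lawson U.LC

instance (U : Urq.{u}) : TopologicalSpace U.RC := Topology.lawson U.RC

/-- `D R_𝒰 E` iff `D ∩ E` is nonempty. -/
def meets (U : Urq.{u}) : U.LC → U.RC → Prop := fun D E => (D.1 ∩ E.1).Nonempty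

/-- `f_{PQ}(D) = ⋂ {C' ∈ 𝖫𝒰' : D ⊆ □_P C'}`. -/
def mapLC {U V : Urq.{u}} (h : U ⟶ V) (D : U.LC) : V.LC :=
  ⟨⋂₀ {C | C ∈ V.sets ∧ D.1 ⊆ box h.P C},
    sInter_mem_stableSets V.isUrq.refl₂ fun _ hC => ⟨hC.1.1, hC.1.2.2.1, hC.1.2.1⟩⟩

/-- `g_{PQ}(E) = ⋂ {φ'C' : C' ∈ 𝖫𝒰', E ⊆ □_Q φ'C'}`. -/
def mapRC {U V : Urq.{u}} (h : U ⟶ V) (E : U.RC) : V.RC :=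
  ⟨⋂₀ {B | ∃ C ∈ V.sets, B = V.phi C ∧ E.1 ⊆ box h.Q (V.phi C)},
    sInter_mem_stableSets V.isUrq.refl₁ (by
      rintro _ ⟨C, hC, rfl, -⟩
      exact ⟨isUp_negDown V.isUrq.trans₂ C, hC.2.2.2, congrArg V.phi hC.2.1⟩)⟩

end Urq

/-- `𝒰 ↦ (𝖫𝖢 𝒰, R_𝒰, 𝖱𝖢 𝒰)` and `(P, Q) ↦ (f_{PQ}, g_{PQ})` define a functor `Urq ⥤ DH`. -/
structure DWellDefined : Prop where
  obj : ∀ U : Urq.{u}, IsDH U.meets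
  map : ∀ {U V : Urq.{u}} (h : U ⟶ V), IsDHHom U.meets V.meets (Urq.mapLC h) (Urq.mapRC h)
  id_left : ∀ (U : Urq.{u}) (D : U.LC), Urq.mapLC (𝟙 U) D = D
  id_right : ∀ (U : Urq.{u}) (E : U.RC), Urq.mapRC (𝟙 U) E = E
  comp_left : ∀ {U V W : Urq.{u}} (h : U ⟶ V) (k : V ⟶ W) (D : U.LC),
    Urq.mapLC (h ≫ k) D = Urq.mapLC k (Urq.mapLC h D)
  comp_right : ∀ {U V W : Urq.{u}} (h : U ⟶ V) (k : V ⟶ W) (E : U.RC),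
    Urq.mapRC (h ≫ k) E = Urq.mapRC k (Urq.mapRC h E)

/-- The functor `𝔻`. -/
def functorD (w : DWellDefined.{u}) : Urq.{u} ⥤ DH.{u} where
  obj U := ⟨U.LC, U.RC, U.meets, w.obj U⟩
  map h := ⟨Urq.mapLC h, Urq.mapRC h, w.map h⟩
  map_id U := DH.Hom.ext (funext (w.id_left U)) (funext (w.id_right U))
  map_comp h k := DH.Hom.ext (funext (w.comp_left h k)) (funext (w.comp_right h k))

/-! ### The functor `ℙ` from Urquhart spaces to Ploščica spaces -/

namespace Urq

/-- `x R_𝒰 y` iff there is `z` with `x ≤₁ z` and `y ≤₂ z`. -/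
def ploRel (U : Urq.{u}) : U.Z → U.Z → Prop := fun x y => ∃ z, U.le₁ x z ∧ U.le₂ y z

end Urq

/-- `(Z, ≤₁, ≤₂) ↦ (Z, R_𝒰)` and `(P, Q) ↦ (P, Q)` define a functor `Urq ⥤ Plo`. -/
structure PWellDefined : Prop where
  obj : ∀ U : Urq.{u}, IsPlo U.ploRel
  map : ∀ {U V : Urq.{u}} (h : U ⟶ V), IsPloHom U.ploRel V.ploRel h.P h.Q
  id_left : ∀ U : Urq.{u}, U.le₁ = leX U.ploRel
  id_right : ∀ U : Urq.{u}, U.le₂ = leY U.ploRel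
  comp_left : ∀ {U V W : Urq.{u}} (h : U ⟶ V) (k : V ⟶ W),
    (h ≫ k).P = star h.P k.P (closedSets W.ploRel)
  comp_right : ∀ {U V W : Urq.{u}} (h : U ⟶ V) (k : V ⟶ W),
    (h ≫ k).Q = costar h.Q k.Q W.ploRel (closedSets W.ploRel)

/-- The functor `ℙ`. -/
def functorP (w : PWellDefined.{u}) : Urq.{u} ⥤ Plo.{u} where
  obj U := ⟨U.Z, U.ploRel, w.obj U⟩
  map h := ⟨h.P, h.Q, w.map h⟩
  map_id U := Plo.Hom.ext (w.id_left U) (w.id_right U)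
  map_comp h k := Plo.Hom.ext (w.comp_left h k) (w.comp_right h k)

end LatDual

open LatDual

/-! All five kinds of space store the same data, namely filters and ideals of a bounded lattice `L`,
and differ only in which filters and ideals they keep as points. The common core is `PolRep`: points
of `X` give filters, points of `Y` give ideals, `R` is disjointness, and every disjoint filter-ideal
pair lies inside a related pair of points. This last clause, `rich`, plays the part of the prime
filter theorem when `L` need not be distributive. From it alone, `u c` is Galois-stable with polar
`v c`, `u` is an order embedding, and the order on points is inclusion of filters.

Morphisms are treated once for all. A lattice homomorphism `φ` induces the relation `canRel` ("the
pullback along `φ` of the filter of `x` is contained in the filter of `x'`"); `box_canRel` shows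
that it acts on the sets `u c` as `φ`, and `IsBoxHom.eq_canRel` that a morphism is determined by
this action. Functoriality and full faithfulness then reduce to two facts about objects: each space
represents its own lattice, and each construction yields a space representing the same lattice.

The first fact is a compactness argument (`polRep_of_compact`, `Urq.diagRep`), except for
Dunn–Hartonas spaces, whose two sides are shown to be the full lattices of filters and of ideals
(`DH.dhRep`). For the second, Zorn's lemma refines `rich` to pairs that are maximal for each other
(`exists_max_pair`). Such pairs survive in `X₀`, in the maximal pairs, and among the d-prime
elements (`isDPrime_of_max`), so `rich` is inherited. Conversely `rich` and Alexander's subbasis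
lemma give compactness, which forces the closed stable sets to be exactly the `u c` (`mem_range`). A
doubly ordered set is the case in which one point carries both a filter and an ideal (`DiagRep`),
and a Ploščica space is an Urquhart space written with the relation "has a common upper bound".

The lattice functors other than the Ploščica one are thus fully faithful. The maximal disjoint pairs
of an arbitrary lattice form an Urquhart space, so the Urquhart functor is essentially surjective,
and the natural isomorphisms carry this around the cycle to Dunn–Hartonas, Gehrke–van Gool and
Hartung spaces. Two-out-of-three makes the functors between these categories equivalences; the
passage to Ploščica spaces is an equivalence by inspection. -/

namespace LatDual

/-! ### Filters and ideals of a lattice -/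

section FilterIdeal

variable {L : Type*} [Lattice L]

/-- A (nonempty) ideal of a lattice. -/
structure IsLatIdeal (I : Set L) : Prop where
  nonempty : I.Nonempty
  lower : IsLowerSet I
  sup_mem : ∀ a ∈ I, ∀ b ∈ I, a ⊔ b ∈ I

/-- Filters and ideals trade places in the order dual; this is what lets facts about the ideal side
be read off from the filter side. -/
theorem IsLatFilter.dual {F : Set L} (h : IsLatFilter F) :
    IsLatIdeal (L := Lᵒᵈ) (OrderDual.ofDual ⁻¹' F) :=
  ⟨h.nonempty, fun _ _ hab ha => h.upper hab ha, h.inf_mem⟩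

theorem IsLatIdeal.dual {I : Set L} (h : IsLatIdeal I) :
    IsLatFilter (X := Lᵒᵈ) (OrderDual.ofDual ⁻¹' I) :=
  ⟨h.nonempty, fun _ _ hab ha => h.lower hab ha, h.sup_mem⟩

theorem isLatIdeal_Iic (k : L) : IsLatIdeal (Set.Iic k) :=
  ⟨⟨k, le_rfl⟩, isLowerSet_Iic k, fun _ ha _ hb => sup_le ha hb⟩

theorem IsLatFilter.top_mem [OrderTop L] {F : Set L} (h : IsLatFilter F) : ⊤ ∈ F := by
  obtain ⟨a, ha⟩ := h.nonempty
  exact h.upper le_top ha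

theorem IsLatIdeal.bot_mem [OrderBot L] {I : Set L} (h : IsLatIdeal I) : ⊥ ∈ I := by
  obtain ⟨a, ha⟩ := h.nonempty
  exact h.lower bot_le ha

theorem IsLatFilter.finset_inf_mem [OrderTop L] {F : Set L} (h : IsLatFilter F) {ι : Type*}
    (t : Finset ι) (f : ι → L) (ht : ∀ i ∈ t, f i ∈ F) : t.inf f ∈ F :=
  Finset.inf_induction h.top_mem h.inf_mem ht

theorem IsLatIdeal.finset_sup_mem [OrderBot L] {I : Set L} (h : IsLatIdeal I) {ι : Type*}
    (t : Finset ι) (f : ι → L) (ht : ∀ i ∈ t, f i ∈ I) : t.sup f ∈ I :=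
  Finset.sup_induction h.bot_mem h.sup_mem ht

/-- The filter generated by a set. -/
def filterGen [OrderTop L] (A : Set L) : Set L := {c | ∃ t : Finset L, ↑t ⊆ A ∧ t.inf id ≤ c}

/-- The ideal generated by a set. -/
def idealGen [OrderBot L] (A : Set L) : Set L := {c | ∃ t : Finset L, ↑t ⊆ A ∧ c ≤ t.sup id}

theorem isLatFilter_filterGen [OrderTop L] (A : Set L) : IsLatFilter (filterGen A) := by
  classical
  refine ⟨⟨⊤, ∅, by simp⟩, fun a b hab ⟨t, ht, h⟩ => ⟨t, ht, h.trans hab⟩, ?_⟩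
  rintro a ⟨s, hs, ha⟩ b ⟨t, ht, hb⟩
  refine ⟨s ∪ t, by simp [hs, ht], ?_⟩
  rw [Finset.inf_union]
  exact inf_le_inf ha hb

theorem isLatIdeal_idealGen [OrderBot L] (A : Set L) : IsLatIdeal (idealGen A) := by
  classical
  refine ⟨⟨⊥, ∅, by simp⟩, fun a b hab ⟨t, ht, h⟩ => ⟨t, ht, hab.trans h⟩, ?_⟩
  rintro a ⟨s, hs, ha⟩ b ⟨t, ht, hb⟩
  refine ⟨s ∪ t, by simp [hs, ht], ?_⟩
  rw [Finset.sup_union]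
  exact sup_le_sup ha hb

theorem subset_filterGen [OrderTop L] (A : Set L) : A ⊆ filterGen A :=
  fun a ha => ⟨{a}, by simpa using ha, by simp⟩

theorem subset_idealGen [OrderBot L] (A : Set L) : A ⊆ idealGen A :=
  fun a ha => ⟨{a}, by simpa using ha, by simp⟩

/-- Every filter disjoint from `I` extends to a maximal one. -/
theorem exists_maximal_filter {F I : Set L} (hF : IsLatFilter F) (hd : ∀ c ∈ F, c ∉ I) :
    ∃ F', F ⊆ F' ∧ IsLatFilter F' ∧ (∀ c ∈ F', c ∉ I) ∧
      ∀ G, IsLatFilter G → F' ⊆ G → (∀ c ∈ G, c ∉ I) → G ⊆ F' := by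
  obtain ⟨M, hFM, hM⟩ := zorn_subset_nonempty {G : Set L | IsLatFilter G ∧ ∀ c ∈ G, c ∉ I} (by
    intro C hC hchain hne
    refine ⟨⋃₀ C, ⟨⟨?_, ?_, ?_⟩, ?_⟩, fun s hs => Set.subset_sUnion_of_mem hs⟩
    · obtain ⟨s, hs⟩ := hne
      obtain ⟨a, ha⟩ := (hC hs).1.nonempty
      exact ⟨a, s, hs, ha⟩
    · exact isUpperSet_sUnion fun s hs => (hC hs).1.upper
    · rintro a ⟨s, hs, ha⟩ b ⟨t, ht, hb⟩
      rcases hchain.total hs ht with h | h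
      · exact ⟨t, ht, (hC ht).1.inf_mem _ (h ha) _ hb⟩
      · exact ⟨s, hs, (hC hs).1.inf_mem _ ha _ (h hb)⟩
    · rintro c ⟨s, hs, hc⟩
      exact (hC hs).2 c hc) F ⟨hF, hd⟩
  exact ⟨M, hFM, hM.prop.1, hM.prop.2, fun G hG hMG hGI => hM.le_of_ge ⟨hG, hGI⟩ hMG⟩

end FilterIdeal

/-! ### Representations of a lattice by a polarity -/

section PolRep

/-- A representation of the lattice `L` by a polarity `(X, R, Y)`: each `x : X` determines the filter
`{c | x ∈ u c}`, each `y : Y` the ideal `{c | y ∈ v c}`, `x R y` means that these are disjoint, and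
every disjoint pair of a filter and an ideal is contained in the pair determined by some `x R y`. -/
structure PolRep {L X Y : Type*} [Lattice L] [BoundedOrder L] (R : X → Y → Prop) (u : L → Set X)
    (v : L → Set Y) : Prop where
  filt : ∀ x, IsLatFilter {c | x ∈ u c}
  idl : ∀ y, IsLatIdeal {c | y ∈ v c}
  rel : ∀ x y, R x y ↔ ∀ c, x ∈ u c → y ∉ v c
  rich : ∀ F I : Set L, IsLatFilter F → IsLatIdeal I → (∀ c ∈ F, c ∉ I) →
    ∃ x y, R x y ∧ (∀ c ∈ F, x ∈ u c) ∧ ∀ c ∈ I, y ∈ v c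

namespace PolRep

variable {L X Y : Type*} [Lattice L] [BoundedOrder L] {R : X → Y → Prop} {u : L → Set X}
  {v : L → Set Y}

/-- The notion is self-dual, so statements such as `leY_iff` and `exists_max_right` need no separate
proof. -/
theorem swap (h : PolRep R u v) : PolRep (L := Lᵒᵈ) (fun y x => R x y)
    (fun c => v (OrderDual.ofDual c)) (fun c => u (OrderDual.ofDual c)) where
  filt y := (h.idl y).dual
  idl x := (h.filt x).dual
  rel y x := (h.rel x y).trans ⟨fun H c hy hx => H _ hx hy, fun H c hx hy => H c hy hx⟩
  rich F I hF hI hd := by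
    obtain ⟨x, y, h1, h2, h3⟩ := h.rich (OrderDual.toDual ⁻¹' I) (OrderDual.toDual ⁻¹' F)
      ⟨hI.nonempty, fun _ _ hab ha => hI.lower hab ha, hI.sup_mem⟩
      ⟨hF.nonempty, fun _ _ hab ha => hF.upper hab ha, hF.inf_mem⟩ (fun c hc hcF => hd c hcF hc)
    exact ⟨y, x, h1, h3, h2⟩

variable (h : PolRep R u v)
include h

/-- `rich` may replace `x` by a point with a larger filter, but a `y` disjoint from the larger
filter is also disjoint from that of `x`. Hence the given `x` can be kept. -/
theorem exists_right {x : X} {I : Set L} (hI : IsLatIdeal I) (hd : ∀ c ∈ I, x ∉ u c) :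
    ∃ y, R x y ∧ ∀ c ∈ I, y ∈ v c := by
  obtain ⟨x', y, h1, h2, h3⟩ := h.rich _ I (h.filt x) hI fun c hc hcI => hd c hcI hc
  exact ⟨y, (h.rel x y).2 fun c hc => (h.rel x' y).1 h1 c (h2 c hc), h3⟩

theorem exists_left {y : Y} {F : Set L} (hF : IsLatFilter F) (hd : ∀ c ∈ F, y ∉ v c) :
    ∃ x, R x y ∧ ∀ c ∈ F, x ∈ u c := by
  obtain ⟨x, y', h1, h2, h3⟩ := h.rich F _ hF (h.idl y) hd
  exact ⟨x, (h.rel x y).2 fun c hc hcy => (h.rel x y').1 h1 c hc (h3 c hcy), h2⟩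

theorem u_mono {c d : L} (hcd : c ≤ d) : u c ⊆ u d := fun x hx => (h.filt x).upper hcd hx

theorem v_anti {c d : L} (hcd : c ≤ d) : v d ⊆ v c := fun y hy => (h.idl y).lower hcd hy

/-- If `c` is not in the ideal of `y`, the principal filter of `c` misses that ideal, and
`exists_left` supplies a predecessor of `y` containing `c`. Together with `box_v` this makes `u c`
and `v c` polars of each other. -/
theorem bdia_u (c : L) : bdia R (u c) = (v c)ᶜ := by
  ext y
  constructor
  · rintro ⟨x, hx, hc⟩
    exact (h.rel x y).1 hx c hc
  · intro hy
    obtain ⟨x, h1, h2⟩ := h.exists_left (y := y) (isLatFilter_Ici c)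
      fun d hd hyd => hy (h.v_anti hd hyd)
    exact ⟨x, h1, h2 c le_rfl⟩

theorem box_v (c : L) : box R (v c)ᶜ = u c := by
  ext x
  constructor
  · intro hx
    by_contra hn
    obtain ⟨y, h1, h2⟩ := h.exists_right (x := x) (isLatIdeal_Iic c)
      fun d hd hxd => hn (h.u_mono hd hxd)
    exact hx y h1 (h2 c le_rfl)
  · exact fun hx y hy => (h.rel x y).1 hy c hx

theorem box_bdia (c : L) : box R (bdia R (u c)) = u c := by rw [h.bdia_u, h.box_v]

/-- When `c ≰ d`, the principal filter of `c` and the principal ideal of `d` are disjoint, and a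
related pair containing them separates `u c` from `u d`. -/
theorem u_subset_iff {c d : L} : u c ⊆ u d ↔ c ≤ d := by
  refine ⟨fun hcd => ?_, h.u_mono⟩
  by_contra hn
  obtain ⟨x, y, h1, h2, h3⟩ := h.rich _ _ (isLatFilter_Ici c) (isLatIdeal_Iic d)
    fun e h1 h2 => hn (le_trans h1 h2)
  exact (h.rel x y).1 h1 d (hcd (h2 c le_rfl)) (h3 d le_rfl)

theorem u_injective : Function.Injective u := fun _ _ hcd =>
  le_antisymm (h.u_subset_iff.1 hcd.subset) (h.u_subset_iff.1 hcd.superset)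

theorem u_inf (c d : L) : u (c ⊓ d) = u c ∩ u d :=
  Set.Subset.antisymm (Set.subset_inter (h.u_mono inf_le_left) (h.u_mono inf_le_right))
    fun x hx => (h.filt x).inf_mem _ hx.1 _ hx.2

theorem v_sup (c d : L) : v (c ⊔ d) = v c ∩ v d :=
  Set.Subset.antisymm (Set.subset_inter (h.v_anti le_sup_left) (h.v_anti le_sup_right))
    fun y hy => (h.idl y).sup_mem _ hy.1 _ hy.2

theorem u_top : u ⊤ = Set.univ := Set.eq_univ_of_forall fun x => (h.filt x).top_mem

theorem v_bot : v ⊥ = Set.univ := Set.eq_univ_of_forall fun y => (h.idl y).bot_mem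

/-- Since `u c` is `□` of a subset of `Y`, the relation alone decides inclusion of filters; no order
on the points has to be part of a representation. -/
theorem leX_iff {x x' : X} : leX R x x' ↔ ∀ c, x ∈ u c → x' ∈ u c := by
  constructor
  · intro hx c hc
    rw [← h.box_v] at hc ⊢
    exact fun y hy => hc y (hx y hy)
  · intro hx y hy
    exact (h.rel x y).2 fun c hc => (h.rel x' y).1 hy c (hx c hc)

theorem leY_iff {y y' : Y} : leY R y y' ↔ ∀ c, y ∈ v c → y' ∈ v c := h.swap.leX_iff

/-- Every filter disjoint from the ideal of `y` is contained in a filter of the form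
`{c | x ∈ u c}` that is maximal among the filters disjoint from the ideal of `y`. -/
theorem exists_max_left {y : Y} {F : Set L} (hF : IsLatFilter F) (hd : ∀ c ∈ F, y ∉ v c) :
    ∃ x, R x y ∧ (∀ c ∈ F, x ∈ u c) ∧ ∀ x', leX R x x' → R x' y → leX R x' x := by
  obtain ⟨F', h1, h2, h3, h4⟩ := exists_maximal_filter (I := {c | y ∈ v c}) hF hd
  obtain ⟨x, hx, hx'⟩ := h.exists_left (y := y) h2 h3
  refine ⟨x, hx, fun c hc => hx' c (h1 hc), fun x' hxx' hy => h.leX_iff.2 fun c hc => ?_⟩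
  exact hx' c (h4 _ (h.filt x') (fun d hd => h.leX_iff.1 hxx' d (hx' d hd))
    (fun d hd => (h.rel x' y).1 hy d hd) hc)

theorem exists_max_right {x : X} {I : Set L} (hI : IsLatIdeal I) (hd : ∀ c ∈ I, x ∉ u c) :
    ∃ y, R x y ∧ (∀ c ∈ I, y ∈ v c) ∧ ∀ y', leY R y y' → R x y' → leY R y' y :=
  h.swap.exists_max_left hI.dual hd

/-- Every disjoint pair of a filter and an ideal is contained in the pair of some `x R y` such that
`x` and `y` are maximal for each other. -/
theorem exists_max_pair {F I : Set L} (hF : IsLatFilter F) (hI : IsLatIdeal I)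
    (hd : ∀ c ∈ F, c ∉ I) :
    ∃ x y, R x y ∧ (∀ c ∈ F, x ∈ u c) ∧ (∀ c ∈ I, y ∈ v c) ∧
      (∀ x', leX R x x' → R x' y → leX R x' x) ∧ ∀ y', leY R y y' → R x y' → leY R y' y := by
  obtain ⟨x₀, y₀, h1, h2, h3⟩ := h.rich F I hF hI hd
  obtain ⟨x, hx, hxF, hxm⟩ := h.exists_max_left (y := y₀) hF fun c hc hcy =>
    (h.rel x₀ y₀).1 h1 c (h2 c hc) hcy
  obtain ⟨y, hy, hyI, hym⟩ := h.exists_max_right (x := x) (h.idl y₀) fun c hc hcx =>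
    (h.rel x y₀).1 hx c hcx hc
  -- `x` was maximal against the ideal of `y₀`. It stays maximal against the larger ideal of `y`,
  -- because whatever is related to `y` is related to `y₀`.
  exact ⟨x, y, hy, hxF, fun c hc => hyI c (h3 c hc),
    fun x' hxx' hx'y => hxm x' hxx' (h.leY_iff.2 hyI x' hx'y), hym⟩

end PolRep

/-- A family of Galois-closed sets that separates unrelated points and has enough points represents
the lattice that it forms. -/
theorem IsPolFamily.polRep {X Y : Type*} {R : X → Y → Prop} {Lf : Set (Set X)}
    (h : IsPolFamily R Lf) (sep : ∀ x y, ¬ R x y → ∃ U ∈ Lf, x ∈ U ∧ y ∉ bdia R U)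
    (rich : ∀ F I : Set (Set X), F.Nonempty → I.Nonempty → F ⊆ Lf → I ⊆ Lf →
      (∀ U ∈ F, ∀ V ∈ F, U ∩ V ∈ F) → (∀ U ∈ I, ∀ V ∈ I, ∃ W ∈ I, U ⊆ W ∧ V ⊆ W) →
      (∀ U ∈ F, ∀ V ∈ I, ∃ x y, R x y ∧ x ∈ U ∧ y ∉ bdia R V) →
      ∃ x y, R x y ∧ (∀ U ∈ F, x ∈ U) ∧ ∀ V ∈ I, y ∉ bdia R V) :
    letI := polLattice h
    letI := polBounded h
    PolRep R (fun U : {U : Set X // U ∈ Lf} => U.1) (fun U => (bdia R U.1)ᶜ) := by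
  let := polLattice h
  let := polBounded h
  refine ⟨fun x => ⟨⟨⊤, trivial⟩, fun U V hUV hx => hUV hx, fun U hU V hV => ⟨hU, hV⟩⟩,
    fun y => ⟨⟨⊥, ?_⟩, fun U V hUV hy hyV => hy (bdia_mono R hUV hyV), fun U hU V hV => ?_⟩,
    fun x y => ⟨fun hxy U hxU hyU => hyU ⟨x, hxy, hxU⟩, fun H => ?_⟩, fun F I hF hI hd => ?_⟩
  · change y ∉ bdia R (box R (bdia R ∅))
    rw [bdia_box_bdia, bdia_empty]
    exact fun h => h
  · change y ∉ bdia R (box R (bdia R (U.1 ∪ V.1)))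
    rw [bdia_box_bdia, bdia_union]
    exact fun h => h.elim hU hV
  · by_contra hn
    obtain ⟨U, hU, h1, h2⟩ := sep x y hn
    exact H ⟨U, hU⟩ h1 h2
  · obtain ⟨x, y, h1, h2, h3⟩ := rich (Subtype.val '' F) (Subtype.val '' I) (hF.nonempty.image _)
      (hI.nonempty.image _) (by rintro _ ⟨U, -, rfl⟩; exact U.2)
      (by rintro _ ⟨U, -, rfl⟩; exact U.2)
      (by
        rintro _ ⟨U, hU, rfl⟩ _ ⟨V, hV, rfl⟩
        exact ⟨_, hF.inf_mem _ hU _ hV, rfl⟩)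
      (by
        rintro _ ⟨U, hU, rfl⟩ _ ⟨V, hV, rfl⟩
        exact ⟨_, ⟨_, hI.sup_mem _ hU _ hV, rfl⟩, le_sup_left (a := U) (b := V),
          le_sup_right (a := U) (b := V)⟩)
      (by
        rintro _ ⟨U, hU, rfl⟩ _ ⟨V, hV, rfl⟩
        -- Disjointness of `F` and `I` gives a point of `U` outside `V`; as `V` is stable, that
        -- point has a successor outside `◆V`.
        have hn : ¬ U.1 ⊆ V.1 := fun hUV => hd U hU (hI.lower (a := V) (b := U) hUV hV)
        obtain ⟨x, hx, hxV⟩ := Set.not_subset.1 hn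
        rw [← h.fix _ V.2] at hxV
        simp only [box, Set.mem_ofPred_eq, not_forall] at hxV
        obtain ⟨y, hy, hyV⟩ := hxV
        exact ⟨x, y, hy, hx, hyV⟩)
    exact ⟨x, y, h1, fun U hU => h2 _ ⟨U, hU, rfl⟩, fun U hU => h3 _ ⟨U, hU, rfl⟩⟩

/-! ### The relations induced by a lattice homomorphism -/

/-- The relation `x S x'` iff `x ∈ u (h c)` implies `x' ∈ u' c` for all `c`. -/
def canRel {L L' X X' : Type*} (u : L → Set X) (u' : L' → Set X') (h : L' → L) : X → X' → Prop :=
  fun x x' => ∀ c, x ∈ u (h c) → x' ∈ u' c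

/-- The composition `⋆` consults only the iterated boxes of the sets `u'' c`, so it depends only on
the composite of the lattice maps. With `costar_canRel` this is the source of all the composition
laws for functors into relational categories. -/
theorem star_canRel {L L' L'' X X' X'' : Type*} {u : L → Set X} {u' : L' → Set X'}
    {u'' : L'' → Set X''} {S : X → X' → Prop} {S' : X' → X'' → Prop} {h : L' → L} {k : L'' → L'}
    (hS : ∀ c, box S (u' c) = u (h c)) (hS' : ∀ c, box S' (u'' c) = u' (k c)) :
    star S S' (Set.range u'') = canRel u u'' (h ∘ k) := by
  funext x z
  refine propext ⟨fun H c hx => H _ ⟨c, rfl⟩ ?_, ?_⟩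
  · rw [hS', hS]
    exact hx
  · rintro H _ ⟨c, rfl⟩ hx
    rw [hS', hS] at hx
    exact H c hx

theorem costar_canRel {L L' L'' X'' Y Y' Y'' : Type*} {v : L → Set Y} {v' : L' → Set Y'}
    {u'' : L'' → Set X''} {v'' : L'' → Set Y''} {R'' : X'' → Y'' → Prop} {T : Y → Y' → Prop}
    {T' : Y' → Y'' → Prop} {h : L' → L} {k : L'' → L'} (hv : ∀ c, bdia R'' (u'' c) = (v'' c)ᶜ)
    (hT : ∀ c, dia T (v' c)ᶜ = (v (h c))ᶜ) (hT' : ∀ c, dia T' (v'' c)ᶜ = (v' (k c))ᶜ) :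
    costar T T' R'' (Set.range u'') = canRel v v'' (h ∘ k) := by
  funext x z
  refine propext ⟨fun H c hx => ?_, ?_⟩
  · by_contra hn
    have := H _ ⟨c, rfl⟩ (by rw [hv]; exact hn)
    rw [hv, hT', hT] at this
    exact this hx
  · rintro H _ ⟨c, rfl⟩ hx
    rw [hv] at hx
    rw [hv, hT', hT]
    exact fun hn => hx (H c hn)

section Can

variable {L X Y L' X' Y' : Type*} [Lattice L] [BoundedOrder L] [Lattice L'] [BoundedOrder L']
  {R : X → Y → Prop} {u : L → Set X} {v : L → Set Y}
  {R' : X' → Y' → Prop} {u' : L' → Set X'} {v' : L' → Set Y'}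

theorem IsLatFilter.comap {F : Set L} (hF : IsLatFilter F) (φ : BoundedLatticeHom L' L) :
    IsLatFilter (φ ⁻¹' F) :=
  ⟨⟨⊤, by simpa using hF.top_mem⟩, hF.upper.preimage (OrderHomClass.mono φ), fun a ha b hb => by
    rw [Set.mem_preimage, map_inf]
    exact hF.inf_mem _ ha _ hb⟩

theorem IsLatIdeal.comap {I : Set L} (hI : IsLatIdeal I) (φ : BoundedLatticeHom L' L) :
    IsLatIdeal (φ ⁻¹' I) :=
  ⟨⟨⊥, by simpa using hI.bot_mem⟩, hI.lower.preimage (OrderHomClass.mono φ), fun a ha b hb => by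
    rw [Set.mem_preimage, map_sup]
    exact hI.sup_mem _ ha _ hb⟩

/-- If `φ c` is not in the filter of `x`, the pullback of that filter along `φ` misses the principal
ideal of `c`; `rich` in the target then gives a successor of `x` outside `u' c`. -/
theorem PolRep.box_canRel (h : PolRep R u v) (h' : PolRep R' u' v') (φ : BoundedLatticeHom L' L)
    (c : L') : box (canRel u u' φ) (u' c) = u (φ c) := by
  ext x
  constructor
  · intro hx
    by_contra hn
    obtain ⟨x', y', h1, h2, h3⟩ := h'.rich _ _ ((h.filt x).comap φ) (isLatIdeal_Iic c)
      fun d hd hdc => hn (h.u_mono (OrderHomClass.mono φ hdc) hd)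
    exact (h'.rel x' y').1 h1 c (hx x' h2) (h3 c le_rfl)
  · exact fun hx x' hxx' => hxx' c hx

theorem PolRep.dia_canRel (h : PolRep R u v) (h' : PolRep R' u' v') (φ : BoundedLatticeHom L' L)
    (c : L') : dia (canRel v v' φ) (v' c)ᶜ = (v (φ c))ᶜ := by
  have : box (canRel v v' φ) (v' c) = v (φ c) := by
    ext y
    constructor
    · intro hy
      by_contra hn
      obtain ⟨x', y', h1, h2, h3⟩ := h'.rich _ _ (isLatFilter_Ici c) ((h.idl y).comap φ)
        fun d hd hdc => hn (h.v_anti (OrderHomClass.mono φ hd) hdc)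
      exact (h'.rel x' y').1 h1 c (h2 c le_rfl) (hy y' h3)
    · exact fun hx x' hxx' => hxx' c hx
  rw [← this]
  ext y
  simp [dia, box]

/-- The relations induced by a lattice homomorphism satisfy the morphism conditions. -/
theorem PolRep.isBoxHom_canRel (h : PolRep R u v) (h' : PolRep R' u' v')
    (φ : BoundedLatticeHom L' L) :
    IsBoxHom R (Set.range u) R' (Set.range u') (canRel u u' φ) (canRel v v' φ) where
  box_mem := by
    rintro _ ⟨c, rfl⟩
    exact ⟨φ c, (h.box_canRel h' φ c).symm⟩
  bdia_box := by
    rintro _ ⟨c, rfl⟩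
    rw [h.box_canRel h', h.bdia_u, h'.bdia_u, h.dia_canRel h']
  sep_left x x' hn := by
    simp only [canRel, not_forall] at hn
    obtain ⟨c, h1, h2⟩ := hn
    exact ⟨_, ⟨c, rfl⟩, by rwa [h.box_canRel h'], h2⟩
  sep_right y y' hn := by
    simp only [canRel, not_forall] at hn
    obtain ⟨c, h1, h2⟩ := hn
    refine ⟨_, ⟨c, rfl⟩, ?_, ?_⟩
    · rw [h'.bdia_u, h.dia_canRel h']
      exact fun hn => hn h1
    · rw [h'.bdia_u]
      exact h2

/-- The pullbacks along `φ` of a disjoint filter and ideal are again disjoint, and `rich` in the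
target realizes them by a related pair. -/
theorem PolRep.canRel_compat (h : PolRep R u v) (h' : PolRep R' u' v')
    (φ : BoundedLatticeHom L' L) (x : X) (y : Y) (hxy : R x y) :
    ∃ x' y', canRel u u' φ x x' ∧ canRel v v' φ y y' ∧ R' x' y' := by
  obtain ⟨x', y', h1, h2, h3⟩ := h'.rich _ _ ((h.filt x).comap φ) ((h.idl y).comap φ)
    fun c hc hc' => (h.rel x y).1 hxy _ hc hc'
  exact ⟨x', y', h2, h3, h1⟩

/-- The relations of a morphism are determined by its action on the lattices. -/
theorem IsBoxHom.eq_canRel {S : X → X' → Prop} {T : Y → Y' → Prop} {φ : L' → L}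
    (hS : IsBoxHom R (Set.range u) R' (Set.range u') S T) (h : PolRep R u v)
    (h' : PolRep R' u' v') (hφ : ∀ c, box S (u' c) = u (φ c)) :
    S = canRel u u' φ ∧ T = canRel v v' φ := by
  constructor
  · funext x x'
    refine propext ⟨fun hx c hc => ?_, fun H => ?_⟩
    · rw [← hφ] at hc
      exact hc x' hx
    · by_contra hn
      obtain ⟨_, ⟨c, rfl⟩, h1, h2⟩ := hS.sep_left x x' hn
      exact h2 (H c (by rwa [← hφ]))
  -- The condition `bdia_box` forces the action of `T` on the sets `v' c` once that of `S` on the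
  -- sets `u' c` is known.
  · have key : ∀ c, dia T (v' c)ᶜ = (v (φ c))ᶜ := fun c => by
      rw [← h'.bdia_u, ← hS.bdia_box _ ⟨c, rfl⟩, hφ, h.bdia_u]
    funext y y'
    refine propext ⟨fun hy c hc => ?_, fun H => ?_⟩
    · by_contra hn
      have : y ∈ dia T (v' c)ᶜ := ⟨y', hy, hn⟩
      rw [key] at this
      exact this hc
    · by_contra hn
      obtain ⟨_, ⟨c, rfl⟩, h1, h2⟩ := hS.sep_right y y' hn
      rw [h'.bdia_u, key] at h1
      rw [h'.bdia_u] at h2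
      exact h2 (H c (not_not.1 h1))

end Can

end PolRep


/-! ### Topologies with subbasic closed sets `u c` and `v c`, and Hartung spaces obtained from them.
-/

section Generated

variable {L X Y : Type*} [Lattice L] [BoundedOrder L] {R : X → Y → Prop} {u : L → Set X}
  {v : L → Set Y}

/-- A space whose topology is generated by the complements of the sets `p c` and `q c` is compact
if each disjoint pair of a filter and an ideal is realized by a point. -/
theorem compactSpace_of_rich {W : Type*} [tW : TopologicalSpace W] {p q : L → Set W}
    (ht : tW = TopologicalSpace.generateFrom (Set.range (fun c => (p c)ᶜ) ∪
      Set.range fun c => (q c)ᶜ))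
    (hp : ∀ w, IsLatFilter {c | w ∈ p c}) (hq : ∀ w, IsLatIdeal {c | w ∈ q c})
    (hpq : ∀ w c, w ∈ p c → w ∉ q c)
    (rich : ∀ F I : Set L, IsLatFilter F → IsLatIdeal I → (∀ c ∈ F, c ∉ I) →
      ∃ w, (∀ c ∈ F, w ∈ p c) ∧ ∀ c ∈ I, w ∈ q c) : CompactSpace W := by
  classical
  refine compactSpace_generateFrom ht fun P hP hcov => ?_
  -- By Alexander's lemma only covers by subbasic sets matter. If the filter and the ideal generated
  -- by the indices in the cover were disjoint, a point realizing them would be uncovered. A common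
  -- element `c` lies above a finite meet of filter indices and below a finite join of ideal
  -- indices, and those finitely many sets already cover.
  have hmeet : ∃ c ∈ filterGen {c | (p c)ᶜ ∈ P}, c ∈ idealGen {c | (q c)ᶜ ∈ P} := by
    by_contra hcon
    push Not at hcon
    obtain ⟨w, h1, h2⟩ := rich _ _ (isLatFilter_filterGen _) (isLatIdeal_idealGen _) hcon
    obtain ⟨V, hV, hw⟩ : w ∈ ⋃₀ P := hcov ▸ trivial
    rcases hP hV with ⟨c, rfl⟩ | ⟨c, rfl⟩
    · exact hw (h1 c (subset_filterGen _ hV))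
    · exact hw (h2 c (subset_idealGen _ hV))
  obtain ⟨c, ⟨s, hs, hsc⟩, t, ht, hct⟩ := hmeet
  refine ⟨((fun c => (p c)ᶜ) '' s) ∪ ((fun c => (q c)ᶜ) '' t), ?_, ?_,
    Set.eq_univ_of_forall fun w => ?_⟩
  · rintro _ (⟨d, hd, rfl⟩ | ⟨d, hd, rfl⟩)
    · exact hs hd
    · exact ht hd
  · exact (s.finite_toSet.image _).union (t.finite_toSet.image _)
  · by_contra hn
    rw [Set.sUnion_union, Set.sUnion_image, Set.sUnion_image] at hn
    simp only [Set.mem_union, Set.mem_iUnion, not_or, not_exists] at hn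
    refine hpq w c ((hp w).upper hsc ((hp w).finset_inf_mem _ _ fun d hd => ?_))
      ((hq w).lower hct ((hq w).finset_sup_mem _ _ fun d hd => ?_))
    · by_contra h
      exact hn.1 d hd h
    · by_contra h
      exact hn.2 d hd h

theorem isClosed_of_generated {X ι : Type*} [tX : TopologicalSpace X] {p : ι → Set X}
    (ht : tX = TopologicalSpace.generateFrom (Set.range fun c => (p c)ᶜ)) (c : ι) :
    IsClosed (p c) := by
  rw [← isOpen_compl_iff, ht]
  exact TopologicalSpace.GenerateOpen.basic _ ⟨c, rfl⟩

/-- In a topology generated by the complements of the sets `p c`, the closed sets are intersections of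
finite unions of sets `p c`. -/
theorem exists_finset_of_closed {X ι : Type*} [tX : TopologicalSpace X] {p : ι → Set X}
    (ht : tX = TopologicalSpace.generateFrom (Set.range fun c => (p c)ᶜ)) {A : Set X}
    (hA : IsClosed A) {x : X} (hx : x ∉ A) :
    ∃ t : Finset ι, A ⊆ ⋃ c ∈ t, p c ∧ x ∉ ⋃ c ∈ t, p c := by
  obtain ⟨_, ⟨f, ⟨hf, hfs⟩, rfl⟩, hxf, hfA⟩ :=
    (TopologicalSpace.isTopologicalBasis_of_subbasis ht).exists_subset_of_mem_open
      (show x ∈ Aᶜ from hx) hA.isOpen_compl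
  classical
  choose g hg using fun V : f => hfs V.2
  have := hf.fintype
  refine ⟨Finset.univ.image g, fun a ha => ?_, fun hx' => ?_⟩
  · by_contra hn
    refine hfA (fun V hV => ?_) ha
    change a ∈ (⟨V, hV⟩ : f).1
    rw [← hg ⟨V, hV⟩]
    exact fun hav => hn (Set.mem_biUnion (x := g ⟨V, hV⟩) (by simp) hav)
  · simp only [Finset.mem_image, Finset.mem_univ, true_and, Set.mem_iUnion] at hx'
    obtain ⟨_, ⟨V, rfl⟩, hxV⟩ := hx'
    have := hxf V V.2
    rw [← hg V] at this
    exact this hxV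

/-- Puts both the graph of `R` and the space of maximal pairs into the form required by
`compactSpace_of_rich`. -/
theorem induced_prod_generateFrom {W X Y ι : Type*} [tX : TopologicalSpace X]
    [tY : TopologicalSpace Y] {p : ι → Set X} {q : ι → Set Y}
    (hX : tX = TopologicalSpace.generateFrom (Set.range fun c => (p c)ᶜ))
    (hY : tY = TopologicalSpace.generateFrom (Set.range fun c => (q c)ᶜ)) (f : W → X × Y) :
    TopologicalSpace.induced f inferInstance = TopologicalSpace.generateFrom
      (Set.range (fun c => ((fun w => (f w).1) ⁻¹' p c)ᶜ) ∪
        Set.range fun c => ((fun w => (f w).2) ⁻¹' q c)ᶜ) := by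
  change TopologicalSpace.induced f
    (TopologicalSpace.induced Prod.fst tX ⊓ TopologicalSpace.induced Prod.snd tY) = _
  rw [induced_inf, induced_compose, induced_compose, hX, hY, induced_generateFrom_eq,
    induced_generateFrom_eq, generateFrom_union, ← Set.range_comp, ← Set.range_comp]
  rfl

namespace PolRep

/-- The `c` with `A ⊆ u c` form a filter and those with `-◆A ⊆ v c` an ideal. If they were disjoint,
a related pair `x R y` containing them would have `x ∈ A` by the first separation hypothesis and `y
∉ ◆A` by the second, which is absurd. A common element `c` squeezes `A` to `u c`. -/
theorem mem_range (h : PolRep R u v) {A : Set X} (hA : box R (bdia R A) = A)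
    (h1 : ∀ x ∉ A, ∃ c, A ⊆ u c ∧ x ∉ u c)
    (h2 : ∀ y ∈ bdia R A, ∃ c, (bdia R A)ᶜ ⊆ v c ∧ y ∉ v c) : A ∈ Set.range u := by
  have hmeet : ∃ c, A ⊆ u c ∧ (bdia R A)ᶜ ⊆ v c := by
    by_contra hcon
    push Not at hcon
    obtain ⟨x, y, hxy, hF, hI⟩ := h.rich {c | A ⊆ u c} {c | (bdia R A)ᶜ ⊆ v c}
      ⟨⟨⊤, by simp [h.u_top]⟩, fun a b hab ha => ha.trans (h.u_mono hab), fun a ha b hb => by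
        change A ⊆ u (a ⊓ b)
        rw [h.u_inf]
        exact Set.subset_inter ha hb⟩
      ⟨⟨⊥, by simp [h.v_bot]⟩, fun a b hab ha => ha.trans (h.v_anti hab), fun a ha b hb => by
        change _ ⊆ v (a ⊔ b)
        rw [h.v_sup]
        exact Set.subset_inter ha hb⟩ hcon
    have hxA : x ∈ A := by
      by_contra hn
      obtain ⟨c, hc, hxc⟩ := h1 x hn
      exact hxc (hF c hc)
    obtain ⟨c, hc, hyc⟩ := h2 y ⟨x, hxy, hxA⟩
    exact hyc (hI c hc)
  obtain ⟨c, hc, hc'⟩ := hmeet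
  refine ⟨c, Set.Subset.antisymm ?_ hc⟩
  rw [← h.box_v, ← hA]
  exact box_mono R (Set.compl_subset_comm.1 hc')

variable [tX : TopologicalSpace X] [tY : TopologicalSpace Y] (h : PolRep R u v)
  (hX : tX = TopologicalSpace.generateFrom (Set.range fun c => (u c)ᶜ))
  (hY : tY = TopologicalSpace.generateFrom (Set.range fun c => (v c)ᶜ))
include h hX hY

theorem isCompact_rel : IsCompact {p : X × Y | R p.1 p.2} := by
  rw [isCompact_iff_compactSpace]
  refine compactSpace_of_rich
    (induced_prod_generateFrom hX hY (Subtype.val : {p : X × Y | R p.1 p.2} → X × Y))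
    (fun w => h.filt w.1.1) (fun w => h.idl w.1.2) (fun w c => (h.rel w.1.1 w.1.2).1 w.2 c) ?_
  intro F I hF hI hd
  obtain ⟨x, y, h1, h2, h3⟩ := h.rich F I hF hI hd
  exact ⟨⟨(x, y), h1⟩, h2, h3⟩

/-- If `y ∉ ◆A` for a closed set `A`, then some `c` separates them. -/
theorem exists_sep_of_closed {A : Set X} (hA : IsClosed A) {y : Y} (hy : y ∉ bdia R A) :
    ∃ c, A ⊆ u c ∧ y ∈ v c := by
  classical
  -- The singleton of `y` need not be closed, so compactness is applied to the related pairs whose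
  -- second coordinate lies above `y`; their first coordinates are still related to `y`, hence lie
  -- outside `A`.
  have hK : IsCompact ({p : X × Y | R p.1 p.2} ∩ ⋂ c : {c // y ∈ v c}, {p | p.2 ∈ v c.1}) :=
    (h.isCompact_rel hX hY).inter_right (isClosed_iInter fun c =>
      (isClosed_of_generated hY c.1).preimage continuous_snd)
  have : Nonempty {t : Finset L // A ⊆ ⋃ c ∈ t, u c} := ⟨{⊤}, by simp [h.u_top]⟩
  obtain ⟨⟨t, ht⟩, hKt⟩ := hK.elim_directed_cover
    (fun t : {t : Finset L // A ⊆ ⋃ c ∈ t, u c} => {p : X × Y | p.1 ∉ ⋃ c ∈ t.1, u c})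
    (fun t => ((t.1.finite_toSet.isClosed_biUnion fun c _ =>
      isClosed_of_generated hX c).preimage continuous_fst).isOpen_compl) (by
    rintro ⟨x, y'⟩ ⟨hxy', hyy'⟩
    have hxy : R x y := h.leY_iff.2 (fun c hc => Set.mem_iInter.1 hyy' ⟨c, hc⟩) x hxy'
    obtain ⟨t, h1, h2⟩ := exists_finset_of_closed hX hA (x := x) fun hx => hy ⟨x, hxy, hx⟩
    exact Set.mem_iUnion.2 ⟨⟨t, h1⟩, h2⟩) (by
    rintro ⟨s, hs⟩ ⟨t, ht⟩
    -- Finite unions of sets `u c` are closed under intersection, since `u c ∩ u d = u (c ⊓ d)`;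
    -- hence the cover is directed.
    refine ⟨⟨Finset.image₂ (· ⊓ ·) s t, fun a ha => ?_⟩, fun p hp hn => hp ?_,
      fun p hp hn => hp ?_⟩
    · obtain ⟨c, hc, hac⟩ := Set.mem_iUnion₂.1 (hs ha)
      obtain ⟨d, hd, had⟩ := Set.mem_iUnion₂.1 (ht ha)
      exact Set.mem_iUnion₂.2 ⟨c ⊓ d, Finset.mem_image₂_of_mem hc hd, by
        rw [h.u_inf]
        exact ⟨hac, had⟩⟩
    all_goals
      obtain ⟨e, he, hpe⟩ := Set.mem_iUnion₂.1 hn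
      obtain ⟨c, hc, d, hd, rfl⟩ := Finset.mem_image₂.1 he
    · exact Set.mem_iUnion₂.2 ⟨c, hc, h.u_mono inf_le_left hpe⟩
    · exact Set.mem_iUnion₂.2 ⟨d, hd, h.u_mono inf_le_right hpe⟩)
  -- The join of `t` separates: it contains `A` by monotonicity of `u`, and each `d ∈ t` is in the
  -- ideal of `y`, as otherwise `y` would have a predecessor in `u d`.
  refine ⟨t.sup id, fun a ha => ?_, (h.idl y).finset_sup_mem _ _ fun d hd => ?_⟩
  · obtain ⟨c, hc, hac⟩ := Set.mem_iUnion₂.1 (ht ha)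
    exact h.u_mono (Finset.le_sup (f := id) hc) hac
  · by_contra hn
    have : y ∈ bdia R (u d) := by
      rw [h.bdia_u]
      exact hn
    obtain ⟨x, hxy, hxd⟩ := this
    exact hKt (a := (x, y)) ⟨hxy, Set.mem_iInter.2 fun c => c.2⟩ (Set.mem_iUnion₂.2 ⟨d, hd, hxd⟩)

theorem exists_of_notMem_closure {A : Set X} (hA : IsClosed A) {x : X}
    (hx : x ∉ box R (bdia R A)) : ∃ c, A ⊆ u c ∧ x ∉ u c := by
  simp only [box, Set.mem_ofPred_eq, not_forall] at hx
  obtain ⟨y, hxy, hy⟩ := hx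
  obtain ⟨c, hc, hyc⟩ := h.exists_sep_of_closed hX hY hA hy
  exact ⟨c, hc, fun hxc => (h.rel x y).1 hxy c hxc hyc⟩

theorem isClosed_box_bdia {A : Set X} (hA : IsClosed A) : IsClosed (box R (bdia R A)) := by
  have : box R (bdia R A) = ⋂ c : {c // A ⊆ u c}, u c.1 := by
    refine Set.Subset.antisymm (Set.subset_iInter fun c => ?_) fun x hx => ?_
    · have := box_mono R (bdia_mono R c.2)
      rwa [h.box_bdia] at this
    · by_contra hn
      obtain ⟨c, hc, hxc⟩ := h.exists_of_notMem_closure hX hY hA hn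
      exact hxc (Set.mem_iInter.1 hx ⟨c, hc⟩)
  rw [this]
  exact isClosed_iInter fun c => isClosed_of_generated hX c.1

/-- The closed sets `A = □◆A` with `-◆A` closed are exactly the sets `u c`. -/
theorem closedSets_eq : closedSets R = Set.range u := by
  ext A
  constructor
  · rintro ⟨hA, hA1, hA2⟩
    refine h.mem_range hA (fun x hx => h.exists_of_notMem_closure hX hY hA1 (by rwa [hA]))
      fun y hy => ?_
    -- The dual separation is applied to the closed set `-◆A`. It is stable on its own side: a point
    -- of `◆A` has a predecessor in `A`, all of whose successors lie in `◆A`.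
    refine h.swap.exists_of_notMem_closure hY hX hA2 fun hn => ?_
    obtain ⟨x, hxy, hxA⟩ := hy
    obtain ⟨y', hxy', hy'⟩ := hn x hxy
    exact hy' ⟨x, hxy', hxA⟩
  · rintro ⟨c, rfl⟩
    refine ⟨h.box_bdia c, isClosed_of_generated hX c, ?_⟩
    rw [h.bdia_u, compl_compl]
    exact isClosed_of_generated hY c

/-- A representation with the generated topologies is a Hartung space. -/
theorem isHg (hl : ∀ x x', leX R x x' → leX R x' x → x = x')
    (hr : ∀ y y', leY R y y' → leY R y' y → y = y') : IsHg R where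
  antisymm_left := hl
  antisymm_right := hr
  compact := h.isCompact_rel hX hY
  subbasis_left := by
    rw [h.closedSets_eq hX hY, hX]
    congr 1
    ext W
    simp [eq_comm]
  subbasis_right := by
    rw [h.closedSets_eq hX hY, hY]
    congr 1
    ext W
    simp [h.bdia_u, eq_comm]
  closed_left _ hA := h.isClosed_box_bdia hX hY hA
  closed_right _ hB := h.swap.isClosed_box_bdia hY hX hB
  maximal x y hxy := by
    obtain ⟨x', h1, h2, h3⟩ := h.exists_max_left (y := y) (h.filt x) ((h.rel x y).1 hxy)
    obtain ⟨y', h4, h5, h6⟩ := h.exists_max_right (x := x) (h.idl y)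
      fun c hc hxc => (h.rel x y).1 hxy c hxc hc
    exact ⟨x', y', h.leX_iff.2 h2, ⟨h1, fun x'' hle hR => hl _ _ (h3 x'' hle hR) hle⟩,
      h.leY_iff.2 h5, ⟨h4, fun y'' hle hR => hr _ _ (h6 y'' hle hR) hle⟩⟩
  sep x y hxy := by
    rw [h.rel] at hxy
    push Not at hxy
    obtain ⟨c, h1, h2⟩ := hxy
    refine ⟨u c, ?_, h1, ?_⟩
    · rw [h.closedSets_eq hX hY]
      exact ⟨c, rfl⟩
    · rw [h.bdia_u]
      exact fun hn => hn h2

end PolRep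

end Generated

/-! ### Doubly ordered spaces as polarities -/

section DoublyOrdered

variable {Z Z' : Type*}

/-- The relation `x R y` iff `x ≤₁ z` and `y ≤₂ z` for some `z`. -/
def commonUpper (le₁ le₂ : Z → Z → Prop) : Z → Z → Prop := fun x y => ∃ z, le₁ x z ∧ le₂ y z

theorem dia_compl (Q : Z → Z' → Prop) (A : Set Z') : dia Q Aᶜ = (box Q A)ᶜ := by
  ext z
  simp [dia, box]

/-- A common upper bound of a point of `C` and `y` stays in the upset `C`, so it can replace the
point. With `box_commonUpper` this translates `φ` and `ψ` into the operators of a polarity. -/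
theorem bdia_commonUpper {le₁ le₂ : Z → Z → Prop} (h₁ : ∀ x, le₁ x x) {C : Set Z}
    (hC : IsUp le₁ C) : bdia (commonUpper le₁ le₂) C = (negDown le₂ C)ᶜ := by
  ext y
  constructor
  · rintro ⟨x, ⟨z, h1, h2⟩, hx⟩ hy
    exact hy z (hC x z h1 hx) h2
  · intro hy
    simp only [negDown, Set.mem_compl_iff, Set.mem_ofPred_eq, not_forall, not_not] at hy
    obtain ⟨z, hz, hyz⟩ := hy
    exact ⟨z, ⟨z, h₁ z, hyz⟩, hz⟩

theorem box_commonUpper {le₁ le₂ : Z → Z → Prop} (h₂ : ∀ x, le₂ x x) {B : Set Z}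
    (hB : IsUp le₂ B) : box (commonUpper le₁ le₂) Bᶜ = negDown le₁ B := by
  ext x
  constructor
  · exact fun hx b hb hxb => hx b ⟨b, hxb, h₂ b⟩ hb
  · rintro hx y ⟨z, h1, h2⟩ hy
    exact hx z (hB y z h2 hy) h1

/-- A stable set of the polarity is automatically a `≤₁`-upset by transitivity; after that the two
descriptions agree through `φ` and `ψ`. -/
theorem closedSets_commonUpper [TopologicalSpace Z] {le₁ le₂ : Z → Z → Prop}
    (r₁ : ∀ x, le₁ x x) (t₁ : ∀ x y z, le₁ x y → le₁ y z → le₁ x z)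
    (r₂ : ∀ x, le₂ x x) (t₂ : ∀ x y z, le₂ x y → le₂ y z → le₂ x z) :
    closedSets (commonUpper le₁ le₂) = urqSets le₁ le₂ := by
  have key : ∀ C, IsUp le₁ C →
      box (commonUpper le₁ le₂) (bdia (commonUpper le₁ le₂) C) = negDown le₁ (negDown le₂ C) :=
    fun C hC => by rw [bdia_commonUpper r₁ hC, box_commonUpper r₂ (isUp_negDown t₂ C)]
  ext C
  constructor
  · rintro ⟨h1, h2, h3⟩
    have hup : IsUp le₁ C := by
      intro x y hxy hx
      rw [← h1] at hx ⊢
      rintro w ⟨z, h4, h5⟩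
      exact hx w ⟨z, t₁ x y z hxy h4, h5⟩
    rw [bdia_commonUpper r₁ hup, compl_compl] at h3
    exact ⟨hup, by rwa [← key C hup], h2, h3⟩
  · rintro ⟨h1, h2, h3, h4⟩
    refine ⟨by rwa [key C h1], h3, ?_⟩
    rwa [bdia_commonUpper r₁ h1, compl_compl]

theorem IsUrq.closedSets_eq [TopologicalSpace Z] {le₁ le₂ : Z → Z → Prop} (h : IsUrq le₁ le₂) :
    closedSets (commonUpper le₁ le₂) = urqSets le₁ le₂ :=
  closedSets_commonUpper h.refl₁ h.trans₁ h.refl₂ h.trans₂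

theorem IsUrq.bdia_eq [TopologicalSpace Z] {le₁ le₂ : Z → Z → Prop} (h : IsUrq le₁ le₂)
    {C : Set Z} (hC : C ∈ urqSets le₁ le₂) :
    bdia (commonUpper le₁ le₂) C = (negDown le₂ C)ᶜ :=
  bdia_commonUpper h.refl₁ hC.1

/-- A morphism of Urquhart spaces is the same as a morphism of the associated Ploščica spaces. -/
theorem isUrqHom_iff [TopologicalSpace Z] [TopologicalSpace Z'] {le₁ le₂ : Z → Z → Prop}
    {le₁' le₂' : Z' → Z' → Prop} (h : IsUrq le₁ le₂) (h' : IsUrq le₁' le₂') {P Q : Z → Z' → Prop} :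
    IsUrqHom le₁ le₂ le₁' le₂' P Q ↔
      IsPloHom (commonUpper le₁ le₂) (commonUpper le₁' le₂') P Q := by
  constructor
  · intro H
    refine ⟨⟨?_, ?_, ?_, ?_⟩, H.serial⟩
    · rw [h.closedSets_eq, h'.closedSets_eq]
      exact H.box_mem
    · rw [h'.closedSets_eq]
      intro C hC
      rw [h.bdia_eq (H.box_mem C hC), h'.bdia_eq hC, dia_compl, H.neg_box C hC]
    · rw [h'.closedSets_eq]
      exact H.sep_left
    · rw [h'.closedSets_eq]
      intro y y' hn
      obtain ⟨C, hC, h1, h2⟩ := H.sep_right y y' hn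
      refine ⟨C, hC, ?_, ?_⟩
      · rw [h'.bdia_eq hC, dia_compl]
        exact fun hn => hn h1
      · rw [h'.bdia_eq hC]
        exact h2
  · rintro ⟨⟨h1, h2, h3, h4⟩, h5⟩
    rw [h.closedSets_eq, h'.closedSets_eq] at h1
    rw [h'.closedSets_eq] at h2 h3 h4
    refine ⟨h1, fun C hC => ?_, h3, fun y y' hn => ?_, h5⟩
    · have := h2 C hC
      rw [h.bdia_eq (h1 C hC), h'.bdia_eq hC, dia_compl] at this
      exact compl_injective this
    · obtain ⟨C, hC, h6, h7⟩ := h4 y y' hn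
      rw [h'.bdia_eq hC] at h6 h7
      rw [dia_compl] at h6
      exact ⟨C, hC, not_not.1 h6, h7⟩

/-- The two composition formulas for the second relation are contrapositives, as `◆C` is the
complement of `φC` and `◇` is dual to `□`. -/
theorem IsUrq.costar_eq {Z₀ : Type*} [TopologicalSpace Z'] {le₁ le₂ : Z' → Z' → Prop}
    (h : IsUrq le₁ le₂) (T : Z₀ → Z → Prop) (T' : Z → Z' → Prop) :
    costar T T' (commonUpper le₁ le₂) (closedSets (commonUpper le₁ le₂)) =
      star T T' {E | ∃ C ∈ urqSets le₁ le₂, E = negDown le₂ C} := by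
  rw [h.closedSets_eq]
  funext x z
  refine propext ⟨?_, fun H C hC => ?_⟩
  · rintro H _ ⟨C, hC, rfl⟩ hx
    by_contra hn
    have := H C hC (by rw [h.bdia_eq hC]; exact hn)
    rw [h.bdia_eq hC, dia_compl, dia_compl] at this
    exact this hx
  · rw [h.bdia_eq hC, dia_compl, dia_compl]
    exact fun hz hx => hz (H _ ⟨C, hC, rfl⟩ hx)

/-- Separation allows both quasi-orders to be recovered from the relation. Interpolation is then the
definition of the relation, and the space is `T₁` because a point in the closure of `{x}` lies above
`x` in both orders. -/
theorem isPlo_of_isUrq [TopologicalSpace Z] {le₁ le₂ : Z → Z → Prop} (h : IsUrq le₁ le₂) :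
    leX (commonUpper le₁ le₂) = le₁ ∧ leY (commonUpper le₁ le₂) = le₂ ∧
      IsPlo (commonUpper le₁ le₂) := by
  have e₁ : leX (commonUpper le₁ le₂) = le₁ := by
    funext x y
    refine propext ⟨fun hxy => ?_, ?_⟩
    · by_contra hn
      obtain ⟨C, hC, h1, h2⟩ := h.sep₁ x y hn
      rw [← h.closedSets_eq] at hC
      rw [← hC.1] at h1 h2
      exact h2 fun w hw => h1 w (hxy w hw)
    · rintro hxy w ⟨z, h1, h2⟩
      exact ⟨z, h.trans₁ _ _ _ hxy h1, h2⟩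
  have e₂ : leY (commonUpper le₁ le₂) = le₂ := by
    funext x y
    refine propext ⟨fun hxy => ?_, ?_⟩
    · by_contra hn
      obtain ⟨C, hC, h1, h2⟩ := h.sep₂ x y hn
      have h3 : y ∈ bdia (commonUpper le₁ le₂) C := by
        rw [h.bdia_eq hC]
        exact h2
      obtain ⟨w, hw, hwC⟩ := h3
      have h4 : x ∈ bdia (commonUpper le₁ le₂) C := ⟨w, hxy w hw, hwC⟩
      rw [h.bdia_eq hC] at h4
      exact h4 h1
    · rintro hxy w ⟨z, h1, h2⟩
      exact ⟨z, h1, h.trans₂ _ _ _ hxy h2⟩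
  have hcl : ∀ C ∈ urqSets le₁ le₂, IsClosed C ∧ IsClosed (negDown le₂ C) :=
    fun C hC => hC.2.2
  refine ⟨e₁, e₂, ?_⟩
  refine ⟨fun z => ⟨z, h.refl₁ z, h.refl₂ z⟩, h.compact, ?_, ?_, ?_, ?_, ?_, ?_, ?_⟩
  · refine ⟨fun x => closure_eq_iff_isClosed.1 (Set.Subset.antisymm (fun y hy => ?_)
      subset_closure)⟩
    have hmem : ∀ A : Set Z, IsClosed A → x ∈ A → y ∈ A := fun A hA hx =>
      closure_minimal (Set.singleton_subset_iff.2 hx) hA hy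
    refine (h.doubly_ordered x y ?_ ?_).symm
    · by_contra hn
      obtain ⟨C, hC, h1, h2⟩ := h.sep₁ x y hn
      exact h2 (hmem C (hcl C hC).1 h1)
    · by_contra hn
      obtain ⟨C, hC, h1, h2⟩ := h.sep₂ x y hn
      exact h2 (hmem _ (hcl C hC).2 h1)
  · rw [h.closedSets_eq]
    refine h.subbasis.trans ?_
    congr 1
    ext W
    constructor
    · rintro ⟨C, hC, rfl | rfl⟩
      · exact ⟨C, hC, Or.inl rfl⟩
      · exact ⟨C, hC, Or.inr (h.bdia_eq hC).symm⟩
    · rintro ⟨C, hC, rfl | rfl⟩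
      · exact ⟨C, hC, Or.inl rfl⟩
      · exact ⟨C, hC, Or.inr (h.bdia_eq hC)⟩
  · rw [h.closedSets_eq]
    intro C hC D hD
    rw [h.bdia_eq (h.inter_mem hC hD), compl_compl]
    exact h.closed_inter C hC D hD
  · rw [h.closedSets_eq]
    intro C hC D hD
    rw [bdia_union, h.bdia_eq hC, h.bdia_eq hD, ← Set.compl_inter, box_commonUpper h.refl₂]
    · exact h.closed_sup C hC D hD
    · intro x y hxy hx
      exact ⟨isUp_negDown h.trans₂ _ x y hxy hx.1, isUp_negDown h.trans₂ _ x y hxy hx.2⟩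
  · rw [h.closedSets_eq]
    intro x y hn
    refine h.sep₁ x y fun hxy => hn ?_
    rw [← e₁] at hxy
    exact hxy
  · rw [h.closedSets_eq]
    intro x y hn
    obtain ⟨C, hC, h1, h2⟩ := h.sep₂ x y fun hxy => hn (by rw [← e₂] at hxy; exact hxy)
    refine ⟨C, hC, ?_, ?_⟩ <;> rw [h.bdia_eq hC]
    · exact fun hn => hn h1
    · exact h2
  · rintro x y ⟨z, h1, h2⟩
    rw [← e₁] at h1
    rw [← e₂] at h2
    exact ⟨z, h1, h2⟩

/-- Every Ploščica space arises from an Urquhart space. -/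
theorem isUrq_of_isPlo [TopologicalSpace Z] {R : Z → Z → Prop} (h : IsPlo R) :
    commonUpper (leX R) (leY R) = R ∧ IsUrq (leX R) (leY R) := by
  have e : commonUpper (leX R) (leY R) = R := by
    funext x y
    refine propext ⟨?_, fun hxy => h.interpolate x y hxy⟩
    rintro ⟨z, h1, h2⟩
    -- Reflexivity of `R` at the common upper bound `z` gives `x R z`, which descends to `x R y`.
    exact h2 x (h1 z (h.refl z))
  have r₁ : ∀ x, leX R x x := fun _ _ h => h
  have r₂ : ∀ x, leY R x x := fun _ _ h => h
  have t₁ : ∀ x y z, leX R x y → leX R y z → leX R x z := fun _ _ _ h1 h2 w hw => h1 w (h2 w hw)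
  have t₂ : ∀ x y z, leY R x y → leY R y z → leY R x z := fun _ _ _ h1 h2 w hw => h1 w (h2 w hw)
  have hcl := closedSets_commonUpper r₁ t₁ r₂ t₂
  rw [e] at hcl
  have hb : ∀ C ∈ closedSets R, bdia R C = (negDown (leY R) C)ᶜ := fun C hC => by
    rw [hcl] at hC
    have := bdia_commonUpper (le₂ := leY R) r₁ hC.1
    rwa [e] at this
  have hn : ∀ C ∈ closedSets R, negDown (leY R) C = (bdia R C)ᶜ := fun C hC => by
    rw [hb C hC, compl_compl]
  refine ⟨e, r₁, t₁, r₂, t₂, h.compact, fun x y h1 h2 => ?_, ?_, ?_, ?_, ?_, ?_⟩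
  -- If `x` is below `y` in both orders, every subbasic open set containing `y` contains `x`. The
  -- complement of `{x}`, open by `T₁`, would then contain `x` if it contained `y`.
  · have := h.t1
    by_contra hne
    obtain ⟨_, ⟨f, ⟨-, hfs⟩, rfl⟩, hyf, hfA⟩ :=
      (TopologicalSpace.isTopologicalBasis_of_subbasis h.subbasis).exists_subset_of_mem_open
        (show y ∈ ({x} : Set Z)ᶜ from fun hy => hne hy.symm) isOpen_compl_singleton
    refine hfA (fun V hV => ?_ : x ∈ ⋂₀ f) rfl
    have hyV := hyf V hV
    obtain ⟨C, hC, rfl | rfl⟩ := hfs hV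
    · intro hx
      rw [← hC.1] at hx hyV
      exact hyV fun w hw => hx w (h1 w hw)
    · obtain ⟨w, hw, hwC⟩ := hyV
      exact ⟨w, h2 w hw, hwC⟩
  · rw [← hcl]
    refine h.subbasis.trans ?_
    congr 1
    ext W
    refine exists_congr fun C => and_congr_right fun hC => ?_
    rw [hn C hC, compl_compl]
  · rw [← hcl]
    intro C hC D hD
    have hCD := h.isPolFamily.inter C hC D hD
    rw [hn _ hCD]
    exact h.closed_inter C hC D hD
  · rw [← hcl]
    intro C hC D hD
    have := h.closed_sup C hC D hD
    rw [bdia_union, hb C hC, hb D hD, ← Set.compl_inter] at this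
    rw [← box_commonUpper (le₁ := leX R) (le₂ := leY R) r₂, e]
    · exact this
    · intro x y hxy hx
      exact ⟨isUp_negDown t₂ _ x y hxy hx.1, isUp_negDown t₂ _ x y hxy hx.2⟩
  · rw [← hcl]
    exact h.sep_left
  · rw [← hcl]
    intro x y hxy
    obtain ⟨C, hC, h1, h2⟩ := h.sep_right x y hxy
    refine ⟨C, hC, ?_, ?_⟩ <;> rw [hn C hC]
    · exact h1
    · exact fun hn => hn h2

end DoublyOrdered

/-! ### Representations of a lattice by a doubly ordered set -/

/-- A representation of the lattice `L` by a doubly ordered set: each point determines a disjoint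
pair of a filter and an ideal, the two orders are the inclusions of the filters and of the ideals,
and every disjoint pair of a filter and an ideal is contained in the pair of some point. -/
structure DiagRep {L Z : Type*} [Lattice L] [BoundedOrder L] (le₁ le₂ : Z → Z → Prop)
    (u v : L → Set Z) : Prop where
  filt : ∀ z, IsLatFilter {c | z ∈ u c}
  idl : ∀ z, IsLatIdeal {c | z ∈ v c}
  disj : ∀ z c, z ∈ u c → z ∉ v c
  le₁_iff : ∀ x y, le₁ x y ↔ ∀ c, x ∈ u c → y ∈ u c
  le₂_iff : ∀ x y, le₂ x y ↔ ∀ c, x ∈ v c → y ∈ v c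
  rich : ∀ F I : Set L, IsLatFilter F → IsLatIdeal I → (∀ c ∈ F, c ∉ I) →
    ∃ z, (∀ c ∈ F, z ∈ u c) ∧ ∀ c ∈ I, z ∈ v c

namespace DiagRep

variable {L Z : Type*} [Lattice L] [BoundedOrder L] {le₁ le₂ : Z → Z → Prop}
  {u v : L → Set Z}

/-- A point carries both a filter and an ideal and is used on either side; `rich`, applied to the
filter of `x` and the ideal of `y`, produces exactly a common upper bound. -/
theorem polRep (h : DiagRep le₁ le₂ u v) : PolRep (commonUpper le₁ le₂) u v where
  filt := h.filt
  idl := h.idl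
  rel x y := by
    constructor
    · rintro ⟨z, h1, h2⟩ c hx hy
      exact h.disj z c ((h.le₁_iff x z).1 h1 c hx) ((h.le₂_iff y z).1 h2 c hy)
    · intro H
      obtain ⟨z, h1, h2⟩ := h.rich _ _ (h.filt x) (h.idl y) H
      exact ⟨z, (h.le₁_iff x z).2 h1, (h.le₂_iff y z).2 h2⟩
  rich F I hF hI hd := by
    obtain ⟨z, h1, h2⟩ := h.rich F I hF hI hd
    exact ⟨z, z, ⟨z, (h.le₁_iff z z).2 fun _ h => h, (h.le₂_iff z z).2 fun _ h => h⟩, h1, h2⟩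

theorem isUp_u (h : DiagRep le₁ le₂ u v) (c : L) : IsUp le₁ (u c) :=
  fun x y hxy hx => (h.le₁_iff x y).1 hxy c hx

theorem negDown_u (h : DiagRep le₁ le₂ u v) (c : L) : negDown le₂ (u c) = v c := by
  have := h.polRep.bdia_u c
  rw [bdia_commonUpper (fun x => (h.le₁_iff x x).2 fun _ h => h) (h.isUp_u c)] at this
  exact compl_injective this

/-- A closed `≤₁`-upset and a point of its image under `φ` are separated by some `c`. -/
theorem exists_sep [TopologicalSpace Z] [CompactSpace Z] (h : DiagRep le₁ le₂ u v)
    (hv : ∀ c, IsClosed (v c)) {C : Set Z} (hC : IsClosed C) (hup : IsUp le₁ C) {y : Z}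
    (hy : y ∈ negDown le₂ C) : ∃ c, C ⊆ u c ∧ y ∈ v c := by
  have : Nonempty {c // y ∈ v c} := ⟨⊥, (h.idl y).bot_mem⟩
  -- Each `d ∈ C` fails `y ≤₂ d` and so avoids some `v c` containing `y`. The ideal of `y` is
  -- directed, so compactness gives one `c` for which all of `C` avoids `v c`; being an upset, `C`
  -- then lies in `u c`.
  obtain ⟨⟨c, hc⟩, hCc⟩ := hC.isCompact.elim_directed_cover
    (fun c : {c // y ∈ v c} => (v c.1)ᶜ) (fun c => (hv c).isOpen_compl) (fun d hd => by
      have := hy d hd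
      rw [h.le₂_iff] at this
      push Not at this
      obtain ⟨c, h1, h2⟩ := this
      exact Set.mem_iUnion.2 ⟨⟨c, h1⟩, h2⟩)
    (fun c d => ⟨⟨c.1 ⊔ d.1, (h.idl y).sup_mem _ c.2 _ d.2⟩,
      Set.compl_subset_compl.2 (h.polRep.v_anti le_sup_left),
      Set.compl_subset_compl.2 (h.polRep.v_anti le_sup_right)⟩)
  refine ⟨c, fun x hx => ?_, hc⟩
  rw [← h.polRep.box_v]
  rintro y' ⟨z, h1, h2⟩ hy'
  exact hCc (hup x z h1 hx) ((h.le₂_iff y' z).1 h2 c hy')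

/-- A closed stable set is an intersection of sets `u c`. -/
theorem exists_sep_stable [TopologicalSpace Z] [CompactSpace Z] (h : DiagRep le₁ le₂ u v)
    (hv : ∀ c, IsClosed (v c)) {C : Set Z} (hC : C ∈ stableSets le₁ le₂) {x : Z} (hx : x ∉ C) :
    ∃ c, C ⊆ u c ∧ x ∉ u c := by
  rw [← hC.2.2] at hx
  simp only [negDown, Set.mem_ofPred_eq, not_forall, not_not] at hx
  obtain ⟨y, hy, hxy⟩ := hx
  obtain ⟨c, h1, h2⟩ := h.exists_sep hv hC.2.1 hC.1 hy
  exact ⟨c, h1, fun hxc => h.disj y c (h.isUp_u c x y hxy hxc) h2⟩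

theorem swap (h : DiagRep le₁ le₂ u v) : DiagRep (L := Lᵒᵈ) le₂ le₁
    (fun c => v (OrderDual.ofDual c)) (fun c => u (OrderDual.ofDual c)) where
  filt z := (h.idl z).dual
  idl z := (h.filt z).dual
  disj z c hv hu := h.disj z _ hu hv
  le₁_iff := h.le₂_iff
  le₂_iff := h.le₁_iff
  rich F I hF hI hd := by
    obtain ⟨z, h2, h3⟩ := h.rich (OrderDual.toDual ⁻¹' I) (OrderDual.toDual ⁻¹' F)
      ⟨hI.nonempty, fun _ _ hab ha => hI.lower hab ha, hI.sup_mem⟩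
      ⟨hF.nonempty, fun _ _ hab ha => hF.upper hab ha, hF.inf_mem⟩ (fun c hc hcF => hd c hcF hc)
    exact ⟨z, h3, h2⟩

/-- A representation by a doubly ordered set with the generated topology is an Urquhart space. -/
theorem isUrq [tZ : TopologicalSpace Z] (h : DiagRep le₁ le₂ u v)
    (anti : ∀ x y, le₁ x y → le₂ x y → x = y)
    (ht : tZ = TopologicalSpace.generateFrom (Set.range (fun c => (u c)ᶜ) ∪
      Set.range fun c => (v c)ᶜ)) : urqSets le₁ le₂ = Set.range u ∧ IsUrq le₁ le₂ := by
  have r₁ : ∀ x, le₁ x x := fun x => (h.le₁_iff x x).2 fun _ h => h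
  have r₂ : ∀ x, le₂ x x := fun x => (h.le₂_iff x x).2 fun _ h => h
  have t₁ : ∀ x y z, le₁ x y → le₁ y z → le₁ x z := fun x y z h1 h2 =>
    (h.le₁_iff x z).2 fun c hc => (h.le₁_iff y z).1 h2 c ((h.le₁_iff x y).1 h1 c hc)
  have t₂ : ∀ x y z, le₂ x y → le₂ y z → le₂ x z := fun x y z h1 h2 =>
    (h.le₂_iff x z).2 fun c hc => (h.le₂_iff y z).1 h2 c ((h.le₂_iff x y).1 h1 c hc)
  have hcpt : CompactSpace Z := compactSpace_of_rich ht h.filt h.idl h.disj h.rich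
  have hu : ∀ c, IsClosed (u c) := fun c => by
    rw [← isOpen_compl_iff, ht]
    exact TopologicalSpace.GenerateOpen.basic _ (Or.inl ⟨c, rfl⟩)
  have hv : ∀ c, IsClosed (v c) := fun c => by
    rw [← isOpen_compl_iff, ht]
    exact TopologicalSpace.GenerateOpen.basic _ (Or.inr ⟨c, rfl⟩)
  have hψ : ∀ c, negDown le₁ (v c) = u c := h.swap.negDown_u
  have hmem : ∀ c, u c ∈ urqSets le₁ le₂ := fun c =>
    ⟨h.isUp_u c, by rw [h.negDown_u, hψ], hu c, by rw [h.negDown_u]; exact hv c⟩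
  have hsets : urqSets le₁ le₂ = Set.range u := by
    ext C
    refine ⟨fun hC => ?_, by rintro ⟨c, rfl⟩; exact hmem c⟩
    have hC' : C ∈ closedSets (commonUpper le₁ le₂) := by
      rwa [closedSets_commonUpper r₁ t₁ r₂ t₂]
    -- The two separation hypotheses are `exists_sep_stable` for the stable set `C` and, after
    -- exchanging the orders, for `φC`.
    refine h.polRep.mem_range hC'.1
      (fun x hx => h.exists_sep_stable hv ⟨hC.1, hC.2.2.1, hC.2.1⟩ hx) fun y hy => ?_
    rw [bdia_commonUpper r₁ hC.1] at hy ⊢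
    rw [compl_compl]
    refine h.swap.exists_sep_stable (C := negDown le₂ C) hu
      ⟨isUp_negDown t₂ C, hC.2.2.2, ?_⟩ hy
    rw [hC.2.1]
  refine ⟨hsets, r₁, t₁, r₂, t₂, hcpt, anti, ?_, ?_, ?_, ?_, ?_⟩
  · rw [hsets, ht]
    congr 1
    ext W
    constructor
    · rintro (⟨c, rfl⟩ | ⟨c, rfl⟩)
      · exact ⟨u c, ⟨c, rfl⟩, Or.inl rfl⟩
      · exact ⟨u c, ⟨c, rfl⟩, Or.inr (by rw [h.negDown_u])⟩
    · rintro ⟨_, ⟨c, rfl⟩, rfl | rfl⟩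
      · exact Or.inl ⟨c, rfl⟩
      · exact Or.inr ⟨c, by rw [h.negDown_u]⟩
  · rw [hsets]
    rintro _ ⟨c, rfl⟩ _ ⟨d, rfl⟩
    rw [← h.polRep.u_inf, h.negDown_u]
    exact hv _
  · rw [hsets]
    rintro _ ⟨c, rfl⟩ _ ⟨d, rfl⟩
    rw [h.negDown_u, h.negDown_u, ← h.polRep.v_sup, hψ]
    exact hu _
  · intro x y hxy
    rw [h.le₁_iff] at hxy
    push Not at hxy
    obtain ⟨c, h1, h2⟩ := hxy
    exact ⟨u c, hmem c, h1, h2⟩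
  · intro x y hxy
    rw [h.le₂_iff] at hxy
    push Not at hxy
    obtain ⟨c, h1, h2⟩ := hxy
    refine ⟨u c, hmem c, ?_⟩
    rw [h.negDown_u]
    exact ⟨h1, h2⟩

end DiagRep

/-- The pairs that are maximal for each other represent the same lattice. -/
theorem PolRep.diagRep_maxPairs {L X Y : Type*} [Lattice L] [BoundedOrder L] {R : X → Y → Prop}
    {u : L → Set X} {v : L → Set Y} (h : PolRep R u v)
    (hl : ∀ x x', leX R x x' → leX R x' x → x = x')
    (hr : ∀ y y', leY R y y' → leY R y' y → y = y') :
    DiagRep (Z := {p : X × Y // IsMaxLeft R p.1 p.2 ∧ IsMaxRight R p.1 p.2})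
      (fun p q => leX R p.1.1 q.1.1) (fun p q => leY R p.1.2 q.1.2)
      (fun c => {p | p.1.1 ∈ u c}) (fun c => {p | p.1.2 ∈ v c}) where
  filt p := h.filt p.1.1
  idl p := h.idl p.1.2
  disj p := (h.rel p.1.1 p.1.2).1 p.2.1.1
  le₁_iff _ _ := h.leX_iff
  le₂_iff _ _ := h.leY_iff
  rich F I hF hI hd := by
    obtain ⟨x, y, h1, h2, h3, h4, h5⟩ := h.exists_max_pair hF hI hd
    exact ⟨⟨(x, y), ⟨h1, fun x' hx hR => hl _ _ (h4 x' hx hR) hx⟩,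
      ⟨h1, fun y' hy hR => hr _ _ (h5 y' hy hR) hy⟩⟩, h2, h3⟩

/-- Comparability in both orders makes the mixed pairs formed from coordinates of `p` and `q`
related, so maximality of each coordinate of `p` forces equality. No antisymmetry of the
quasi-orders is needed. -/
theorem maxPairs_antisymm {X Y : Type*} {R : X → Y → Prop}
    (p q : {p : X × Y // IsMaxLeft R p.1 p.2 ∧ IsMaxRight R p.1 p.2})
    (h₁ : leX R p.1.1 q.1.1) (h₂ : leY R p.1.2 q.1.2) : p = q := by
  refine Subtype.ext (Prod.ext ?_ ?_)
  · exact (p.2.1.2 _ h₁ (h₂ _ q.2.1.1)).symm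
  · exact (p.2.2.2 _ h₂ (h₁ _ q.2.1.1)).symm

/-- An Urquhart space represents its lattice. -/
theorem Urq.diagRep (U : Urq.{u}) :
    DiagRep U.le₁ U.le₂ (fun C : U.L => C.1) (fun C => U.phi C.1) where
  filt z := ⟨⟨⊤, trivial⟩, fun C D hCD hz => hCD hz, fun C hC D hD => ⟨hC, hD⟩⟩
  idl z := ⟨⟨⊥, fun _ h => h.elim⟩, fun C D hCD hz => negDown_anti U.le₂ hCD hz,
    fun C hC D hD => (U.isUrq.neg_sup C.2 D.2).symm.subset ⟨hC, hD⟩⟩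
  disj z C hz hz' := hz' z hz (U.isUrq.refl₂ z)
  le₁_iff x y := by
    refine ⟨fun hxy C hx => C.2.1 x y hxy hx, fun H => ?_⟩
    by_contra hn
    obtain ⟨C, hC, h1, h2⟩ := U.isUrq.sep₁ x y hn
    exact h2 (H ⟨C, hC⟩ h1)
  le₂_iff x y := by
    refine ⟨fun hxy C hx => isUp_negDown U.isUrq.trans₂ C.1 x y hxy hx, fun H => ?_⟩
    by_contra hn
    obtain ⟨C, hC, h1, h2⟩ := U.isUrq.sep₂ x y hn
    exact h2 (H ⟨C, hC⟩ h1)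
  rich F I hF hI hd := by
    have := U.isUrq.compact
    have : Nonempty F := hF.nonempty.to_subtype
    have : Nonempty I := hI.nonempty.to_subtype
    have hcl : ∀ i : F × I, IsClosed (i.1.1.1 ∩ U.phi i.2.1.1) := fun i =>
      i.1.1.2.2.2.1.inter i.2.1.2.2.2.2
    -- The closed sets `C ∩ φD`, for `C` in the filter and `D` in the ideal, are downward directed.
    -- They are nonempty: otherwise the upset `C` would lie in `ψφD = D`, placing `C` in the ideal.
    obtain ⟨z, hz⟩ := IsCompact.nonempty_iInter_of_directed_nonempty_isCompact_isClosed
      (fun i : F × I => i.1.1.1 ∩ U.phi i.2.1.1) (by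
        rintro ⟨C, D⟩ ⟨C', D'⟩
        refine ⟨(⟨C.1 ⊓ C'.1, hF.inf_mem _ C.2 _ C'.2⟩, ⟨D.1 ⊔ D'.1, hI.sup_mem _ D.2 _ D'.2⟩),
          Set.inter_subset_inter (inf_le_left (a := C.1)) (negDown_anti U.le₂ (le_sup_left (a := D.1))),
          Set.inter_subset_inter (inf_le_right (a := C.1))
            (negDown_anti U.le₂ (le_sup_right (a := D.1)))⟩) (by
        rintro ⟨C, D⟩
        by_contra hn
        refine hd C.1 C.2 (hI.lower (a := D.1) (fun x hx => ?_) D.2)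
        rw [← D.1.2.2.1]
        intro d hd hxd
        exact hn ⟨d, C.1.2.1 x d hxd hx, hd⟩) (fun i => (hcl i).isCompact) hcl
    rw [Set.mem_iInter] at hz
    obtain ⟨C₀⟩ := ‹Nonempty F›
    obtain ⟨D₀⟩ := ‹Nonempty I›
    exact ⟨z, fun C hC => (hz (⟨C, hC⟩, D₀)).1, fun D hD => (hz (C₀, ⟨D, hD⟩)).2⟩


/-! ### Coherent lattices as filter lattices -/

/-- A complete lattice is the lattice of filters of `L`, via the map `a` that sends an element of `L`
to the corresponding principal filter. -/
structure CohRep {L X : Type*} [Lattice L] [BoundedOrder L] [CompleteLattice X] (a : L → X) :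
    Prop where
  le_iff : ∀ c d, a c ≤ a d ↔ d ≤ c
  compact : ∀ c, IsCompactElement (a c)
  le_of : ∀ x y, (∀ c, a c ≤ x → a c ≤ y) → x ≤ y
  inf_le : ∀ c d, a (c ⊓ d) ≤ a c ⊔ a d
  top_le : a ⊤ ≤ ⊥

namespace CohRep

variable {L X : Type*} [Lattice L] [BoundedOrder L] [CompleteLattice X] {a : L → X}

theorem isLatFilter (h : CohRep a) (x : X) : IsLatFilter {c | a c ≤ x} :=
  ⟨⟨⊤, h.top_le.trans bot_le⟩, fun _ _ hcd hc => ((h.le_iff _ _).2 hcd).trans hc,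
    fun c hc d hd => (h.inf_le c d).trans (sup_le hc hd)⟩

/-- The image of a filter under the antitone map `a` is directed, so compactness of `a c` places it
below a single `a d` with `d ∈ F`. Thus the join loses no information and every filter is realized
by an element. -/
theorem le_sSup_iff (h : CohRep a) {F : Set L} (hF : IsLatFilter F) {c : L} :
    a c ≤ sSup (a '' F) ↔ c ∈ F := by
  refine ⟨fun hc => ?_, fun hc => le_sSup ⟨c, hc, rfl⟩⟩
  obtain ⟨_, ⟨d, hd, rfl⟩, hcd⟩ := h.compact c (a '' F) _ (hF.nonempty.image a) (by
    rintro _ ⟨c, hc, rfl⟩ _ ⟨d, hd, rfl⟩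
    exact ⟨_, ⟨_, hF.inf_mem _ hc _ hd, rfl⟩, (h.le_iff _ _).2 inf_le_left,
      (h.le_iff _ _).2 inf_le_right⟩) (isLUB_sSup _) hc
  exact hF.upper ((h.le_iff _ _).1 hcd) hd

theorem ext (h : CohRep a) {x y : X} (H : ∀ c, a c ≤ x ↔ a c ≤ y) : x = y :=
  le_antisymm (h.le_of _ _ fun c => (H c).1) (h.le_of _ _ fun c => (H c).2)

theorem sSup_eq (h : CohRep a) (x : X) : sSup (a '' {c | a c ≤ x}) = x :=
  h.ext fun _ => h.le_sSup_iff (h.isLatFilter x)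

/-- A compact element is the directed join of the principal elements below it, hence is one of them.
-/
theorem exists_eq (h : CohRep a) {k : X} (hk : IsCompactElement k) : ∃ c, a c = k := by
  have hF := h.isLatFilter k
  obtain ⟨_, ⟨d, hd, rfl⟩, hcd⟩ := hk (a '' {c | a c ≤ k}) _ (hF.nonempty.image a) (by
    rintro _ ⟨c, hc, rfl⟩ _ ⟨d, hd, rfl⟩
    exact ⟨_, ⟨_, hF.inf_mem _ hc _ hd, rfl⟩, (h.le_iff _ _).2 inf_le_left,
      (h.le_iff _ _).2 inf_le_right⟩) (isLUB_sSup _) (h.sSup_eq k).ge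
  exact ⟨d, le_antisymm hd hcd⟩

theorem map_sup (h : CohRep a) (c d : L) : a (c ⊔ d) = a c ⊓ a d :=
  h.ext fun _ => by rw [le_inf_iff, h.le_iff, h.le_iff, h.le_iff, sup_le_iff]

theorem map_bot (h : CohRep a) : a ⊥ = ⊤ :=
  top_le_iff.1 (h.le_of _ _ fun _ _ => (h.le_iff _ _).2 bot_le)

theorem isCoherent (h : CohRep a) : IsCoherent X where
  algebraic := ⟨fun x => ⟨_, by
    rintro _ ⟨c, -, rfl⟩
    exact h.compact c, h.sSup_eq x⟩⟩
  compact_top := h.map_bot ▸ h.compact ⊥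
  compact_inf k l hk hl := by
    obtain ⟨c, rfl⟩ := h.exists_eq hk
    obtain ⟨d, rfl⟩ := h.exists_eq hl
    rw [← h.map_sup]
    exact h.compact _

theorem exists_mem_scott (h : CohRep a) {W : Set X} (hW : IsOpen[Topology.scott X Set.univ] W)
    {x : X} (hx : x ∈ W) : ∃ c, a c ≤ x ∧ a c ∈ W := by
  have hF := h.isLatFilter x
  obtain ⟨_, ⟨⟨c, hc, rfl⟩, hcW⟩⟩ := ((scott_isOpen_iff W).1 hW).2 (d := a '' {c | a c ≤ x})
    (Set.mem_univ _) (hF.nonempty.image a) (by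
    rintro _ ⟨c, hc, rfl⟩ _ ⟨d, hd, rfl⟩
    exact ⟨_, ⟨_, hF.inf_mem _ hc _ hd, rfl⟩, (h.le_iff _ _).2 inf_le_left,
      (h.le_iff _ _).2 inf_le_right⟩) (isLUB_sSup _) (by rwa [h.sSup_eq])
  exact ⟨c, hc, hcW⟩

section Lawson

variable [tX : TopologicalSpace X] [Topology.IsLawson X]

/-- A basic Lawson-open set is a Scott-open set minus an upset. Descending from `x` to a suitable
principal element stays in the former by inaccessibility and cannot enter the latter. -/
theorem exists_mem_open (h : CohRep a) {U : Set X} (hU : IsOpen U) {x : X} (hx : x ∈ U) :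
    ∃ c, a c ≤ x ∧ a c ∈ U := by
  obtain ⟨_, ⟨t, -, W, hW, rfl⟩, hxV, hVU⟩ :=
    (Topology.IsLawson.isTopologicalBasis X).exists_subset_of_mem_open hx hU
  obtain ⟨c, hc, hcW⟩ := h.exists_mem_scott hW hxV.1
  exact ⟨c, hc, hVU ⟨hcW, fun hn => hxV.2 ((upperClosure t).upper hc hn)⟩⟩

theorem isClopen_Ici (h : CohRep a) (c : L) : IsClopen (Set.Ici (a c)) :=
  isClopen_Ici_of_compact (h.compact c)

/-- Every `Ici x` is an intersection of sets `Ici (a c)` and every Scott-open set is a union of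
them, so both halves of the Lawson topology come from these clopen sets. -/
theorem topology_eq (h : CohRep a) : tX = TopologicalSpace.generateFrom
    (Set.range (fun c => (Set.Ici (a c))ᶜ) ∪ Set.range fun c => Set.Ici (a c)) := by
  refine le_antisymm (le_generateFrom ?_) ?_
  · rintro _ (⟨c, rfl⟩ | ⟨c, rfl⟩)
    · exact (h.isClopen_Ici c).compl.2
    · exact (h.isClopen_Ici c).2
  · rw [Topology.IsLawson.topology_eq_lawson (α := X)]
    refine le_inf (le_generateFrom ?_) fun W hW => ?_
    · rintro _ ⟨x, rfl⟩
      have : (Set.Ici x)ᶜ = ⋃ c : {c // a c ≤ x}, (Set.Ici (a c.1))ᶜ := by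
        ext z
        simp only [Set.mem_compl_iff, Set.mem_Ici, Set.mem_iUnion, Subtype.exists]
        refine ⟨fun hz => ?_, ?_⟩
        · by_contra hn
          push Not at hn
          exact hz (h.le_of _ _ hn)
        · rintro ⟨c, hc, hz⟩ hxz
          exact hz (hc.trans hxz)
      rw [this]
      exact @isOpen_iUnion _ _ (TopologicalSpace.generateFrom _) _ fun c =>
        TopologicalSpace.GenerateOpen.basic _ (Or.inl ⟨c.1, rfl⟩)
    · have : W = ⋃ c : {c // a c ∈ W}, Set.Ici (a c.1) := by
        ext z
        simp only [Set.mem_Ici, Set.mem_iUnion, Subtype.exists]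
        refine ⟨fun hz => ?_, ?_⟩
        · obtain ⟨c, h1, h2⟩ := h.exists_mem_scott hW hz
          exact ⟨c, h2, h1⟩
        · rintro ⟨c, hc, hz⟩
          exact ((scott_isOpen_iff W).1 hW).1 hz hc
      rw [this]
      exact @isOpen_iUnion _ _ (TopologicalSpace.generateFrom _) _ fun c =>
        TopologicalSpace.GenerateOpen.basic _ (Or.inr ⟨c.1, rfl⟩)

/-- An ultrafilter converges to the element whose lattice filter consists of the `c` with `Ici (a
c)` in the ultrafilter. -/
theorem compactSpace (h : CohRep a) : CompactSpace X := by
  rw [← isCompact_univ_iff, isCompact_iff_ultrafilter_le_nhds]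
  intro f _
  have hF : IsLatFilter {c | Set.Ici (a c) ∈ f} := by
    refine ⟨⟨⊤, Filter.univ_mem' fun x => h.top_le.trans bot_le⟩,
      fun c d hcd hc => Filter.mem_of_superset hc (Set.Ici_subset_Ici.2 ((h.le_iff _ _).2 hcd)),
      fun c hc d hd => Filter.mem_of_superset (Filter.inter_mem hc hd) fun x hx =>
        (h.inf_le c d).trans (sup_le hx.1 hx.2)⟩
  refine ⟨sSup (a '' {c | Set.Ici (a c) ∈ f}), trivial, ?_⟩
  rw [h.topology_eq, TopologicalSpace.nhds_generateFrom]
  refine le_iInf₂ fun s hs => Filter.le_principal_iff.2 ?_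
  obtain ⟨hxs, ⟨c, rfl⟩ | ⟨c, rfl⟩⟩ := hs
  · exact Ultrafilter.compl_mem_iff_notMem.2 fun hn => hxs ((h.le_sSup_iff hF).2 hn)
  · exact (h.le_sSup_iff hF).1 hxs

end Lawson

/-- The maps of filter lattices induced by lattice homomorphisms are coherent. -/
theorem isCohMap {L' X' : Type*} [Lattice L'] [BoundedOrder L'] [CompleteLattice X'] {a' : L' → X'}
    [TopologicalSpace X] [Topology.IsLawson X] [TopologicalSpace X'] [Topology.IsLawson X']
    (h : CohRep a) (h' : CohRep a') (φ : BoundedLatticeHom L' L) {f : X → X'}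
    (hf : ∀ c x, a' c ≤ f x ↔ a (φ c) ≤ x) : IsCohMap f ∧ ∃ l : X' → X, GaloisConnection l f ∧
      ∀ d x', a d ≤ l x' ↔ ∃ c, a' c ≤ x' ∧ φ c ≤ d := by
  -- The left adjoint of "pull a filter back along `φ`" is "take the filter generated by the image
  -- under `φ`".
  have hG : ∀ x', IsLatFilter {d | ∃ c, a' c ≤ x' ∧ φ c ≤ d} := by
    intro x'
    have hx' := h'.isLatFilter x'
    refine ⟨⟨⊤, ⊤, hx'.top_mem, le_top⟩, ?_, ?_⟩
    · rintro d e hde ⟨c, h1, h2⟩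
      exact ⟨c, h1, h2.trans hde⟩
    · rintro d ⟨c, h1, h2⟩ d' ⟨c', h3, h4⟩
      refine ⟨c ⊓ c', hx'.inf_mem _ h1 _ h3, ?_⟩
      rw [map_inf]
      exact inf_le_inf h2 h4
  have hl : ∀ d x', a d ≤ sSup (a '' {d | ∃ c, a' c ≤ x' ∧ φ c ≤ d}) ↔
      ∃ c, a' c ≤ x' ∧ φ c ≤ d := fun d x' => h.le_sSup_iff (hG x')
  have gc : GaloisConnection (fun x' => sSup (a '' {d | ∃ c, a' c ≤ x' ∧ φ c ≤ d})) f := by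
    intro x' x
    constructor
    · intro hx
      refine h'.le_of _ _ fun c hc => (hf c x).2 (le_trans ?_ hx)
      exact (hl _ _).2 ⟨c, hc, le_rfl⟩
    · intro hx
      refine h.le_of _ _ fun d hd => ?_
      obtain ⟨c, h1, h2⟩ := (hl _ _).1 hd
      exact ((h.le_iff _ _).2 h2).trans ((hf c x).1 (h1.trans hx))
  refine ⟨⟨fun x y => h'.ext fun c => ?_, h'.ext fun c => ?_, ?_, _, gc, fun x y => h.ext fun d => ?_,
    h.ext fun d => ?_⟩, _, gc, hl⟩
  · rw [hf, le_inf_iff, le_inf_iff, hf, hf]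
  · rw [hf]
    exact iff_of_true le_top le_top
  · rw [h'.topology_eq, continuous_generateFrom_iff]
    have hpre : ∀ c, f ⁻¹' Set.Ici (a' c) = Set.Ici (a (φ c)) := fun c => Set.ext fun x => hf c x
    rintro _ (⟨c, rfl⟩ | ⟨c, rfl⟩)
    · rw [Set.preimage_compl, hpre]
      exact (h.isClopen_Ici _).compl.2
    · change IsOpen (f ⁻¹' Set.Ici (a' c))
      rw [hpre]
      exact (h.isClopen_Ici _).2
  · rw [le_inf_iff, hl, hl, hl]
    constructor
    · rintro ⟨c, h1, h2⟩
      exact ⟨⟨c, h1.trans inf_le_left, h2⟩, ⟨c, h1.trans inf_le_right, h2⟩⟩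
    · rintro ⟨⟨c, h1, h2⟩, ⟨c', h3, h4⟩⟩
      -- Preservation of meets by the left adjoint is where `φ` must preserve joins; preservation of
      -- the top likewise uses `φ ⊥ = ⊥`.
      refine ⟨c ⊔ c', ?_, ?_⟩
      · rw [h'.map_sup]
        exact inf_le_inf h1 h3
      · rw [SupHomClass.map_sup]
        exact sup_le h2 h4
  · rw [hl]
    exact iff_of_true ⟨⊥, le_top, by simp⟩ le_top

end CohRep

/-! ### Dunn–Hartonas spaces as spaces of filters and ideals -/

/-- `(X, R, Y)` is the triple of the filters of `L`, the disjointness relation, and the ideals of `L`;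
`a` and `b` send an element of `L` to its principal filter and ideal. -/
structure DHRep {L X Y : Type*} [Lattice L] [BoundedOrder L] [CompleteLattice X]
    [CompleteLattice Y] (R : X → Y → Prop) (a : L → X) (b : L → Y) : Prop where
  left : CohRep a
  right : CohRep (L := Lᵒᵈ) fun c => b (OrderDual.ofDual c)
  rel : ∀ x y, R x y ↔ ∀ c, a c ≤ x → ¬ b c ≤ y

namespace DHRep

variable {L X Y : Type*} [Lattice L] [BoundedOrder L] [CompleteLattice X]
  [CompleteLattice Y] {R : X → Y → Prop} {a : L → X} {b : L → Y}

theorem swap (h : DHRep R a b) : DHRep (L := Lᵒᵈ) (fun y x => R x y)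
    (fun c => b (OrderDual.ofDual c)) (fun c => a (OrderDual.ofDual c)) where
  left := h.right
  right := ⟨h.left.le_iff, h.left.compact, h.left.le_of, h.left.inf_le, h.left.top_le⟩
  rel y x := (h.rel x y).trans ⟨fun H _ hy hx => H _ hx hy, fun H _ hx hy => H _ hy hx⟩

theorem b_le_iff (h : DHRep R a b) (c d : L) : b c ≤ b d ↔ c ≤ d := h.right.le_iff _ _

theorem rel_a_iff (h : DHRep R a b) (c : L) (y : Y) : R (a c) y ↔ ¬ b c ≤ y := by
  rw [h.rel]
  exact ⟨fun H => H c le_rfl, fun H d hd hy =>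
    H (((h.b_le_iff c d).2 ((h.left.le_iff _ _).1 hd)).trans hy)⟩

/-- All filters and ideals are points here, so a disjoint pair is realized by the joins of its
principal elements, with nothing enlarged. -/
theorem polRep (h : DHRep R a b) : PolRep R (fun c => Set.Ici (a c)) (fun c => Set.Ici (b c)) where
  filt := h.left.isLatFilter
  idl y := by
    have := h.right.isLatFilter y
    exact ⟨this.nonempty, fun _ _ hab ha => this.upper hab ha, this.inf_mem⟩
  rel := h.rel
  rich F I hF hI hd := by
    refine ⟨sSup (a '' F), sSup (b '' I), ?_, fun c hc => le_sSup ⟨c, hc, rfl⟩,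
      fun c hc => le_sSup ⟨c, hc, rfl⟩⟩
    rw [h.rel]
    intro c h1 h2
    exact hd c ((h.left.le_sSup_iff hF).1 h1) ((h.right.le_sSup_iff hI.dual).1 h2)

theorem antitone_left (h : DHRep R a b) {x x' : X} {y : Y} (hx : x ≤ x') (hR : R x' y) : R x y :=
  (h.rel x y).2 fun c hc => (h.rel x' y).1 hR c (hc.trans hx)

theorem isLatFilter_image (h : DHRep R a b) (x : X) : IsLatFilter {y | ¬ R x y} := by
  have key : ∀ y, ¬ R x y ↔ ∃ c, a c ≤ x ∧ b c ≤ y := fun y => by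
    rw [h.rel]
    push Not
    rfl
  simp only [key]
  refine ⟨⟨⊤, ⊤, h.left.top_le.trans bot_le, le_top⟩, ?_, ?_⟩
  · rintro y y' hyy' ⟨c, h1, h2⟩
    exact ⟨c, h1, h2.trans hyy'⟩
  · rintro y ⟨c, h1, h2⟩ y' ⟨d, h3, h4⟩
    exact ⟨c ⊓ d, (h.left.isLatFilter x).inf_mem _ h1 _ h3,
      le_inf (((h.b_le_iff _ _).2 inf_le_left).trans h2)
        (((h.b_le_iff _ _).2 inf_le_right).trans h4)⟩

theorem le_left (h : DHRep R a b) (x x' : X) (hxx' : {y | R x y} ⊆ {y | R x' y}) : x' ≤ x :=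
  h.left.le_of _ _ fun c hc => h.polRep.leX_iff.1 hxx' c hc

/-- The second component of a morphism is determined by the first. -/
theorem le_map_iff {L' X' Y' : Type*} [Lattice L'] [BoundedOrder L'] [CompleteLattice X']
    [CompleteLattice Y'] [TopologicalSpace X] [TopologicalSpace Y] [TopologicalSpace X']
    [TopologicalSpace Y'] {R' : X' → Y' → Prop} {a' : L' → X'} {b' : L' → Y'}
    (h : DHRep R a b) (h' : DHRep R' a' b') {φ : L' → L}
    {f : X → X'} {g : Y → Y'} (H : IsDHHom R R' f g) (hf : ∀ c x, a' c ≤ f x ↔ a (φ c) ≤ x)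
    (c : L') (y : Y) : b' c ≤ g y ↔ b (φ c) ≤ y := by
  -- Whether `b' c ≤ g y` is detected by relating the principal element `a' c` to `g y`, so the back
  -- and forth conditions apply.
  rw [← not_iff_not, ← h'.rel_a_iff, ← h.rel_a_iff]
  constructor
  · intro hR
    obtain ⟨x, h1, h2⟩ := H.back_left _ _ hR
    exact h.antitone_left ((hf c x).1 h2) h1
  · intro hR
    exact h'.antitone_left ((hf c _).2 le_rfl) (H.forth _ _ hR)

theorem isClopen_rel_a [TopologicalSpace Y] [Topology.IsLawson Y] (h : DHRep R a b)
    (c : L) : IsClopen {y | R (a c) y} := by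
  have : {y | R (a c) y} = (Set.Ici (b c))ᶜ := Set.ext fun y => h.rel_a_iff c y
  rw [this]
  exact (h.right.isClopen_Ici c).compl

theorem isClosed_image [TopologicalSpace Y] [Topology.IsLawson Y] (h : DHRep R a b)
    (x : X) : IsClosed {y | R x y} := by
  have : {y | R x y} = ⋂ c : {c // a c ≤ x}, (Set.Ici (b c.1))ᶜ := by
    ext y
    simp [h.rel]
  rw [this]
  exact isClosed_iInter fun c => (h.right.isClopen_Ici c.1).compl.1

section Lawson

variable [tX : TopologicalSpace X] [Topology.IsLawson X] [tY : TopologicalSpace Y]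
  [Topology.IsLawson Y]

/-- A clopen `U` is compact and lies above finitely many principal elements of itself. As `R` is
antitone, `R[U]` is the union of their images, each of which is clopen. -/
theorem isClopen_bdia (h : DHRep R a b) {U : Set X} (hU : IsClopen U) : IsClopen (bdia R U) := by
  have := h.left.compactSpace
  obtain ⟨t, ht⟩ := hU.1.isCompact.elim_finite_subcover
    (fun c : {c // a c ∈ U} => Set.Ici (a c.1)) (fun c => (h.left.isClopen_Ici c.1).2) (by
    intro x hx
    obtain ⟨c, h1, h2⟩ := h.left.exists_mem_open hU.2 hx
    exact Set.mem_iUnion.2 ⟨⟨c, h2⟩, h1⟩)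
  have : bdia R U = ⋃ c ∈ t, {y | R (a c.1) y} := by
    ext y
    simp only [Set.mem_iUnion, exists_prop]
    constructor
    · rintro ⟨x, hx, hxU⟩
      obtain ⟨c, hc, hcx⟩ := Set.mem_iUnion₂.1 (ht hxU)
      exact ⟨c, hc, h.antitone_left hcx hx⟩
    · rintro ⟨c, -, hc⟩
      exact ⟨_, hc, c.2⟩
  rw [this]
  exact t.finite_toSet.isClopen_biUnion fun c _ => h.isClopen_rel_a c.1

/-- The filters and ideals of a lattice form a Dunn–Hartonas space. -/
theorem isDH (h : DHRep R a b) : IsDH R where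
  coherent_left := h.left.isCoherent
  coherent_right := h.right.isCoherent
  lawson_left := inferInstance
  lawson_right := inferInstance
  interior := ⟨h.isClosed_image, fun _ => h.isClopen_bdia, h.swap.isClosed_image,
    fun _ => h.swap.isClopen_bdia⟩
  filter_image := h.isLatFilter_image
  filter_preimage := h.swap.isLatFilter_image
  le_left := h.le_left
  le_right := h.swap.le_left

end Lawson

variable {L' X' Y' : Type*} [Lattice L'] [BoundedOrder L'] [CompleteLattice X']
  [CompleteLattice Y'] {R' : X' → Y' → Prop} {a' : L' → X'} {b' : L' → Y'}

/-- The witness is the left adjoint of `f` at `x'`. If its filter met the ideal of `y`, some `φ c`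
with `c` in the filter of `x'` would lie in that ideal, putting `c` in the ideal of `g y` against
`x' R' g(y)`. -/
theorem exists_back [TopologicalSpace X] [Topology.IsLawson X] [TopologicalSpace X']
    [Topology.IsLawson X'] (h : DHRep R a b) (h' : DHRep R' a' b') (φ : BoundedLatticeHom L' L)
    {f : X → X'} {g : Y → Y'} (hf : ∀ c x, a' c ≤ f x ↔ a (φ c) ≤ x)
    (hg : ∀ c y, b' c ≤ g y ↔ b (φ c) ≤ y) (x' : X') (y : Y) (hR : R' x' (g y)) :
    ∃ x, R x y ∧ x' ≤ f x := by
  obtain ⟨-, l, gc, hl⟩ := h.left.isCohMap h'.left φ hf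
  refine ⟨l x', (h.rel _ _).2 fun d hd hdy => ?_, gc.le_u_l x'⟩
  obtain ⟨c, h1, h2⟩ := (hl d x').1 hd
  exact (h'.rel _ _).1 hR c h1 ((hg c y).2 (((h.b_le_iff _ _).2 h2).trans hdy))

/-- The maps of filters and ideals induced by a lattice homomorphism form a morphism. -/
theorem isDHHom [TopologicalSpace X] [Topology.IsLawson X] [TopologicalSpace X']
    [Topology.IsLawson X'] [TopologicalSpace Y] [Topology.IsLawson Y] [TopologicalSpace Y']
    [Topology.IsLawson Y'] (h : DHRep R a b) (h' : DHRep R' a' b') (φ : BoundedLatticeHom L' L)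
    {f : X → X'} {g : Y → Y'} (hf : ∀ c x, a' c ≤ f x ↔ a (φ c) ≤ x)
    (hg : ∀ c y, b' c ≤ g y ↔ b (φ c) ≤ y) : IsDHHom R R' f g where
  coh_left := (h.left.isCohMap h'.left φ hf).1
  coh_right := (h.right.isCohMap h'.right (BoundedLatticeHom.dual φ) fun c y => hg c y).1
  forth x y hxy := (h'.rel _ _).2 fun c h1 h2 =>
    (h.rel _ _).1 hxy (φ c) ((hf c x).1 h1) ((hg c y).1 h2)
  back_left := h.exists_back h' φ hf hg
  back_right x y' := h.swap.exists_back h'.swap (BoundedLatticeHom.dual φ)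
    (fun c y => hg c y) (fun c x => hf c x) y' x

end DHRep

namespace DH

variable (D : DH.{u})

instance : Topology.IsLawson D.X := D.isDH.lawson_left

instance : Topology.IsLawson D.Y := D.isDH.lawson_right

variable {D}

/-- The least element of a clopen filter. -/
def gen (F : D.CLF) : D.X := sInf F.1

/-- The least element of the filter `-R[F]` associated with a clopen filter `F`. -/
def cogen (F : D.CLF) : D.Y := sInf {y | ¬ D.R (gen F) y}

theorem gen_spec (F : D.CLF) : IsCompactElement (gen F) ∧ F.1 = Set.Ici (gen F) := by
  obtain ⟨k, hk, hF⟩ := exists_compact_of_clopen_filter F.2.1 F.2.2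
  have : gen F = k := by rw [gen, hF, csInf_Ici]
  rw [this]
  exact ⟨hk, hF⟩

theorem mem_iff (F : D.CLF) (x : D.X) : x ∈ F.1 ↔ gen F ≤ x := by
  rw [(gen_spec F).2]
  rfl

/-- As `R` is antitone in its first argument, the image of the least element of `F` is the image of
all of `F`, hence clopen. Its complement is a clopen filter, so it is principal on a compact
element. -/
theorem cogen_spec (F : D.CLF) : IsCompactElement (cogen F) ∧
    {y | ¬ D.R (gen F) y} = Set.Ici (cogen F) := by
  have hcl : IsClopen {y | ¬ D.R (gen F) y} := by
    have : {y | ¬ D.R (gen F) y} = (bdia D.R F.1)ᶜ := by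
      refine Set.ext fun y => not_congr ⟨fun hy => ⟨_, hy, (mem_iff F _).2 le_rfl⟩, ?_⟩
      rintro ⟨x, hx, hxF⟩
      by_contra hn
      exact (D.isDH.filter_preimage y).upper ((mem_iff F x).1 hxF) hn hx
    rw [this]
    exact (D.isDH.interior.clopen_image _ F.2.2).compl
  obtain ⟨k, hk, hF⟩ := exists_compact_of_clopen_filter (D.isDH.filter_image _) hcl
  have : cogen F = k := by rw [cogen, hF, csInf_Ici]
  rw [this]
  exact ⟨hk, hF⟩

theorem cogen_le_iff (F : D.CLF) (y : D.Y) : cogen F ≤ y ↔ ¬ D.R (gen F) y :=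
  (Set.ext_iff.1 (cogen_spec F).2 y).symm

theorem gen_le_iff (F G : D.CLF) : gen F ≤ gen G ↔ G ≤ F := by
  rw [← mem_iff]
  exact ⟨fun h x hx => F.2.1.upper ((mem_iff G x).1 hx) h, fun h => h ((mem_iff G _).2 le_rfl)⟩

/-- A clopen filter with a prescribed least element. -/
theorem exists_gen {k : D.X} (hk : IsCompactElement k) : ∃ F : D.CLF, gen F = k :=
  ⟨⟨Set.Ici k, isLatFilter_Ici k, isClopen_Ici_of_compact hk⟩, csInf_Ici⟩

/-- The points unrelated to a compact `l` form a clopen filter `F`; `le_right` then identifies `l`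
with `cogen F`. -/
theorem exists_cogen {l : D.Y} (hl : IsCompactElement l) : ∃ F : D.CLF, cogen F = l := by
  have hcl : IsClopen {x | ¬ D.R x l} := by
    have : {x | ¬ D.R x l} = (dia D.R (Set.Ici l))ᶜ := by
      refine Set.ext fun x => not_congr ⟨fun hx => ⟨_, hx, le_rfl⟩, ?_⟩
      rintro ⟨y, hy, hly⟩
      by_contra hn
      exact (D.isDH.filter_image x).upper hly hn hy
    rw [this]
    exact (D.isDH.interior.clopen_preimage _ (isClopen_Ici_of_compact hl)).compl
  let F : D.CLF := ⟨{x | ¬ D.R x l}, D.isDH.filter_preimage l, hcl⟩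
  refine ⟨F, le_antisymm ((cogen_le_iff F l).2 ((mem_iff F _).2 le_rfl)) ?_⟩
  refine D.isDH.le_right _ _ fun x hx => ?_
  by_contra hn
  exact (D.isDH.filter_preimage (cogen F)).upper ((mem_iff F x).1 hn)
    ((cogen_le_iff F _).1 le_rfl) hx

theorem cohRep_gen (D : DH.{u}) : CohRep (gen : D.CLF → D.X) where
  le_iff := gen_le_iff
  compact F := (gen_spec F).1
  le_of x y H := by
    have := D.isDH.coherent_left.algebraic
    obtain ⟨s, hs, rfl⟩ := IsCompactlyGenerated.exists_sSup_eq x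
    refine sSup_le fun k hk => ?_
    obtain ⟨F, rfl⟩ := exists_gen (hs k hk)
    exact H F (le_sSup hk)
  inf_le F G := (mem_iff (F ⊓ G) _).1 ⟨(mem_iff F _).2 le_sup_left, (mem_iff G _).2 le_sup_right⟩
  top_le := sInf_le trivial

/-- A Dunn–Hartonas space is the space of filters and ideals of its lattice of clopen filters. -/
theorem dhRep (D : DH.{u}) : DHRep D.R (gen : D.CLF → D.X) cogen where
  left := cohRep_gen D
  right :=
    { le_iff := fun F G => by
        change cogen (D := D) F ≤ cogen (D := D) G ↔ F.ofDual ≤ G.ofDual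
        rw [← gen_le_iff (D := D)]
        refine ⟨fun h => D.isDH.le_left _ _ fun y hy => ?_, fun h => ?_⟩
        · by_contra hn
          exact (cogen_le_iff F.ofDual y).1 (h.trans ((cogen_le_iff G.ofDual y).2 hn)) hy
        · refine (cogen_le_iff F.ofDual _).2 ?_
          have h1 := (cogen_le_iff G.ofDual _).1 le_rfl
          exact (D.isDH.filter_preimage (cogen G.ofDual)).upper h h1
      compact := fun F => (cogen_spec (D := D) F).1
      le_of := fun x y H => by
        have := D.isDH.coherent_right.algebraic
        obtain ⟨s, hs, rfl⟩ := IsCompactlyGenerated.exists_sSup_eq x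
        refine sSup_le fun k hk => ?_
        obtain ⟨F, rfl⟩ := exists_cogen (hs k hk)
        exact H F (le_sSup hk)
      inf_le := fun F G => by
        change cogen (D := D) (F.ofDual ⊔ G.ofDual) ≤ cogen (D := D) F ⊔ cogen (D := D) G
        rw [cogen_le_iff]
        -- The join of two clopen filters has its least element above `gen F ⊓ gen G`, and the
        -- points unrelated to a fixed one are closed under meets.
        refine (D.isDH.filter_preimage _).upper (a := gen F.ofDual ⊓ gen G.ofDual)
          (le_sInf ?_) ((D.isDH.filter_preimage _).inf_mem _ ?_ _ ?_)
        · rintro z ⟨w, hw, w', hw', hz⟩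
          exact (inf_le_inf ((mem_iff F.ofDual w).1 hw) ((mem_iff G.ofDual w').1 hw')).trans hz
        · exact (cogen_le_iff F.ofDual _).1 le_sup_left
        · exact (cogen_le_iff G.ofDual _).1 le_sup_right
      top_le := by
        change cogen (⊥ : D.CLF) ≤ ⊥
        rw [cogen_le_iff]
        have h1 : gen (⊥ : D.CLF) = ⊤ := csInf_Ici
        rw [h1]
        exact (D.isDH.filter_preimage _).top_mem }
  rel x y := by
    constructor
    · intro hxy F h1 h2
      exact (D.isDH.filter_preimage y).upper h1 ((cogen_le_iff F y).1 h2) hxy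
    · intro H
      by_contra hn
      -- The set of points unrelated to `y` is open because `R⁻¹[y]` is closed, so it contains a
      -- compact element below `x`.
      obtain ⟨F, h1, h2⟩ := (cohRep_gen D).exists_mem_open
        (D.isDH.interior.closed_preimage y).isOpen_compl (show x ∈ {x | D.R x y}ᶜ from hn)
      exact H F h1 ((cogen_le_iff F y).2 h2)

theorem gen_le_map_iff {D E : DH.{u}} (h : D ⟶ E) (F : E.CLF) (x : D.X) :
    gen F ≤ h.f x ↔ gen (latMap h F) ≤ x := by
  rw [← mem_iff, ← mem_iff]
  rfl

theorem cogen_le_map_iff {D E : DH.{u}} (h : D ⟶ E) (F : E.CLF) (y : D.Y) :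
    cogen F ≤ h.g y ↔ cogen (latMap h F) ≤ y :=
  (dhRep D).le_map_iff (dhRep E) h.isHom (gen_le_map_iff h) F y

end DH


/-! ### The functor `𝔻` is well defined -/

/-- Order-theoretic compactness of `u c` comes from compactness of `Z`: if no member of a directed
family of stable sets lies inside `u c`, the sets `D ∩ v c` are nonempty, closed and downward
directed, so they share a point, which contradicts that the intersection of the family lies in `u
c`. The remaining separation is `exists_sep_stable`. -/
theorem DiagRep.cohRep {L Z : Type*} [Lattice L] [BoundedOrder L] [TopologicalSpace Z]
    [CompactSpace Z] {le₁ le₂ : Z → Z → Prop} {u v : L → Set Z} (h : DiagRep le₁ le₂ u v)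
    (hv : ∀ c, IsClosed (v c)) (r₂ : ∀ x, le₂ x x) (hs : ∀ c, u c ∈ stableSets le₁ le₂) :
    @CohRep L _ _ _ (stableLattice r₂) fun c => ⟨u c, hs c⟩ := by
  let := stableLattice (le := le₁) r₂
  refine ⟨fun c d => h.polRep.u_subset_iff, fun c => ?_, fun D E H x hx => ?_, fun c d => ?_,
    fun x _ => (h.filt x).top_mem⟩
  · rw [CompleteLattice.isCompactElement_iff_le_of_directed_sSup_le]
    intro s hne hdir hle
    by_contra hcon
    push Not at hcon
    have : Nonempty s := hne.to_subtype
    have hcl : ∀ D : s, IsClosed (D.1.1 ∩ v c) := fun D => D.1.2.2.1.inter (hv c)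
    obtain ⟨z, hz⟩ := IsCompact.nonempty_iInter_of_directed_nonempty_isCompact_isClosed
      (fun D : s => D.1.1 ∩ v c) (by
        intro D E
        obtain ⟨F, hF, h1, h2⟩ := hdir D.1 D.2 E.1 E.2
        exact ⟨⟨F, hF⟩, Set.inter_subset_inter_left _ h1, Set.inter_subset_inter_left _ h2⟩) (by
        intro D
        by_contra hn
        refine hcon D.1 D.2 fun x hx => ?_
        have hψ : negDown le₁ (v c) = u c := h.swap.negDown_u c
        change x ∈ u c
        rw [← hψ]
        exact fun d hd hxd => hn ⟨d, D.1.2.1 x d hxd hx, hd⟩) (fun D => (hcl D).isCompact) hcl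
    rw [Set.mem_iInter] at hz
    refine h.disj z c (hle ?_) (hz ⟨_, hne.some_mem⟩).2
    rintro _ ⟨D, hD, rfl⟩
    exact (hz ⟨D, hD⟩).1
  · by_contra hn
    obtain ⟨c, h1, h2⟩ := h.exists_sep_stable hv D.2 hn
    exact h2 (H c h1 hx)
  · intro x hx
    have h1 := @le_sup_left {D // D ∈ stableSets le₁ le₂} _ ⟨u c, hs c⟩ ⟨u d, hs d⟩ x hx
    have h2 := @le_sup_right {D // D ∈ stableSets le₁ le₂} _ ⟨u c, hs c⟩ ⟨u d, hs d⟩ x hx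
    exact (h.filt x).inf_mem _ h1 _ h2

namespace Urq

/-- The element of `𝖫𝖢 𝒰` given by a member of the lattice. -/
def toLC {U : Urq.{u}} (C : U.L) : U.LC := ⟨C.1, C.2.1, C.2.2.2.1, C.2.2.1⟩

/-- The element of `𝖱𝖢 𝒰` given by a member of the lattice. -/
def toRC {U : Urq.{u}} (C : U.L) : U.RC :=
  ⟨U.phi C.1, isUp_negDown U.isUrq.trans₂ _, C.2.2.2.2, congrArg U.phi C.2.2.1⟩

instance (U : Urq.{u}) : Topology.IsLawson U.LC := ⟨rfl⟩

instance (U : Urq.{u}) : Topology.IsLawson U.RC := ⟨rfl⟩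

/-- `D` meets `E` exactly when the filter of `D` and the ideal of `E` are disjoint. For the
converse, a point realizing both lies in `D` and in `E`, since closed stable sets are intersections
of members of the lattice and of their images under `φ`, respectively. -/
theorem dhRep (U : Urq.{u}) : DHRep U.meets (toLC : U.L → U.LC) toRC := by
  have := U.isUrq.compact
  have hl : CohRep (toLC : U.L → U.LC) :=
    U.diagRep.cohRep (fun C => C.2.2.2.2) U.isUrq.refl₂ fun C => (toLC C).2
  have hr : CohRep (L := U.Lᵒᵈ) fun C => (toRC (OrderDual.ofDual C) : U.RC) :=
    U.diagRep.swap.cohRep (fun C => (OrderDual.ofDual C).2.2.2.1) U.isUrq.refl₁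
      fun C => (toRC (OrderDual.ofDual C)).2
  refine ⟨hl, hr, fun D E => ⟨?_, fun H => ?_⟩⟩
  · rintro ⟨z, hzD, hzE⟩ C hC hC'
    exact U.diagRep.disj z C (hC hzD) (hC' hzE)
  · have hI := hr.isLatFilter E
    obtain ⟨z, h1, h2⟩ := U.diagRep.rich _ {C | toRC C ≤ E} (hl.isLatFilter D)
      ⟨hI.nonempty, fun _ _ hab ha => hI.upper hab ha, hI.inf_mem⟩ H
    refine ⟨z, ?_, ?_⟩
    · by_contra hn
      obtain ⟨C, h3, h4⟩ := U.diagRep.exists_sep_stable (fun C => C.2.2.2.2) D.2 hn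
      exact h4 (h1 C h3)
    · by_contra hn
      obtain ⟨C, h3, h4⟩ := U.diagRep.swap.exists_sep_stable
        (fun C => (OrderDual.ofDual C).2.2.2.1) E.2 hn
      exact h4 (h2 (OrderDual.ofDual C) h3)

/-- The defining intersection is the join of the pullback along `latMap h` of the filter of `D`; by
compactness of principal elements no further member of the lattice contains it. -/
theorem toLC_le_map_iff {U V : Urq.{u}} (h : U ⟶ V) (C : V.L) (D : U.LC) :
    toLC C ≤ mapLC h D ↔ toLC (latMap h C) ≤ D := by
  have hF := ((dhRep U).left.isLatFilter D).comap (latMap h)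
  refine ⟨fun hC => (((dhRep V).left.le_sSup_iff hF).1 (hC.trans ?_) :), fun hC => ?_⟩
  · refine Set.subset_sInter ?_
    rintro C' ⟨hC', hD⟩
    exact le_sSup (a := (toLC ⟨C', hC'⟩ : V.LC)) ⟨⟨C', hC'⟩, hD, rfl⟩
  · exact Set.sInter_subset_of_mem ⟨C.2, hC⟩

theorem toRC_le_map_iff {U V : Urq.{u}} (h : U ⟶ V) (C : V.L) (E : U.RC) :
    toRC C ≤ mapRC h E ↔ toRC (latMap h C) ≤ E := by
  have hF := ((dhRep U).right.isLatFilter E).comap (BoundedLatticeHom.dual (latMap h))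
  have key : ∀ C : V.L, toRC (latMap h C) ≤ E ↔ E.1 ⊆ box h.Q (V.phi C.1) := fun C => by
    rw [← h.isHom.neg_box C.1 C.2]
    rfl
  refine ⟨fun hC => (((dhRep V).right.le_sSup_iff hF).1 (hC.trans ?_) :), fun hC => ?_⟩
  · refine Set.subset_sInter ?_
    rintro _ ⟨C', hC', rfl, hD⟩
    exact le_sSup (a := (toRC ⟨C', hC'⟩ : V.RC))
      ⟨OrderDual.toDual ⟨C', hC'⟩, (key ⟨C', hC'⟩).2 hD, rfl⟩
  · exact Set.sInter_subset_of_mem ⟨C.1, C.2, rfl, (key C).1 hC⟩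

end Urq

/-- Elements of `𝖫𝖢` and `𝖱𝖢` are determined by the principal elements below them, so identities and
composites are inherited from the boxes on the lattices. -/
theorem dWellDefined : DWellDefined.{u} where
  obj U := U.dhRep.isDH
  map {U V} h := U.dhRep.isDHHom V.dhRep (Urq.latMap h) (Urq.toLC_le_map_iff h)
    (Urq.toRC_le_map_iff h)
  id_left U D := U.dhRep.left.ext fun C => by
    rw [Urq.toLC_le_map_iff]
    exact iff_of_eq (congrArg (fun C : U.L => Urq.toLC C ≤ D) (Subtype.ext (U.box_le₁ C.2)))
  id_right U E := U.dhRep.right.ext fun C => by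
    refine (Urq.toRC_le_map_iff (𝟙 U) (OrderDual.ofDual C) E).trans ?_
    exact iff_of_eq (congrArg (fun C : U.L => Urq.toRC C ≤ E)
      (Subtype.ext (U.box_le₁ (OrderDual.ofDual C).2)))
  comp_left {U V W} h k D := W.dhRep.left.ext fun C => by
    rw [Urq.toLC_le_map_iff, Urq.toLC_le_map_iff, Urq.toLC_le_map_iff]
    exact iff_of_eq (congrArg (fun C : U.L => Urq.toLC C ≤ D) (Subtype.ext (box_star _ _ C.2)))
  comp_right {U V W} h k E := W.dhRep.right.ext fun C => by
    refine (Urq.toRC_le_map_iff (h ≫ k) (OrderDual.ofDual C) E).trans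
      (Iff.trans ?_ (Urq.toRC_le_map_iff k (OrderDual.ofDual C) _).symm)
    rw [Urq.toRC_le_map_iff]
    exact iff_of_eq (congrArg (fun C : U.L => Urq.toRC C ≤ E)
      (Subtype.ext (box_star _ _ (OrderDual.ofDual C).2)))

/-! ### The functor `ℙ` is well defined -/

theorem pWellDefined : PWellDefined.{u} where
  obj U := (isPlo_of_isUrq U.isUrq).2.2
  map {U V} h := (isUrqHom_iff U.isUrq V.isUrq).1 h.isHom
  id_left U := (isPlo_of_isUrq U.isUrq).1.symm
  id_right U := (isPlo_of_isUrq U.isUrq).2.1.symm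
  comp_left {_ _ W} h k := congrArg (star h.P k.P) W.isUrq.closedSets_eq.symm
  comp_right {_ _ W} h k := (W.isUrq.costar_eq h.Q k.Q).symm

/-! ### The functor `𝕌` is well defined -/

/-- A separating family of closed Galois-stable sets of a compact polarity represents the lattice that
it forms. -/
theorem IsPolFamily.polRep_of_compact {X Y : Type*} [TopologicalSpace X] [TopologicalSpace Y]
    {R : X → Y → Prop} {Lf : Set (Set X)} (h : IsPolFamily R Lf)
    (sep : ∀ x y, ¬ R x y → ∃ U ∈ Lf, x ∈ U ∧ y ∉ bdia R U)
    (hK : IsCompact {p : X × Y | R p.1 p.2})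
    (hcl : ∀ U ∈ Lf, IsClosed U ∧ IsClosed (bdia R U)ᶜ) :
    letI := polLattice h
    letI := polBounded h
    PolRep R (fun U : {U : Set X // U ∈ Lf} => U.1) (fun U => (bdia R U.1)ᶜ) := by
  refine h.polRep sep fun F I hF hI hFL hIL hF2 hI2 hd => ?_
  have : Nonempty F := hF.to_subtype
  have : Nonempty I := hI.to_subtype
  by_contra hcon
  push Not at hcon
  -- Were there no suitable related pair, the directed closed sets indexed by `F × I` would have
  -- empty intersection inside `R`. Compactness would make one pair `(U, V)` already inconsistent,
  -- against `hd`.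
  obtain ⟨⟨U, V⟩, hi⟩ := hK.elim_directed_family_closed
    (fun i : F × I => {p : X × Y | p.1 ∈ i.1.1} ∩ {p | p.2 ∈ (bdia R i.2.1)ᶜ})
    (fun i => ((hcl _ (hFL i.1.2)).1.preimage continuous_fst).inter
      ((hcl _ (hIL i.2.2)).2.preimage continuous_snd)) (by
      rw [Set.eq_empty_iff_forall_notMem]
      rintro ⟨x, y⟩ ⟨hxy, hi⟩
      rw [Set.mem_iInter] at hi
      obtain ⟨V, hV, hyV⟩ := hcon x y hxy fun U hU => (hi (⟨U, hU⟩, Classical.arbitrary I)).1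
      exact (hi (Classical.arbitrary F, ⟨V, hV⟩)).2 hyV) (by
      rintro ⟨U, V⟩ ⟨U', V'⟩
      obtain ⟨W, hW, h1, h2⟩ := hI2 V.1 V.2 V'.1 V'.2
      exact ⟨(⟨_, hF2 U.1 U.2 U'.1 U'.2⟩, ⟨W, hW⟩),
        Set.inter_subset_inter (fun p hp => hp.1) fun p hp hpV => hp (bdia_mono _ h1 hpV),
        Set.inter_subset_inter (fun p hp => hp.2) fun p hp hpV => hp (bdia_mono _ h2 hpV)⟩)
  obtain ⟨x, y, h1, h2, h3⟩ := hd U.1 U.2 V.1 V.2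
  exact (Set.eq_empty_iff_forall_notMem.1 hi) (x, y) ⟨h1, h2, h3⟩

namespace Hg

/-- A Hartung space represents its lattice. -/
theorem polRep (H : Hg.{u}) : PolRep H.R (fun A : H.L => A.1) (fun A => (bdia H.R A.1)ᶜ) :=
  H.isHg.isPolFamily.polRep_of_compact H.isHg.sep H.isHg.compact fun _ hA => hA.2

theorem topX_eq (H : Hg.{u}) :
    H.topX = TopologicalSpace.generateFrom (Set.range fun A : H.L => A.1ᶜ) := by
  refine H.isHg.subbasis_left.trans (congrArg _ (Set.ext fun W => ⟨?_, ?_⟩))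
  · rintro ⟨A, hA, rfl⟩
    exact ⟨⟨A, hA⟩, rfl⟩
  · rintro ⟨A, rfl⟩
    exact ⟨A.1, A.2, rfl⟩

theorem topY_eq (H : Hg.{u}) :
    H.topY = TopologicalSpace.generateFrom (Set.range fun A : H.L => (bdia H.R A.1)ᶜᶜ) := by
  refine H.isHg.subbasis_right.trans (congrArg _ (Set.ext fun W => ⟨?_, ?_⟩))
  · rintro ⟨A, hA, rfl⟩
    exact ⟨⟨A, hA⟩, compl_compl _⟩
  · rintro ⟨A, rfl⟩
    exact ⟨A.1, A.2, compl_compl _⟩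

theorem diagRep (H : Hg.{u}) : DiagRep H.le₁ H.le₂ (fun A : H.L => {p : H.MaxPairs | p.1.1 ∈ A.1})
    (fun A => {p | p.1.2 ∈ (bdia H.R A.1)ᶜ}) :=
  H.polRep.diagRep_maxPairs H.isHg.antisymm_left H.isHg.antisymm_right

theorem isUrq (H : Hg.{u}) : urqSets H.le₁ H.le₂ =
    Set.range (fun A : H.L => {p : H.MaxPairs | p.1.1 ∈ A.1}) ∧ IsUrq H.le₁ H.le₂ :=
  H.diagRep.isUrq maxPairs_antisymm (induced_prod_generateFrom H.topX_eq H.topY_eq Subtype.val)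

theorem range_val (H : Hg.{u}) : Set.range (fun A : H.L => A.1) = closedSets H.R :=
  Subtype.range_coe

/-- Every morphism is the canonical pair of relations of its lattice map; composition laws and
faithfulness both rest on this. -/
theorem hom_eq {H K : Hg.{u}} (h : H ⟶ K) :
    h.S = canRel (fun A : H.L => A.1) (fun A : K.L => A.1) (latMap h) ∧
      h.T = canRel (fun A : H.L => (bdia H.R A.1)ᶜ) (fun A : K.L => (bdia K.R A.1)ᶜ) (latMap h) := by
  have hh : IsBoxHom H.R (Set.range fun A : H.L => A.1) K.R (Set.range fun A : K.L => A.1)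
      h.S h.T := by
    rw [range_val, range_val]
    exact h.isHom.toIsBoxHom
  exact hh.eq_canRel H.polRep K.polRep fun _ => rfl

theorem P_eq {H K : Hg.{u}} (h : H ⟶ K) : Hg.P h =
    canRel (fun A : H.L => {p : H.MaxPairs | p.1.1 ∈ A.1})
      (fun A : K.L => {p : K.MaxPairs | p.1.1 ∈ A.1}) (latMap h) := by
  funext p q
  exact congrFun (congrFun (hom_eq h).1 p.1.1) q.1.1

theorem Q_eq {H K : Hg.{u}} (h : H ⟶ K) : Hg.Q h =
    canRel (fun A : H.L => {p : H.MaxPairs | p.1.2 ∈ (bdia H.R A.1)ᶜ})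
      (fun A : K.L => {p : K.MaxPairs | p.1.2 ∈ (bdia K.R A.1)ᶜ}) (latMap h) := by
  funext p q
  exact congrFun (congrFun (hom_eq h).2 p.1.2) q.1.2

theorem box_P {H K : Hg.{u}} (h : H ⟶ K) (A : K.L) :
    box (Hg.P h) {p : K.MaxPairs | p.1.1 ∈ A.1} = {p : H.MaxPairs | p.1.1 ∈ (latMap h A).1} := by
  rw [P_eq]
  exact H.diagRep.polRep.box_canRel K.diagRep.polRep (latMap h) A

end Hg

theorem DiagRep.canRel_serial {L L' Z Z' : Type*} [Lattice L] [BoundedOrder L] [Lattice L']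
    [BoundedOrder L'] {le₁ le₂ : Z → Z → Prop} {u v : L → Set Z} {le₁' le₂' : Z' → Z' → Prop}
    {u' v' : L' → Set Z'} (h : DiagRep le₁ le₂ u v) (h' : DiagRep le₁' le₂' u' v')
    (φ : BoundedLatticeHom L' L) (z : Z) : ∃ z', canRel u u' φ z z' ∧ canRel v v' φ z z' :=
  h'.rich _ _ ((h.filt z).comap φ) ((h.idl z).comap φ) fun c => h.disj z (φ c)

/-- The relations induced by a lattice homomorphism form a morphism of Urquhart spaces. -/
theorem DiagRep.isUrqHom {L L' Z Z' : Type*} [Lattice L] [BoundedOrder L] [Lattice L']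
    [BoundedOrder L'] [TopologicalSpace Z] [TopologicalSpace Z'] {le₁ le₂ : Z → Z → Prop}
    {u v : L → Set Z} {le₁' le₂' : Z' → Z' → Prop} {u' v' : L' → Set Z'}
    (h : DiagRep le₁ le₂ u v) (h' : DiagRep le₁' le₂' u' v')
    (hU : urqSets le₁ le₂ = Set.range u ∧ IsUrq le₁ le₂)
    (hU' : urqSets le₁' le₂' = Set.range u' ∧ IsUrq le₁' le₂') (φ : BoundedLatticeHom L' L) :
    IsUrqHom le₁ le₂ le₁' le₂' (canRel u u' φ) (canRel v v' φ) := by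
  rw [isUrqHom_iff hU.2 hU'.2]
  refine ⟨?_, h.canRel_serial h' φ⟩
  rw [hU.2.closedSets_eq, hU'.2.closedSets_eq, hU.1, hU'.1]
  exact h.polRep.isBoxHom_canRel h'.polRep φ

theorem uWellDefined : UWellDefined.{u} where
  obj H := H.isUrq.2
  map {H K} h := by
    rw [Hg.P_eq, Hg.Q_eq]
    exact H.diagRep.isUrqHom K.diagRep H.isUrq K.isUrq (Hg.latMap h)
  comp_left {H K M} h k := by
    rw [M.isUrq.1, star_canRel (Hg.box_P h) (Hg.box_P k), Hg.P_eq]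
    exact congrArg (canRel _ _) (funext fun A => Subtype.ext (box_star _ _ A.2))
  comp_right {H K M} h k := by
    rw [← M.isUrq.2.costar_eq, M.isUrq.2.closedSets_eq, M.isUrq.1, costar_canRel
      (u'' := fun A : M.L => {p : M.MaxPairs | p.1.1 ∈ A.1}) M.diagRep.polRep.bdia_u
      (h := Hg.latMap h) (k := Hg.latMap k)
      (v := fun A : H.L => {p : H.MaxPairs | p.1.2 ∈ (bdia H.R A.1)ᶜ})
      (v' := fun A : K.L => {p : K.MaxPairs | p.1.2 ∈ (bdia K.R A.1)ᶜ}) ?_ ?_, Hg.Q_eq]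
    · exact congrArg (canRel _ _) (funext fun A => Subtype.ext (box_star _ _ A.2))
    · intro A
      rw [Hg.Q_eq]
      exact H.diagRep.polRep.dia_canRel K.diagRep.polRep (Hg.latMap h) A
    · intro A
      rw [Hg.Q_eq]
      exact K.diagRep.polRep.dia_canRel M.diagRep.polRep (Hg.latMap k) A


/-! ### Gehrke–van Gool spaces from representations -/

section Ordered

variable {L X : Type*} [Lattice L] [TopologicalSpace X] [CompactSpace X]
  [PartialOrder X] {u : L → Set X}

/-- Every clopen upset is a finite union of sets `u c`. -/
theorem exists_finset_of_clopen (hu : ∀ c, IsClopen (u c)) (hf : ∀ x, IsLatFilter {c | x ∈ u c})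
    (hle : ∀ x x', x ≤ x' ↔ ∀ c, x ∈ u c → x' ∈ u c) {U : Set X} (hU : IsClopen U)
    (hup : IsUpperSet U) : ∃ t : Finset L, U = ⋃ c ∈ t, u c := by
  have key : ∀ x ∈ U, ∃ c, x ∈ u c ∧ u c ⊆ U := by
    intro x hx
    have : Nonempty {c // x ∈ u c} := (hf x).nonempty.to_subtype
    -- Every point outside the upset `U` fails to lie above `x`, so some `u c` containing `x`
    -- excludes it. The filter of `x` is directed, so a single `c` excludes the compact complement
    -- of `U`.
    obtain ⟨⟨c, hc⟩, hUc⟩ := hU.compl.1.isCompact.elim_directed_cover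
      (fun c : {c // x ∈ u c} => (u c.1)ᶜ) (fun c => (hu c.1).compl.2) (by
      intro x' hx'
      have hn : ¬ x ≤ x' := fun hle => hx' (hup hle hx)
      rw [hle] at hn
      push Not at hn
      obtain ⟨c, h1, h2⟩ := hn
      exact Set.mem_iUnion.2 ⟨⟨c, h1⟩, h2⟩) fun c d =>
        ⟨⟨c.1 ⊓ d.1, (hf x).inf_mem _ c.2 _ d.2⟩,
          Set.compl_subset_compl.2 fun z hz => (hf z).upper inf_le_left hz,
          Set.compl_subset_compl.2 fun z hz => (hf z).upper inf_le_right hz⟩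
    exact ⟨c, hc, Set.compl_subset_compl.1 hUc⟩
  classical
  obtain ⟨t, ht⟩ := hU.1.isCompact.elim_finite_subcover (fun c : {c // u c ⊆ U} => u c.1)
    (fun c => (hu c.1).2) fun x hx => by
      obtain ⟨c, h1, h2⟩ := key x hx
      exact Set.mem_iUnion.2 ⟨⟨c, h2⟩, h1⟩
  refine ⟨t.image Subtype.val, Set.Subset.antisymm (fun x hx => ?_) (fun x hx => ?_)⟩
  · obtain ⟨c, hc, hxc⟩ := Set.mem_iUnion₂.1 (ht hx)
    exact Set.mem_iUnion₂.2 ⟨c.1, Finset.mem_image_of_mem _ hc, hxc⟩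
  · obtain ⟨c, hc, hxc⟩ := Set.mem_iUnion₂.1 hx
    obtain ⟨d, -, rfl⟩ := Finset.mem_image.1 hc
    exact d.2 hxc

/-- The complements of the sets `u c` generate the topology of open downsets. -/
theorem openDownsets_eq {L : Type*} {u : L → Set X} (hu : ∀ c, IsClopen (u c))
    (hle : ∀ x x', x ≤ x' ↔ ∀ c, x ∈ u c → x' ∈ u c) :
    openDownsets X = TopologicalSpace.generateFrom (Set.range fun c => (u c)ᶜ) := by
  refine le_antisymm (le_generateFrom ?_) fun W hW => ?_
  · rintro _ ⟨c, rfl⟩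
    exact ⟨(hu c).compl.2, fun x y hyx hx hy => hx ((hle y x).1 hyx c hy)⟩
  · have hWo : IsOpen W ∧ IsLowerSet W := hW
    have key : ∀ x : W, ∃ t : Finset L, x.1 ∈ ⋂ c ∈ t, (u c)ᶜ ∧ ⋂ c ∈ t, (u c)ᶜ ⊆ W := by
      intro x
      classical
      obtain ⟨t, ht⟩ := hWo.1.isClosed_compl.isCompact.elim_finite_subcover
        (fun c : {c // x.1 ∉ u c} => u c.1) (fun c => (hu c.1).2) fun x' hx' => by
          have hn : ¬ x' ≤ x.1 := fun hle => hx' (hWo.2 hle x.2)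
          rw [hle] at hn
          push Not at hn
          obtain ⟨c, h1, h2⟩ := hn
          exact Set.mem_iUnion.2 ⟨⟨c, h2⟩, h1⟩
      refine ⟨t.image Subtype.val, Set.mem_iInter₂.2 fun c hc => ?_, fun z hz => ?_⟩
      · obtain ⟨d, -, rfl⟩ := Finset.mem_image.1 hc
        exact d.2
      · by_contra hn
        obtain ⟨c, hc, hxc⟩ := Set.mem_iUnion₂.1 (ht hn)
        exact Set.mem_iInter₂.1 hz c.1 (Finset.mem_image_of_mem _ hc) hxc
    choose t ht1 ht2 using key
    have : W = ⋃ x, ⋂ c ∈ t x, (u c)ᶜ :=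
      Set.Subset.antisymm (fun x hx => Set.mem_iUnion.2 ⟨⟨x, hx⟩, ht1 _⟩) (Set.iUnion_subset ht2)
    rw [this]
    let _ := TopologicalSpace.generateFrom (Set.range fun c => (u c)ᶜ)
    exact isOpen_iUnion fun x => (t x).finite_toSet.isOpen_biInter fun c _ =>
      TopologicalSpace.GenerateOpen.basic _ ⟨c, rfl⟩

end Ordered

namespace PolRep

variable {L X Y : Type*} [Lattice L] [BoundedOrder L] {R : X → Y → Prop} {u : L → Set X}
  {v : L → Set Y}

theorem v_finset_sup (h : PolRep R u v) (t : Finset L) : v (t.sup id) = ⋂ c ∈ t, v c :=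
  Set.Subset.antisymm (Set.subset_iInter₂ fun _ hc => h.v_anti (Finset.le_sup (f := id) hc))
    fun y hy => (h.idl y).finset_sup_mem t _ fun c hc => Set.mem_iInter₂.1 hy c hc

/-- `◆` preserves unions and `v` turns finite joins into intersections. Hence `◆` of a finite union
is the complement of a single `v`, which gives the clopen conditions of a Gehrke–van Gool space. -/
theorem bdia_biUnion (h : PolRep R u v) (t : Finset L) :
    bdia R (⋃ c ∈ t, u c) = (v (t.sup id))ᶜ := by
  rw [h.v_finset_sup]
  ext y
  have key : ∀ c, y ∈ bdia R (u c) ↔ y ∉ v c := fun c => by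
    rw [h.bdia_u]
    rfl
  simp only [Set.mem_compl_iff, Set.mem_iInter, not_forall, exists_prop]
  constructor
  · rintro ⟨x, hx, hxt⟩
    obtain ⟨c, hc, hxc⟩ := Set.mem_iUnion₂.1 hxt
    exact ⟨c, hc, (key c).1 ⟨x, hx, hxc⟩⟩
  · rintro ⟨c, hc, hy⟩
    obtain ⟨x, hx, hxc⟩ := (key c).2 hy
    exact ⟨x, hx, Set.mem_iUnion₂.2 ⟨c, hc, hxc⟩⟩

theorem box_compl_biUnion (h : PolRep R u v) (t : Finset L) :
    box R (⋃ c ∈ t, v c)ᶜ = u (t.inf id) := by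
  have h1 := h.swap.bdia_biUnion t
  have h2 : dia R (⋃ c ∈ t, v c) = (u (t.inf id))ᶜ := h1
  have h3 := dia_compl R (⋃ c ∈ t, v c)ᶜ
  rw [compl_compl, h2] at h3
  exact (compl_injective h3).symm

variable [TopologicalSpace X] [CompactSpace X] [PartialOrder X] [TopologicalSpace Y]
  [CompactSpace Y] [PartialOrder Y]

/-- A representation by compact ordered spaces, such that the sets `u c` and `v c` are clopen and
determine the orders, is a Gehrke–van Gool space if it satisfies the two regularity conditions. -/
theorem isGvG (h : PolRep R u v) (hu : ∀ c, IsClopen (u c)) (hv : ∀ c, IsClopen (v c))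
    (hX : ∀ x x', x ≤ x' ↔ ∀ c, x ∈ u c → x' ∈ u c) (hY : ∀ y y', y ≤ y' ↔ ∀ c, y ∈ v c → y' ∈ v c)
    (hl : ∀ t : Finset L, maxLeft R ∩ u (t.sup id) ⊆ ⋃ c ∈ t, u c →
      u (t.sup id) ⊆ ⋃ c ∈ t, u c)
    (hr : ∀ t : Finset L, maxRight R ∩ v (t.inf id) ⊆ ⋃ c ∈ t, v c →
      v (t.inf id) ⊆ ⋃ c ∈ t, v c) : gvgSets R = Set.range u ∧ IsGvG R := by
  have hupX : ∀ c, IsUpperSet (u c) := fun c x x' hxx' hx => (hX x x').1 hxx' c hx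
  have hupY : ∀ c, IsUpperSet (v c) := fun c x x' hxx' hx => (hY x x').1 hxx' c hx
  have cX : ∀ U : Set X, IsClopen U → IsUpperSet U → ∃ t : Finset L, U = ⋃ c ∈ t, u c :=
    fun U => exists_finset_of_clopen hu h.filt hX
  have cY : ∀ V : Set Y, IsClopen V → IsLowerSet V → ∃ t : Finset L, V = (⋃ c ∈ t, v c)ᶜ := by
    intro V hV hVl
    obtain ⟨t, ht⟩ := exists_finset_of_clopen (L := Lᵒᵈ) (u := fun c => v (OrderDual.ofDual c)) hv
      h.swap.filt hY hV.compl hVl.compl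
    exact ⟨t, (compl_eq_comm.1 ht).symm⟩
  have hmem : ∀ c, u c ∈ gvgSets R := fun c => ⟨hu c, hupX c, h.box_bdia c⟩
  have hsets : gvgSets R = Set.range u := by
    ext U
    refine ⟨fun ⟨h1, h2, h3⟩ => ?_, by rintro ⟨c, rfl⟩; exact hmem c⟩
    obtain ⟨t, rfl⟩ := cX U h1 h2
    exact ⟨t.sup id, by rw [← h.box_v, ← h.bdia_biUnion, h3]⟩
  refine ⟨hsets, inferInstance, ⟨fun {x y} hxy => ?_⟩, inferInstance, ⟨fun {x y} hxy => ?_⟩,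
    fun x x' => (hX x x').trans h.leX_iff.symm, fun y y' => (hY y y').trans h.leY_iff.symm,
    fun U h1 h2 => ?_, fun V h1 h2 => ?_, fun x y hxy => ?_, fun U h1 h2 h3 => ?_,
    fun V h1 h2 h3 => ?_⟩
  · rw [hX] at hxy
    push Not at hxy
    obtain ⟨c, h1, h2⟩ := hxy
    exact ⟨u c, hu c, hupX c, h1, h2⟩
  · rw [hY] at hxy
    push Not at hxy
    obtain ⟨c, h1, h2⟩ := hxy
    exact ⟨v c, hv c, hupY c, h1, h2⟩
  · obtain ⟨t, rfl⟩ := cX U h1 h2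
    rw [h.bdia_biUnion]
    exact ⟨(hv _).compl, (hupY _).compl⟩
  · obtain ⟨t, rfl⟩ := cY V h1 h2
    rw [h.box_compl_biUnion]
    exact ⟨hu _, hupX _⟩
  · rw [h.rel] at hxy
    push Not at hxy
    obtain ⟨c, h1, h2⟩ := hxy
    refine ⟨u c, hmem c, h1, ?_⟩
    rw [h.bdia_u]
    exact fun hn => hn h2
  · obtain ⟨t, rfl⟩ := cX U h1 h2
    refine Set.Subset.antisymm (subset_box_bdia R _) ?_
    -- The stable closure of the finite union over `t` is `u (t.sup id)`, which turns the regularity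
    -- axiom into `hl`.
    rw [h.bdia_biUnion, h.box_v] at h3 ⊢
    exact hl t h3
  · obtain ⟨t, rfl⟩ := cY V h1 h2
    rw [h.box_compl_biUnion, h.bdia_u] at h3 ⊢
    refine Set.Subset.antisymm (Set.compl_subset_compl.2 (hr t ?_)) (Set.compl_subset_compl.2 ?_)
    · rintro y ⟨hy1, hy2⟩
      by_contra hn
      exact h3 ⟨hy1, hn⟩ hy2
    · exact Set.iUnion₂_subset fun c hc => h.v_anti (Finset.inf_le (f := id) hc)

end PolRep

/-! ### d-prime elements -/

namespace CohRep

variable {L X : Type*} [Lattice L] [BoundedOrder L] [CompleteLattice X] {a : L → X}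

theorem map_inf (h : CohRep a) (c d : L) : a (c ⊓ d) = a c ⊔ a d :=
  le_antisymm (h.inf_le c d) (sup_le ((h.le_iff _ _).2 inf_le_left) ((h.le_iff _ _).2 inf_le_right))

theorem map_finset_sup (h : CohRep a) {ι : Type*} (t : Finset ι) (f : ι → L) :
    a (t.sup f) = t.inf fun i => a (f i) := by
  classical
  induction t using Finset.induction_on with
  | empty => simp [h.map_bot]
  | insert i t _ ih => rw [Finset.sup_insert, Finset.inf_insert, h.map_sup, ih]

/-- The elements of a filter lattice that are d-prime are the filters that are prime with respect to
distributive finite joins. -/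
theorem isDPrime_iff (h : CohRep a) (x : X) : IsDPrime x ↔ ∀ t : Finset L,
    (∀ d, d ⊓ t.sup id ≤ t.sup fun c => d ⊓ c) → a (t.sup id) ≤ x → ∃ c ∈ t, a c ≤ x := by
  classical
  -- The compact elements are the principal ones and `a` turns finite joins into finite meets, so
  -- distributive finite meets of compact elements correspond to distributive finite joins in `L`.
  have hinf : ∀ t : Finset L, (t.image a).inf id = a (t.sup id) := fun t => by
    rw [h.map_finset_sup, Finset.inf_image]
    rfl
  have hdist : ∀ t : Finset L, (∀ k, IsCompactElement k →
      k ⊔ (t.image a).inf id = (t.image a).inf fun m => k ⊔ m) ↔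
      ∀ d, d ⊓ t.sup id ≤ t.sup fun c => d ⊓ c := by
    intro t
    have key : ∀ d, (a d ⊔ (t.image a).inf id = (t.image a).inf fun m => a d ⊔ m) ↔
        d ⊓ t.sup id ≤ t.sup fun c => d ⊓ c := by
      intro d
      have : ((t.image a).inf fun m => a d ⊔ m) = a (t.sup fun c => d ⊓ c) := by
        rw [h.map_finset_sup, Finset.inf_image]
        exact Finset.inf_congr rfl fun c _ => (h.map_inf d c).symm
      rw [this, hinf, ← h.map_inf]
      refine ⟨fun e => (h.le_iff _ _).1 e.ge, fun e => le_antisymm ((h.le_iff _ _).2 ?_)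
        ((h.le_iff _ _).2 e)⟩
      exact Finset.sup_le fun c hc => inf_le_inf_left d (Finset.le_sup (f := id) hc)
    refine ⟨fun H d => (key d).1 (H _ (h.compact d)), fun H k hk => ?_⟩
    obtain ⟨d, rfl⟩ := h.exists_eq hk
    exact (key d).2 (H d)
  constructor
  · rintro ⟨-, H⟩ t ht hx
    obtain ⟨m, hm, hmx⟩ := H (t.image a) (by
      intro m hm
      obtain ⟨c, -, rfl⟩ := Finset.mem_image.1 hm
      exact h.compact c) ((hdist t).2 ht) (by rwa [hinf])
    obtain ⟨c, hc, rfl⟩ := Finset.mem_image.1 hm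
    exact ⟨c, hc, hmx⟩
  · intro H
    refine ⟨?_, fun M hM hd hx => ?_⟩
    · rintro rfl
      -- The empty join is `⊥` and `a ⊥ = ⊤`, so the case `t = ∅` is what excludes the top element.
      obtain ⟨c, hc, -⟩ := H ∅ (by simp) le_top
      simp at hc
    · choose! f hf using fun m hm => h.exists_eq (hM m hm)
      have hMt : (M.image f).image a = M := by
        rw [Finset.image_image]
        exact (Finset.image_congr fun m hm => hf m hm).trans Finset.image_id'
      rw [← hMt] at hd hx
      rw [hinf] at hx
      obtain ⟨c, hc, hcx⟩ := H _ ((hdist _).1 hd) hx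
      exact ⟨a c, hMt ▸ Finset.mem_image_of_mem a hc, hcx⟩

/-- By `isDPrime_iff`, d-primeness is a conjunction of conditions "`a` of the join lies below `x`
only if some `a c` does", each clopen in the Lawson topology. Compactness of the d-prime part
follows. -/
theorem isClosed_dPrime [TopologicalSpace X] [Topology.IsLawson X] (h : CohRep a) :
    IsClosed {x : X | IsDPrime x} := by
  have : {x : X | IsDPrime x} = ⋂ t : {t : Finset L // ∀ d, d ⊓ t.sup id ≤ t.sup fun c => d ⊓ c},
      (Set.Ici (a (t.1.sup id)))ᶜ ∪ ⋃ c ∈ t.1, Set.Ici (a c) := by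
    ext x
    simp only [Set.mem_ofPred_eq, h.isDPrime_iff, Set.mem_iInter, Set.mem_union, Set.mem_compl_iff,
      Set.mem_Ici, Set.mem_iUnion, exists_prop, Subtype.forall, ← imp_iff_not_or]
  rw [this]
  exact isClosed_iInter fun t => (h.isClopen_Ici _).compl.1.union
    (t.1.finite_toSet.isClosed_biUnion fun c _ => (h.isClopen_Ici c).1)

/-- Joining with a principal element adjoins `c` to the filter of `x`, and the generated filter
consists of the elements above some `f ⊓ c`. -/
theorem le_sup_iff (h : CohRep a) (c d : L) (x : X) :
    a d ≤ x ⊔ a c ↔ ∃ f, a f ≤ x ∧ f ⊓ c ≤ d := by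
  have hx := h.isLatFilter x
  have hF : IsLatFilter {d | ∃ f, a f ≤ x ∧ f ⊓ c ≤ d} := by
    refine ⟨⟨⊤, ⊤, hx.top_mem, le_top⟩, ?_, ?_⟩
    · rintro d e hde ⟨f, h1, h2⟩
      exact ⟨f, h1, h2.trans hde⟩
    · rintro d ⟨f, h1, h2⟩ d' ⟨f', h3, h4⟩
      exact ⟨f ⊓ f', hx.inf_mem _ h1 _ h3, le_inf ((inf_le_inf_right c inf_le_left).trans h2)
        ((inf_le_inf_right c inf_le_right).trans h4)⟩
  constructor
  · intro hd
    refine (h.le_sSup_iff hF).1 (hd.trans (sup_le (h.le_of _ _ fun f hf => ?_) ?_))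
    · exact (h.le_sSup_iff hF).2 ⟨f, hf, inf_le_left⟩
    · exact (h.le_sSup_iff hF).2 ⟨⊤, hx.top_mem, inf_le_right⟩
  · rintro ⟨f, h1, h2⟩
    refine ((h.le_iff _ _).2 h2).trans ((h.inf_le f c).trans (sup_le_sup_right h1 _))

end CohRep

namespace DHRep

variable {L X Y : Type*} [Lattice L] [BoundedOrder L] [CompleteLattice X]
  [CompleteLattice Y] {R : X → Y → Prop} {a : L → X} {b : L → Y}

/-- A filter that is maximal among those disjoint from a given ideal is d-prime. -/
theorem isDPrime_of_max (h : DHRep R a b) {x : X} {y : Y} (hxy : R x y)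
    (hmax : ∀ x', leX R x x' → R x' y → leX R x' x) : IsDPrime x := by
  rw [h.left.isDPrime_iff]
  intro t ht hx
  by_contra hcon
  push Not at hcon
  -- If `c` is outside the filter of `x`, maximality makes the filter generated by `x` and `c` meet
  -- the ideal of `y`. The witnesses are `f` in the filter and `d` in the ideal with `f ⊓ c ≤ d`.
  have key : ∀ c ∈ t, ∃ f d, a f ≤ x ∧ f ⊓ c ≤ d ∧ b d ≤ y := by
    intro c hc
    have hn : ¬ R (x ⊔ a c) y := fun hR => hcon c hc <| h.polRep.leX_iff.1
      (hmax (x ⊔ a c) (h.polRep.leX_iff.2 fun _ hd => le_trans hd le_sup_left) hR) c le_sup_right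
    rw [h.rel] at hn
    push Not at hn
    obtain ⟨d, h1, h2⟩ := hn
    obtain ⟨f, h3, h4⟩ := (h.left.le_sup_iff c d x).1 h1
    exact ⟨f, d, h3, h4, h2⟩
  choose! f d h1 h2 h3 using key
  refine (h.rel x y).1 hxy (t.sup d) ?_ ((h.polRep.idl y).finset_sup_mem t d h3)
  refine ((h.left.le_iff _ _).2 ?_).trans ((h.left.isLatFilter x).inf_mem _
    ((h.left.isLatFilter x).finset_inf_mem t f h1) _ hx)
  -- Distributivity of the join is used here: the meet of all `f c` with the join of `t` lies in the
  -- filter of `x` and is below the join of all `d c`, which is in the ideal of `y`.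
  refine (ht _).trans (Finset.sup_le fun c hc => ?_)
  exact (inf_le_inf_right c (Finset.inf_le hc)).trans ((h2 c hc).trans (Finset.le_sup hc))

/-- The d-prime filters and ideals represent the same lattice. -/
theorem polRep_prime (h : DHRep R a b) :
    PolRep (fun (x : {x : X // IsDPrime x}) (y : {y : Y // IsDPrime y}) => R x.1 y.1)
      (fun c => {x | a c ≤ x.1}) (fun c => {y | b c ≤ y.1}) where
  filt x := h.polRep.filt x.1
  idl y := h.polRep.idl y.1
  rel x y := h.rel x.1 y.1
  rich F I hF hI hd := by
    -- Pairs maximal for each other are d-prime on both sides, so restricting to d-prime elements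
    -- keeps enough points.
    obtain ⟨x, y, h1, h2, h3, h4, h5⟩ := h.polRep.exists_max_pair hF hI hd
    exact ⟨⟨x, h.isDPrime_of_max h1 h4⟩, ⟨y, h.swap.isDPrime_of_max h1 h5⟩, h1, h2, h3⟩

theorem prime_le_iff (h : DHRep R a b) (x x' : {x : X // IsDPrime x}) :
    x ≤ x' ↔ ∀ c, x ∈ {x : {x : X // IsDPrime x} | a c ≤ x.1} → x' ∈ {x | a c ≤ x.1} :=
  ⟨fun hx _ hc => le_trans hc hx, h.left.le_of x.1 x'.1⟩

/-- The covering hypothesis on maximal points forces the join of `t` to be distributive. If it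
failed at `d`, a maximal pair would separate `d ⊓ ⋁ t` from `⋁ (d ⊓ c)`; its filter contains `⋁ t`,
hence some `c ∈ t`, hence `d ⊓ c`, a contradiction. With the join distributive, d-primeness covers
all remaining points. -/
theorem regular_prime (h : DHRep R a b) (t : Finset L)
    (ht : maxLeft (fun (x : {x : X // IsDPrime x}) (y : {y : Y // IsDPrime y}) => R x.1 y.1) ∩
      {x | a (t.sup id) ≤ x.1} ⊆ ⋃ c ∈ t, {x | a c ≤ x.1}) :
    {x : {x : X // IsDPrime x} | a (t.sup id) ≤ x.1} ⊆ ⋃ c ∈ t, {x | a c ≤ x.1} := by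
  intro x hx
  have hdist : ∀ d, d ⊓ t.sup id ≤ t.sup fun c => d ⊓ c := by
    intro d
    by_contra hn
    obtain ⟨x, y, h1, h2, h3, h4, -⟩ := h.polRep_prime.exists_max_pair (isLatFilter_Ici _)
      (isLatIdeal_Iic (t.sup fun c => d ⊓ c)) fun e h1 h2 => hn (le_trans h1 h2)
    have hx := h2 _ le_rfl
    rw [h.polRep_prime.u_inf] at hx
    obtain ⟨c, hc, hcx⟩ := Set.mem_iUnion₂.1 (ht ⟨⟨y, h1, fun x' hx' hxx' => (h.prime_le_iff _ _).2
      (h.polRep_prime.leX_iff.1 (h4 x' (h.polRep_prime.leX_iff.2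
        ((h.prime_le_iff _ _).1 hxx')) hx'))⟩, hx.2⟩)
    refine (h.polRep_prime.rel x y).1 h1 _ (h.polRep_prime.u_mono
      (Finset.le_sup (f := fun c => d ⊓ c) hc) ?_) (h3 _ le_rfl)
    rw [h.polRep_prime.u_inf]
    exact ⟨hx.1, hcx⟩
  obtain ⟨c, hc, hcx⟩ := (h.left.isDPrime_iff x.1).1 x.2 t hdist hx
  exact Set.mem_iUnion₂.2 ⟨c, hc, hcx⟩

/-- The d-prime filters and ideals form a Gehrke–van Gool space. -/
theorem isGvG [TopologicalSpace X] [Topology.IsLawson X] [TopologicalSpace Y]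
    [Topology.IsLawson Y] (h : DHRep R a b) :
    gvgSets (fun (x : {x : X // IsDPrime x}) (y : {y : Y // IsDPrime y}) => R x.1 y.1) =
      Set.range (fun c => {x : {x : X // IsDPrime x} | a c ≤ x.1}) ∧
    IsGvG fun (x : {x : X // IsDPrime x}) (y : {y : Y // IsDPrime y}) => R x.1 y.1 := by
  have := h.left.compactSpace
  have := h.right.compactSpace
  have : CompactSpace {x : X // IsDPrime x} :=
    isCompact_iff_compactSpace.1 h.left.isClosed_dPrime.isCompact
  have : CompactSpace {y : Y // IsDPrime y} :=
    isCompact_iff_compactSpace.1 h.right.isClosed_dPrime.isCompact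
  exact h.polRep_prime.isGvG (fun c => (h.left.isClopen_Ici c).preimage continuous_subtype_val)
    (fun c => (h.right.isClopen_Ici c).preimage continuous_subtype_val) h.prime_le_iff
    h.swap.prime_le_iff h.regular_prime h.swap.regular_prime

end DHRep

/-! ### The functor `𝔾` is well defined -/

namespace DH

/-- The d-prime elements of `X` that belong to a clopen filter. -/
def uPrime {D : DH.{u}} (F : D.CLF) : Set {x : D.X // IsDPrime x} := {x | gen F ≤ x.1}

/-- The d-prime elements of `Y` that belong to the clopen filter of `Y` given by one of `X`. -/
def vPrime {D : DH.{u}} (F : D.CLF) : Set {y : D.Y // IsDPrime y} := {y | cogen F ≤ y.1}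

theorem polRep_prime (D : DH.{u}) : PolRep D.Rp (uPrime (D := D)) vPrime := D.dhRep.polRep_prime

theorem isGvG (D : DH.{u}) : gvgSets D.Rp = Set.range (uPrime (D := D)) ∧ IsGvG D.Rp :=
  D.dhRep.isGvG

theorem primeRel_f {D E : DH.{u}} (h : D ⟶ E) :
    primeRel h.f = canRel (uPrime (D := D)) (uPrime (D := E)) (latMap h) := by
  funext x x'
  refine propext ⟨fun hx F hF => le_trans ((gen_le_map_iff h F x.1).2 hF) hx, fun H => ?_⟩
  exact E.dhRep.left.le_of _ _ fun F hF => H F ((gen_le_map_iff h F x.1).1 hF)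

theorem primeRel_g {D E : DH.{u}} (h : D ⟶ E) :
    primeRel h.g = canRel (vPrime (D := D)) (vPrime (D := E)) (latMap h) := by
  funext x x'
  refine propext ⟨fun hx F hF => le_trans ((cogen_le_map_iff h F x.1).2 hF) hx, fun H => ?_⟩
  exact E.dhRep.right.le_of _ _ fun F hF => H F ((cogen_le_map_iff h F x.1).1 hF)

theorem box_primeRel {D E : DH.{u}} (h : D ⟶ E) (F : E.CLF) :
    box (primeRel h.f) (uPrime F) = uPrime (latMap h F) := by
  rw [primeRel_f]
  exact D.polRep_prime.box_canRel E.polRep_prime (latMap h) F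

theorem dia_primeRel {D E : DH.{u}} (h : D ⟶ E) (F : E.CLF) :
    dia (primeRel h.g) (vPrime F)ᶜ = (vPrime (latMap h F))ᶜ := by
  rw [primeRel_g]
  exact D.polRep_prime.dia_canRel E.polRep_prime (latMap h) F

end DH

/-- Once the relations are rewritten as `canRel` and the stable clopen upsets as a range, only the
general facts about representations remain; `hWellDefined` and `uWellDefined` follow the same
pattern. -/
theorem gWellDefined : GWellDefined.{u} where
  obj D := D.isGvG.2
  map {D E} h := by
    rw [DH.primeRel_f, DH.primeRel_g]
    refine ⟨?_, D.polRep_prime.canRel_compat E.polRep_prime (DH.latMap h)⟩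
    rw [D.isGvG.1, E.isGvG.1]
    exact D.polRep_prime.isBoxHom_canRel E.polRep_prime (DH.latMap h)
  comp_left {D E F} h k := by
    rw [F.isGvG.1, star_canRel (DH.box_primeRel h) (DH.box_primeRel k), DH.primeRel_f]
    rfl
  comp_right {D E F} h k := by
    rw [F.isGvG.1, costar_canRel F.polRep_prime.bdia_u (DH.dia_primeRel h) (DH.dia_primeRel k),
      DH.primeRel_g]
    rfl

/-! ### The functor `ℍ` is well defined -/

namespace GvG

/-- A Gehrke–van Gool space represents its lattice. -/
theorem polRep (G : GvG.{u}) : PolRep G.R (fun U : G.L => U.1) (fun U => (bdia G.R U.1)ᶜ) := by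
  have := G.isGvG.compact_left
  have := G.isGvG.compact_right
  have hcl : ∀ U ∈ gvgSets G.R, IsClopen U ∧ IsClopen (bdia G.R U)ᶜ := fun U hU =>
    ⟨hU.1, (G.isGvG.clopen_bdia U hU.1 hU.2.1).1.compl⟩
  refine G.isGvG.isPolFamily.polRep_of_compact G.isGvG.sep (IsClosed.isCompact ?_)
    fun U hU => ⟨(hcl U hU).1.1, (hcl U hU).2.1⟩
  -- The relation is closed in the compact product: a separating `U` yields the clopen rectangle of
  -- `U` and `-◆U`, which contains no related pair.
  rw [← isOpen_compl_iff, isOpen_iff_forall_mem_open]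
  rintro ⟨x, y⟩ hxy
  obtain ⟨U, hU, h1, h2⟩ := G.isGvG.sep x y hxy
  refine ⟨U ×ˢ (bdia G.R U)ᶜ, ?_, (hcl U hU).1.2.prod (hcl U hU).2.2, ⟨h1, h2⟩⟩
  rintro ⟨x', y'⟩ ⟨h3, h4⟩ h5
  exact h4 ⟨x', h5, h3⟩

theorem le_iff_left (G : GvG.{u}) (x x' : G.X) : x ≤ x' ↔ ∀ U : G.L, x ∈ U.1 → x' ∈ U.1 :=
  (G.isGvG.le_left x x').trans G.polRep.leX_iff

theorem le_iff_right (G : GvG.{u}) (y y' : G.Y) :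
    y ≤ y' ↔ ∀ U : G.L, y ∈ (bdia G.R U.1)ᶜ → y' ∈ (bdia G.R U.1)ᶜ :=
  (G.isGvG.le_right y y').trans G.polRep.leY_iff

/-- The points of `X₀` in a member of the lattice. -/
def uMax {G : GvG.{u}} (U : G.L) : Set G.X₀ := {x | x.1 ∈ U.1}

/-- The points of `Y₀` outside `◆U`. -/
def vMax {G : GvG.{u}} (U : G.L) : Set G.Y₀ := {y | y.1 ∈ (bdia G.R U.1)ᶜ}

/-- The two coordinates of a pair maximal for each other lie in `X₀` and `Y₀`, so `rich` is
inherited. -/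
theorem polRep_max (G : GvG.{u}) : PolRep G.R₀ (uMax (G := G)) vMax where
  filt x := G.polRep.filt x.1
  idl y := G.polRep.idl y.1
  rel x y := G.polRep.rel x.1 y.1
  rich F I hF hI hd := by
    obtain ⟨x, y, h1, h2, h3, h4, h5⟩ := G.polRep.exists_max_pair hF hI hd
    exact ⟨⟨x, y, h1, fun x' hx' hxx' => (G.isGvG.le_left _ _).2
      (h4 x' ((G.isGvG.le_left _ _).1 hxx') hx')⟩, ⟨y, x, h1, fun y' hy' hyy' =>
        (G.isGvG.le_right _ _).2 (h5 y' ((G.isGvG.le_right _ _).1 hyy') hy')⟩, h1, h2, h3⟩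

theorem top_X₀ (G : GvG.{u}) : (inferInstance : TopologicalSpace G.X₀) =
    TopologicalSpace.generateFrom (Set.range fun U : G.L => (uMax U)ᶜ) := by
  have := G.isGvG.compact_left
  change TopologicalSpace.induced Subtype.val (openDownsets G.X) = _
  rw [openDownsets_eq (u := fun U : G.L => U.1) (fun U => U.2.1) G.le_iff_left,
    induced_generateFrom_eq, ← Set.range_comp]
  rfl

theorem top_Y₀ (G : GvG.{u}) : (inferInstance : TopologicalSpace G.Y₀) =
    TopologicalSpace.generateFrom (Set.range fun U : G.L => (vMax U)ᶜ) := by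
  have := G.isGvG.compact_right
  change TopologicalSpace.induced Subtype.val (openDownsets G.Y) = _
  rw [openDownsets_eq (u := fun U : G.L => (bdia G.R U.1)ᶜ)
    (fun U => (G.isGvG.clopen_bdia U.1 U.2.1 U.2.2.1).1.compl) G.le_iff_right,
    induced_generateFrom_eq, ← Set.range_comp]
  rfl

theorem closedSets_R₀ (G : GvG.{u}) : closedSets G.R₀ = Set.range (uMax (G := G)) :=
  G.polRep_max.closedSets_eq G.top_X₀ G.top_Y₀

theorem isHg (G : GvG.{u}) : IsHg G.R₀ :=
  G.polRep_max.isHg G.top_X₀ G.top_Y₀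
    (fun _ _ h1 h2 => Subtype.ext (le_antisymm
      ((G.le_iff_left _ _).2 (G.polRep_max.leX_iff.1 h1))
      ((G.le_iff_left _ _).2 (G.polRep_max.leX_iff.1 h2))))
    (fun _ _ h1 h2 => Subtype.ext (le_antisymm
      ((G.le_iff_right _ _).2 (G.polRep_max.leY_iff.1 h1))
      ((G.le_iff_right _ _).2 (G.polRep_max.leY_iff.1 h2))))

theorem hom_eq {G H : GvG.{u}} (h : G ⟶ H) :
    h.S = canRel (fun U : G.L => U.1) (fun U : H.L => U.1) (latMap h) ∧
      h.T = canRel (fun U : G.L => (bdia G.R U.1)ᶜ) (fun U : H.L => (bdia H.R U.1)ᶜ) (latMap h) := by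
  have hr : ∀ K : GvG.{u}, Set.range (fun U : K.L => U.1) = gvgSets K.R :=
    fun _ => Subtype.range_coe
  have hh : IsBoxHom G.R (Set.range fun U : G.L => U.1) H.R (Set.range fun U : H.L => U.1)
      h.S h.T := by
    rw [hr, hr]
    exact h.isHom.toIsBoxHom
  exact hh.eq_canRel G.polRep H.polRep fun _ => rfl

theorem S₀_eq {G H : GvG.{u}} (h : G ⟶ H) :
    S₀ h = canRel (uMax (G := G)) (uMax (G := H)) (latMap h) := by
  funext x x'
  exact congrFun (congrFun (hom_eq h).1 x.1) x'.1

theorem T₀_eq {G H : GvG.{u}} (h : G ⟶ H) :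
    T₀ h = canRel (vMax (G := G)) (vMax (G := H)) (latMap h) := by
  funext y y'
  exact congrFun (congrFun (hom_eq h).2 y.1) y'.1

theorem box_S₀ {G H : GvG.{u}} (h : G ⟶ H) (U : H.L) : box (S₀ h) (uMax U) = uMax (latMap h U) := by
  rw [S₀_eq]
  exact G.polRep_max.box_canRel H.polRep_max (latMap h) U

theorem dia_T₀ {G H : GvG.{u}} (h : G ⟶ H) (U : H.L) :
    dia (T₀ h) (vMax U)ᶜ = (vMax (latMap h U))ᶜ := by
  rw [T₀_eq]
  exact G.polRep_max.dia_canRel H.polRep_max (latMap h) U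

end GvG

theorem hWellDefined : HWellDefined.{u} where
  obj G := G.isHg
  map {G H} h := by
    rw [GvG.S₀_eq, GvG.T₀_eq]
    refine ⟨?_, G.polRep_max.canRel_compat H.polRep_max (GvG.latMap h)⟩
    rw [G.closedSets_R₀, H.closedSets_R₀]
    exact G.polRep_max.isBoxHom_canRel H.polRep_max (GvG.latMap h)
  -- The restricted order and the order computed from `R₀` are both inclusion of the sets of lattice
  -- members containing a point.
  id_left G := by
    funext x x'
    exact propext ((G.le_iff_left x.1 x'.1).trans G.polRep_max.leX_iff.symm)
  id_right G := by
    funext y y'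
    exact propext ((G.le_iff_right y.1 y'.1).trans G.polRep_max.leY_iff.symm)
  comp_left {G H K} h k := by
    rw [K.closedSets_R₀, star_canRel (GvG.box_S₀ h) (GvG.box_S₀ k), GvG.S₀_eq]
    exact congrArg (canRel _ _) (funext fun U => Subtype.ext (box_star _ _ U.2))
  comp_right {G H K} h k := by
    rw [K.closedSets_R₀, costar_canRel K.polRep_max.bdia_u (GvG.dia_T₀ h) (GvG.dia_T₀ k),
      GvG.T₀_eq]
    exact congrArg (canRel _ _) (funext fun U => Subtype.ext (box_star _ _ U.2))


/-! ### The natural isomorphisms -/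

/-- A bijection onto a family of sets given as the range of an injective map. -/
noncomputable def equivOfRange {L X : Type*} {u : L → Set X} (hu : Function.Injective u)
    {s : Set (Set X)} (hs : s = Set.range u) : L ≃ {A // A ∈ s} :=
  Equiv.ofBijective (fun c => ⟨u c, hs ▸ ⟨c, rfl⟩⟩)
    ⟨fun _ _ h => hu (congrArg Subtype.val h), by
      rintro ⟨A, hA⟩
      obtain ⟨c, rfl⟩ : A ∈ Set.range u := hs ▸ hA
      exact ⟨c, rfl⟩⟩

namespace DH

/-- Clopen filters correspond to the stable clopen upsets of d-prime elements. -/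
noncomputable def primeIso (D : DH.{u}) : D.CLF ≃o ((functorG gWellDefined).obj D).L where
  toEquiv := equivOfRange D.polRep_prime.u_injective D.isGvG.1
  map_rel_iff' := D.polRep_prime.u_subset_iff

/-- The natural isomorphism `γ`. -/
noncomputable def primeNatIso : DH.latFunctor.{u} ≅ (functorG gWellDefined).op ⋙ GvG.latFunctor :=
  NatIso.ofComponents (fun D => BddLat.Iso.mk D.unop.primeIso) fun h =>
    BddLat.ext fun F => Subtype.ext (box_primeRel h.unop F).symm

end DH

namespace GvG

/-- Stable clopen upsets correspond to the stable closed subsets of `X₀`. -/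
noncomputable def maxIso (G : GvG.{u}) : G.L ≃o ((functorH hWellDefined).obj G).L where
  toEquiv := equivOfRange G.polRep_max.u_injective G.closedSets_R₀
  map_rel_iff' := G.polRep_max.u_subset_iff

/-- The natural isomorphism `δ`. -/
noncomputable def maxNatIso : GvG.latFunctor.{u} ≅ (functorH hWellDefined).op ⋙ Hg.latFunctor :=
  NatIso.ofComponents (fun G => BddLat.Iso.mk G.unop.maxIso) fun h =>
    BddLat.ext fun U => Subtype.ext (box_S₀ h.unop U).symm

end GvG

namespace Hg

/-- Stable closed sets correspond to stable sets of maximal pairs. -/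
noncomputable def maxPairsIso (H : Hg.{u}) : H.L ≃o ((functorU uWellDefined).obj H).L where
  toEquiv := equivOfRange H.diagRep.polRep.u_injective H.isUrq.1
  map_rel_iff' := H.diagRep.polRep.u_subset_iff

/-- The natural isomorphism `μ`. -/
noncomputable def maxPairsNatIso :
    Hg.latFunctor.{u} ≅ (functorU uWellDefined).op ⋙ Urq.latFunctor :=
  NatIso.ofComponents (fun H => BddLat.Iso.mk H.unop.maxPairsIso) fun h =>
    BddLat.ext fun A => Subtype.ext (box_P h.unop A).symm

end Hg

namespace Urq

/-- Members of the lattice correspond to clopen filters of `𝖫𝖢 𝒰`. -/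
noncomputable def clopenFilterIso (U : Urq.{u}) : U.L ≃o ((functorD dWellDefined).obj U).CLF where
  toEquiv := Equiv.ofBijective (fun C => ⟨Set.Ici (toLC C), isLatFilter_Ici _,
      U.dhRep.left.isClopen_Ici C⟩)
    ⟨fun _ _ h => U.dhRep.polRep.u_injective (congrArg Subtype.val h), by
      intro F
      -- A clopen filter is principal on a compact element, and the compact elements of `𝖫𝖢` are the
      -- members of the lattice.
      obtain ⟨hk, hF⟩ := DH.gen_spec F
      obtain ⟨C, hC⟩ := U.dhRep.left.exists_eq hk
      exact ⟨C, Subtype.ext ((congrArg Set.Ici hC).trans hF.symm)⟩⟩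
  map_rel_iff' := U.dhRep.polRep.u_subset_iff

/-- The natural isomorphism `ξ`. -/
noncomputable def clopenFilterNatIso :
    Urq.latFunctor.{u} ≅ (functorD dWellDefined).op ⋙ DH.latFunctor :=
  NatIso.ofComponents (fun U => BddLat.Iso.mk U.unop.clopenFilterIso) fun h =>
    BddLat.ext fun C => Subtype.ext (Set.ext fun D => (toLC_le_map_iff h.unop C D).symm)

/-- The lattices of an Urquhart space and of the corresponding Ploščica space coincide. -/
def ploIso (U : Urq.{u}) : U.L ≃o ((functorP pWellDefined).obj U).L where
  toEquiv := Equiv.setCongr U.isUrq.closedSets_eq.symm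
  map_rel_iff' := Iff.rfl

/-- The natural isomorphism `π`. -/
def ploNatIso : Urq.latFunctor.{u} ≅ (functorP pWellDefined).op ⋙ Plo.latFunctor :=
  NatIso.ofComponents (fun U => BddLat.Iso.mk U.unop.ploIso) fun _ =>
    BddLat.ext fun _ => rfl

end Urq

/-! ### The lattice functors are fully faithful -/

/-- The principal elements below `f x` and below `g y` are prescribed by the lattice map; for `g`
this is the fact that the first component determines the second. -/
instance : DH.latFunctor.{u}.Faithful where
  map_injective {D E} h k hk := by
    have e : DH.latMap h.unop = DH.latMap k.unop := congrArg BddLat.Hom.hom hk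
    refine Quiver.Hom.unop_inj (DH.Hom.ext (funext fun x => ?_) (funext fun y => ?_))
    · exact D.unop.dhRep.left.ext fun F => by
        rw [DH.gen_le_map_iff, DH.gen_le_map_iff, e]
    · exact D.unop.dhRep.right.ext fun F => by
        refine (DH.cogen_le_map_iff h.unop F.ofDual y).trans ?_
        rw [e]
        exact (DH.cogen_le_map_iff k.unop F.ofDual y).symm

/-- The morphism of Dunn–Hartonas spaces induced by a homomorphism of the lattices of clopen
filters. -/
def DH.homOfLat {D E : DH.{u}} (φ : BoundedLatticeHom E.CLF D.CLF) : D ⟶ E where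
  f x := sSup (DH.gen '' {F | DH.gen (φ F) ≤ x})
  g y := sSup ((fun F : E.CLFᵒᵈ => DH.cogen F.ofDual) ''
    {F | DH.cogen (φ F.ofDual) ≤ y})
  isHom :=
    haveI := D.isDH.lawson_left
    haveI := D.isDH.lawson_right
    haveI := E.isDH.lawson_left
    haveI := E.isDH.lawson_right
    D.dhRep.isDHHom E.dhRep φ
      (fun _ x => E.dhRep.left.le_sSup_iff ((D.dhRep.left.isLatFilter x).comap φ))
      fun c y => E.dhRep.right.le_sSup_iff (c := OrderDual.toDual c)
        ((D.dhRep.right.isLatFilter y).comap (BoundedLatticeHom.dual φ))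

instance : DH.latFunctor.{u}.Full where
  map_surjective {D E} φ := by
    refine ⟨(DH.homOfLat φ.hom).op, BddLat.ext fun F => ?_⟩
    refine Subtype.ext (Set.ext fun x => ?_)
    change F.1 (sSup _) ↔ _
    refine (DH.mem_iff F _).trans (Iff.trans ?_ (DH.mem_iff (D := E.unop) _ x).symm)
    exact D.unop.dhRep.left.le_sSup_iff ((E.unop.dhRep.left.isLatFilter x).comap φ.hom)

theorem GvG.range_val (G : GvG.{u}) : Set.range (fun U : G.L => U.1) = gvgSets G.R :=
  Subtype.range_coe

instance : GvG.latFunctor.{u}.Faithful where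
  map_injective {G H} h k hk := by
    have e : GvG.latMap h.unop = GvG.latMap k.unop := congrArg BddLat.Hom.hom hk
    refine Quiver.Hom.unop_inj (GvG.Hom.ext ?_ ?_)
    · rw [(GvG.hom_eq h.unop).1, (GvG.hom_eq k.unop).1, e]
    · rw [(GvG.hom_eq h.unop).2, (GvG.hom_eq k.unop).2, e]

/-- The relations `canRel` of `φ` form a morphism whose box is `φ` itself, by `box_canRel`.
Contravariance makes it run from the space of the codomain to that of the domain. -/
instance : GvG.latFunctor.{u}.Full where
  map_surjective {G H} φ := by
    have hφ := H.unop.polRep.isBoxHom_canRel G.unop.polRep φ.hom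
    rw [GvG.range_val, GvG.range_val] at hφ
    exact ⟨Quiver.Hom.op (X := H.unop) ⟨_, _, hφ, H.unop.polRep.canRel_compat G.unop.polRep φ.hom⟩,
      BddLat.ext fun U => Subtype.ext (H.unop.polRep.box_canRel G.unop.polRep φ.hom U)⟩

instance : Hg.latFunctor.{u}.Faithful where
  map_injective {G H} h k hk := by
    have e : Hg.latMap h.unop = Hg.latMap k.unop := congrArg BddLat.Hom.hom hk
    refine Quiver.Hom.unop_inj (Hg.Hom.ext ?_ ?_)
    · rw [(Hg.hom_eq h.unop).1, (Hg.hom_eq k.unop).1, e]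
    · rw [(Hg.hom_eq h.unop).2, (Hg.hom_eq k.unop).2, e]

instance : Hg.latFunctor.{u}.Full where
  map_surjective {G H} φ := by
    have hφ := H.unop.polRep.isBoxHom_canRel G.unop.polRep φ.hom
    rw [Hg.range_val, Hg.range_val] at hφ
    exact ⟨Quiver.Hom.op (X := H.unop) ⟨_, _, hφ, H.unop.polRep.canRel_compat G.unop.polRep φ.hom⟩,
      BddLat.ext fun U => Subtype.ext (H.unop.polRep.box_canRel G.unop.polRep φ.hom U)⟩

namespace Urq

theorem urqSets_eq_range (U : Urq.{u}) :
    urqSets U.le₁ U.le₂ = Set.range (fun C : U.L => C.1) ∧ IsUrq U.le₁ U.le₂ :=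
  ⟨Subtype.range_coe.symm, U.isUrq⟩

theorem hom_eq {U V : Urq.{u}} (h : U ⟶ V) :
    h.P = canRel (fun C : U.L => C.1) (fun C : V.L => C.1) (latMap h) ∧
      h.Q = canRel (fun C : U.L => U.phi C.1) (fun C : V.L => V.phi C.1) (latMap h) := by
  have hh := ((isUrqHom_iff U.isUrq V.isUrq).1 h.isHom).toIsBoxHom
  rw [U.isUrq.closedSets_eq, V.isUrq.closedSets_eq, U.urqSets_eq_range.1,
    V.urqSets_eq_range.1] at hh
  exact hh.eq_canRel U.diagRep.polRep V.diagRep.polRep fun _ => rfl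

end Urq

instance : Urq.latFunctor.{u}.Faithful where
  map_injective {U V} h k hk := by
    have e : Urq.latMap h.unop = Urq.latMap k.unop := congrArg BddLat.Hom.hom hk
    refine Quiver.Hom.unop_inj (Urq.Hom.ext ?_ ?_)
    · rw [(Urq.hom_eq h.unop).1, (Urq.hom_eq k.unop).1, e]
    · rw [(Urq.hom_eq h.unop).2, (Urq.hom_eq k.unop).2, e]

instance : Urq.latFunctor.{u}.Full where
  map_surjective {U V} φ :=
    ⟨Quiver.Hom.op (X := V.unop) ⟨_, _, V.unop.diagRep.isUrqHom U.unop.diagRep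
      V.unop.urqSets_eq_range U.unop.urqSets_eq_range φ.hom⟩,
      BddLat.ext fun C => Subtype.ext
        (V.unop.diagRep.polRep.box_canRel U.unop.diagRep.polRep φ.hom C)⟩

/-! ### Every lattice is the lattice of an Urquhart space -/

section Canonical

variable (L : Type u) [Lattice L] [BoundedOrder L]

/-- A filter and an ideal are related when they are disjoint. -/
def disjRel (F : {F : Set L // IsLatFilter F}) (I : {I : Set L // IsLatIdeal I}) : Prop :=
  ∀ c ∈ F.1, c ∉ I.1

/-- The tautological representation, in which `rich` returns its own input. Its maximal pairs supply
the points of the Urquhart space. -/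
theorem polRep_disjRel : PolRep (disjRel L) (fun c => {F | c ∈ F.1}) (fun c => {I | c ∈ I.1}) where
  filt F := F.2
  idl I := I.2
  rel _ _ := Iff.rfl
  rich F I hF hI hd := ⟨⟨F, hF⟩, ⟨I, hI⟩, hd, fun _ h => h, fun _ h => h⟩

/-- The maximal disjoint pairs of a filter and an ideal. -/
abbrev MaxDisjPairs : Type u :=
  {p : {F : Set L // IsLatFilter F} × {I : Set L // IsLatIdeal I} //
    IsMaxLeft (disjRel L) p.1 p.2 ∧ IsMaxRight (disjRel L) p.1 p.2}

theorem diagRep_maxDisjPairs : DiagRep (Z := MaxDisjPairs L)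
    (fun p q => leX (disjRel L) p.1.1 q.1.1) (fun p q => leY (disjRel L) p.1.2 q.1.2)
    (fun c => {p | c ∈ p.1.1.1}) (fun c => {p | c ∈ p.1.2.1}) :=
  (polRep_disjRel L).diagRep_maxPairs
    (fun _ _ h1 h2 => Subtype.ext (Set.Subset.antisymm
      (fun c => (polRep_disjRel L).leX_iff.1 h1 c) fun c => (polRep_disjRel L).leX_iff.1 h2 c))
    (fun _ _ h1 h2 => Subtype.ext (Set.Subset.antisymm
      (fun c => (polRep_disjRel L).leY_iff.1 h1 c) fun c => (polRep_disjRel L).leY_iff.1 h2 c))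

instance : TopologicalSpace (MaxDisjPairs L) :=
  TopologicalSpace.generateFrom (Set.range (fun c => {p : MaxDisjPairs L | c ∈ p.1.1.1}ᶜ) ∪
    Set.range fun c => {p : MaxDisjPairs L | c ∈ p.1.2.1}ᶜ)

theorem isUrq_maxDisjPairs :
    urqSets (Z := MaxDisjPairs L) (fun p q => leX (disjRel L) p.1.1 q.1.1)
        (fun p q => leY (disjRel L) p.1.2 q.1.2) =
      Set.range (fun c => {p : MaxDisjPairs L | c ∈ p.1.1.1}) ∧
    IsUrq (Z := MaxDisjPairs L) (fun p q => leX (disjRel L) p.1.1 q.1.1)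
      (fun p q => leY (disjRel L) p.1.2 q.1.2) :=
  (diagRep_maxDisjPairs L).isUrq maxPairs_antisymm rfl

/-- The Urquhart space of a lattice. -/
def Urq.ofLat : Urq.{u} := ⟨MaxDisjPairs L, _, _, (isUrq_maxDisjPairs L).2⟩

/-- Every bounded lattice is isomorphic to that of its Urquhart space. -/
noncomputable def Urq.ofLatIso : L ≃o (Urq.ofLat L).L where
  toEquiv := equivOfRange (diagRep_maxDisjPairs L).polRep.u_injective (isUrq_maxDisjPairs L).1
  map_rel_iff' := (diagRep_maxDisjPairs L).polRep.u_subset_iff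

end Canonical

/-! ### The equivalences -/

/-- `F` followed by the double-opposite equivalence is `F.op.rightOp`, so the second factor can be
cancelled. -/
theorem isEquivalence_of_op {C D : Type*} [Category* C] [Category* D] (F : C ⥤ D)
    [F.op.IsEquivalence] : F.IsEquivalence :=
  have : (F ⋙ opOp D).IsEquivalence := inferInstanceAs F.op.rightOp.IsEquivalence
  Functor.isEquivalence_of_comp_right F (opOp D)

/-- Objects reached by `G` are reached by `H` through `F.op`; applied to `𝔻`, `𝔾` and `ℍ` in turn,
this spreads essential surjectivity from Urquhart spaces to the others. -/
theorem essSurj_of_iso_op_comp {C D E : Type*} [Category* C] [Category* D] [Category* E] {F : C ⥤ D}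
    {G : Cᵒᵖ ⥤ E} {H : Dᵒᵖ ⥤ E} (e : G ≅ F.op ⋙ H) [G.EssSurj] : H.EssSurj :=
  ⟨fun Z => ⟨F.op.obj (G.objPreimage Z), ⟨(e.app _).symm ≪≫ G.objObjPreimageIso Z⟩⟩⟩

theorem isEquivalence_of_iso_op_comp {C D E : Type*} [Category* C] [Category* D] [Category* E]
    {F : C ⥤ D} {G : Cᵒᵖ ⥤ E} {H : Dᵒᵖ ⥤ E} (e : G ≅ F.op ⋙ H) [G.IsEquivalence]
    [H.IsEquivalence] : F.IsEquivalence :=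
  have := Functor.isEquivalence_of_iso e
  have := Functor.isEquivalence_of_comp_right F.op H
  isEquivalence_of_op F

instance isEquivalence_urq : Urq.latFunctor.{u}.IsEquivalence where
  essSurj := ⟨fun L => ⟨op (Urq.ofLat L), ⟨(BddLat.Iso.mk (Urq.ofLatIso L)).symm⟩⟩⟩

instance isEquivalence_dh : DH.latFunctor.{u}.IsEquivalence where
  essSurj := essSurj_of_iso_op_comp Urq.clopenFilterNatIso

instance isEquivalence_gvg : GvG.latFunctor.{u}.IsEquivalence where
  essSurj := essSurj_of_iso_op_comp DH.primeNatIso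

instance isEquivalence_hg : Hg.latFunctor.{u}.IsEquivalence where
  essSurj := essSurj_of_iso_op_comp GvG.maxNatIso

/-- Morphisms on both sides are the same pairs of relations by `isUrqHom_iff`, and each Ploščica
space equals the image of its own doubly ordered set, so `eqToIso` suffices. -/
instance isEquivalence_functorP : (functorP.{u} pWellDefined).IsEquivalence where
  faithful := ⟨fun h => Urq.Hom.ext (congrArg Plo.Hom.P h) (congrArg Plo.Hom.Q h)⟩
  full := ⟨fun {U V} h => ⟨⟨h.P, h.Q, (isUrqHom_iff U.isUrq V.isUrq).2 h.isHom⟩, rfl⟩⟩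
  essSurj := ⟨fun A => ⟨⟨A.Z, leX A.R, leY A.R, (isUrq_of_isPlo A.isPlo).2⟩, ⟨eqToIso (by
    have e := (isUrq_of_isPlo A.isPlo).1
    obtain ⟨Z, R, h⟩ := A
    change Plo.mk Z (commonUpper (leX R) (leY R)) _ = _
    congr)⟩⟩⟩

instance isEquivalence_plo : Plo.latFunctor.{u}.IsEquivalence :=
  have := Functor.isEquivalence_of_iso Urq.ploNatIso.{u}
  Functor.isEquivalence_of_comp_left (functorP pWellDefined).op Plo.latFunctor

end LatDual

theorem mainTheorem9 :
    ∃ (wG : GWellDefined.{u}) (wH : HWellDefined.{u}) (wU : UWellDefined.{u})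
      (wD : DWellDefined.{u}) (wP : PWellDefined.{u}),
      -- the triangles commute up to natural isomorphism
      (∃ γ : DH.latFunctor.{u} ≅ (functorG wG).op ⋙ GvG.latFunctor.{u},
        ∀ (D : DH.{u}) (F : D.CLF),
          ((γ.hom.app (op D)).hom F : ((functorG wG).obj D).L).1 = {x | x.1 ∈ F.1}) ∧
      (∃ δ : GvG.latFunctor.{u} ≅ (functorH wH).op ⋙ Hg.latFunctor.{u},
        ∀ (G : GvG.{u}) (A : G.L),
          ((δ.hom.app (op G)).hom A : ((functorH wH).obj G).L).1 = {x | x.1 ∈ A.1}) ∧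
      (∃ μ : Hg.latFunctor.{u} ≅ (functorU wU).op ⋙ Urq.latFunctor.{u},
        ∀ (H : Hg.{u}) (A : H.L),
          ((μ.hom.app (op H)).hom A : ((functorU wU).obj H).L).1 = {p | p.1.1 ∈ A.1}) ∧
      (∃ ξ : Urq.latFunctor.{u} ≅ (functorD wD).op ⋙ DH.latFunctor.{u},
        ∀ (U : Urq.{u}) (C : U.L),
          ((ξ.hom.app (op U)).hom C : ((functorD wD).obj U).CLF).1 = {E | E.1 ⊆ C.1}) ∧
      (∃ π : Urq.latFunctor.{u} ≅ (functorP wP).op ⋙ Plo.latFunctor.{u},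
        ∀ (U : Urq.{u}) (C : U.L),
          ((π.hom.app (op U)).hom C : ((functorP wP).obj U).L).1 = C.1) ∧
      -- the functors between the relational categories are equivalences
      (functorG wG).IsEquivalence ∧ (functorH wH).IsEquivalence ∧ (functorU wU).IsEquivalence ∧
      (functorD wD).IsEquivalence ∧ (functorP wP).IsEquivalence ∧
      -- all the categories are dually equivalent to bounded lattices
      DH.latFunctor.{u}.IsEquivalence ∧ GvG.latFunctor.{u}.IsEquivalence ∧
      Hg.latFunctor.{u}.IsEquivalence ∧ Urq.latFunctor.{u}.IsEquivalence ∧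
      Plo.latFunctor.{u}.IsEquivalence :=
  ⟨gWellDefined, hWellDefined, uWellDefined, dWellDefined, pWellDefined,
    -- `γ` was built from least elements, whence the appeal to `DH.mem_iff`; the other four formulas
    -- hold by definition.
    ⟨DH.primeNatIso, fun _ F => Set.ext fun x => (DH.mem_iff F x.1).symm⟩,
    ⟨GvG.maxNatIso, fun _ _ => rfl⟩,
    ⟨Hg.maxPairsNatIso, fun _ _ => rfl⟩,
    ⟨Urq.clopenFilterNatIso, fun _ _ => rfl⟩,
    ⟨Urq.ploNatIso, fun _ _ => rfl⟩,
    -- Each functor is an equivalence by two-out-of-three, both lattice functors in its triangle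
    -- being dual equivalences.
    isEquivalence_of_iso_op_comp DH.primeNatIso,
    isEquivalence_of_iso_op_comp GvG.maxNatIso,
    isEquivalence_of_iso_op_comp Hg.maxPairsNatIso,
    isEquivalence_of_iso_op_comp Urq.clopenFilterNatIso,
    inferInstance, inferInstance, inferInstance, inferInstance, inferInstance, inferInstance⟩
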